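/- **General linear discrepancy theorem.** Let $m\ge 1$ and let $\mathcal D$ be a probability distribution on $\mathbb R^m$ with finite second moments, mean $\mu$ and covariance matrix $\Sigma$; put $\sigma=\|\Sigma\|_{\mathrm{op}}^{1/2}$ and assume $\sigma>0$. Let $$\Lambda=\{v\in\mathbb R^m:\langle v,w\rangle\in\mathbb Z\ \text{ for all } w\in\mathrm{support}(\mathcal D)\},\qquad V=\{\theta\in\mathbb R^m:\ \|\theta\|\le\|\theta-w\|\ \text{ for all } 0\ne w\in \Lambda\}.$$ $\mathcal D$ is *admissible* if $\Pr_{X\sim\mathcal D}[\langle X,\nu\rangle\ge\langle\mu,\nu\rangle]\ge \frac1{4e^2}$ for all $\nu\in\mathbb R^m$. It is *anti-concentrated with constant* $\kappa$ if for all $\nu\in\mathbb R^m$ and $\theta\in V$, $$\Pr_{X\sim\mathcal D}\big[d(\langle\theta,X\rangle,\mathbb Z)\ge\kappa\min(1,\|\theta\|_\infty\sigma)\ \big|\ \langle\nu,X\rangle\le\langle\nu,\mu\rangle\big]\ge\kappa .$$ There is an exponent $K\in\mathbb N$ such that for every $\kappa_0>0$ there are constants $C,c>0$, depending only on $\kappa_0$,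 with the following property. Let $\mathcal D$ be admissible and anti-concentrated with a constant $\kappa\ge\kappa_0$, let $p\in[0,1]$ and $n\in\mathbb N$, and assume - $p\le\frac{\kappa^4}{1000m^5}$ and $p\ge C\,m^{3/4}\left(\frac{\|\mu\|}{\sigma}+1\right)^{3/2}n^{-1/4}$; - $n\ge C m^K$; - $\sigma\sqrt{m/\kappa}+\|\mu\|\le e^{\kappa^3pn/(80m)}$ and $\left(1+\frac{\|\mu\|^2}{\sigma^2}\right)^{1/m}\le\dfrac{\kappa^3\exp\left(\frac{\kappa^3}{3\cdot 80^2pm^3}\right)}{50000m^2}$. Let $A\in\mathbb R^{m\times n}$ have i.i.d. columns with law $\mathcal D$. - *Continuous case.* If $V=\mathbb R^m$ (for example, if $\mathcal D$ is absolutely continuous), then with probability at least $1-e^{-cpn}$ over $A$, for every $\lambda\in\mathbb R^m$ with $\|\lambda-pn\mu\|\le\sigma p\sqrt{mn}$ there is $S\subseteq[n]$ with $|S|\in[\frac12pn,\frac32pn]$ and $\|A\mathbf 1_S-\lambda\|\le n^4\exp\left(-\frac{\kappa^3pn}{m}\right)$. - *Discrete case.* If $\Lambda=\mathbb Z^m$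 (so that $\mathrm{support}(\mathcal D)\subseteq\mathbb Z^m$), then with probability at least $1-e^{-cpn}$ over $A$, for every $\lambda\in\mathbb Z^m$ with $\|\lambda-pn\mu\|\le\sigma p\sqrt{mn}$ there is $S\subseteq[n]$ with $|S|\in[\frac12pn,\frac32pn]$ and $A\mathbf 1_S=\lambda$. -/

import Mathlib

open MeasureTheory

noncomputable section

namespace RandomDisc

/-- `ℝ^m` with the Euclidean norm and inner product. -/
abbrev Vec (m : ℕ) : Type := EuclideanSpace ℝ (Fin m)

variable {m : ℕ}

/-- The mean of a distribution on `ℝ^m`. -/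
def mean (D : Measure (Vec m)) : Vec m := ∫ x, x ∂D

/-- The covariance matrix of a distribution on `ℝ^m`. -/
def covMatrix (D : Measure (Vec m)) : Matrix (Fin m) (Fin m) ℝ :=
  Matrix.of fun i j => ∫ x, (x i - mean D i) * (x j - mean D j) ∂D

/-- The square root of the operator norm of the covariance matrix. -/
def sigma (D : Measure (Vec m)) : ℝ :=
  Real.sqrt ‖Matrix.toEuclideanCLM (𝕜 := ℝ) (covMatrix D)‖

/-- The vectors whose inner product with every point of the support of `D` is an integer. -/
def dualLattice (D : Measure (Vec m)) : Set (Vec m) :=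
  {v | ∀ w ∈ D.support, ∃ k : ℤ, inner ℝ v w = (k : ℝ)}

/-- The fundamental domain in Fourier space: the points which are at least as close to the origin
as to every nonzero point of the dual lattice. It is everything when there is no such point. -/
def fundDomain (D : Measure (Vec m)) : Set (Vec m) :=
  {θ | ∀ w ∈ dualLattice D, w ≠ 0 → ‖θ‖ ≤ ‖θ - w‖}

/-- The set `ℤ^m` inside `ℝ^m`. -/
def integerPoints (m : ℕ) : Set (Vec m) := {v | ∀ i, ∃ k : ℤ, v i = (k : ℝ)}

/-- The distance of a real number to the integers. -/
def distInt (x : ℝ) : ℝ := Metric.infDist x (Set.range fun k : ℤ => (k : ℝ))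

/-- The maximum norm of a vector. -/
def supNorm (θ : Vec m) : ℝ := ⨆ i, |θ i|

/-- Every closed half-space with the mean on its boundary has mass at least `1 / (4 e^2)`. -/
def Admissible (D : Measure (Vec m)) : Prop :=
  ∀ ν : Vec m, 1 / (4 * Real.exp 1 ^ 2) ≤ D.real {x | inner ℝ (mean D) ν ≤ inner ℝ x ν}

/-- Anti-concentration with constant `κ`: conditionally on any closed half-space with the mean
on its boundary, `⟨θ, X⟩` is far from the integers with probability at least `κ`. -/
def AntiConcentrated (D : Measure (Vec m)) (κ : ℝ) : Prop :=
  ∀ ν : Vec m, ∀ θ ∈ fundDomain D,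
    κ ≤ (ProbabilityTheory.cond D {x | inner ℝ ν x ≤ inner ℝ ν (mean D)}).real
      {x | κ * min 1 (supNorm θ * sigma D) ≤ distInt (inner ℝ θ x)}

/-- The law of the columns of a random matrix with `n` independent columns of law `D`. -/
def columnsLaw (n : ℕ) (D : Measure (Vec m)) : Measure (Fin n → Vec m) :=
  Measure.pi fun _ => D

/-- The image `A 1_S` of the indicator vector of `S`, where `A` is given by its columns. -/
def subsetSum {n : ℕ} (A : Fin n → Vec m) (S : Finset (Fin n)) : Vec m := ∑ j ∈ S, A j

end RandomDisc

end

noncomputable section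

namespace RandomDisc

variable {m : ℕ}

/-! ### The maximum norm -/

/-! Choose a random `S` by taking each column near the mean independently, column `j` with a
probability `q j` close to `p`, the `q j` being tuned so that the expected subset sum is exactly the
target `l`. A local limit argument then shows that the sum falls on, or very near, `l` with positive
probability. For a weight `w` on frequency space, the average over `S` of the cosine transform of
`w` at `subsetSum A S - l` equals `∫ w · Re φ`, with `φ` the characteristic function of the centred
sum. A Gaussian `w` has a transform that exceeds a suitable threshold only near the origin
(continuous case); the indicator of the unit cube has one that vanishes at all nonzero integer
points (discrete case).

The integral is bounded below with the help of the quadratic form `Q θ = p ∑ ⟨θ, A j⟩²`. Where `Q <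
20 m²`, a Taylor expansion gives `Re φ > 0`, with a constant lower bound where `Q < 1`
(`re_subsetChar_ge`). Elsewhere `|φ|` is controlled by the distances of the `⟨θ, A j⟩` to the
integers: either none of these numbers wraps around and `|φ| ≤ exp (-7Q)`, or anti-concentration
makes `|φ|` exponentially small (`Regular.norm_subsetChar_le`). The tail of `exp (-Q)` is compared
with the volume of the ellipsoid `Q < 1` by `integral_exp_neg_quadForm`, and the remaining errors
with a cube inside that ellipsoid. `Regular.exists_subset` combines these bounds.

What is needed of the matrix is collected in `Regular`, which does not mention `l`; hence one event
serves all targets at once. It is likely by Chebyshev and Chernoff, by Hoeffding for truncated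
columns, and by a union bound over a grid of frequencies (`columnsLaw_real_not_regular_le`). In the
continuous case the grid is exponentially large, roughly `exp (κ³pn)`, which is affordable because a
single frequency fails with probability at most `exp (-κn/8)` and `p` is much smaller than `κ`.
Suitable `q j` exist because the zonotope spanned by the columns is fat in every direction
(`exists_sum_smul_eq`, `Regular.exists_weights`). -/

theorem supNorm_eq (θ : Vec m) : supNorm θ = ‖(WithLp.ofLp θ : Fin m → ℝ)‖ := by
  unfold supNorm
  apply le_antisymm
  · exact Real.iSup_le (fun i => by simpa using norm_le_pi_norm (WithLp.ofLp θ) i) (norm_nonneg _)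
  · rw [pi_norm_le_iff_of_nonneg (Real.iSup_nonneg fun i => abs_nonneg _)]
    intro i
    rw [Real.norm_eq_abs]
    exact le_ciSup (f := fun i => |θ i|) (Set.finite_range _).bddAbove i

theorem supNorm_nonneg (θ : Vec m) : 0 ≤ supNorm θ := by
  rw [supNorm_eq]; exact norm_nonneg _

theorem abs_apply_le_supNorm (θ : Vec m) (i : Fin m) : |θ i| ≤ supNorm θ := by
  rw [supNorm_eq]; exact norm_le_pi_norm (WithLp.ofLp θ) i

theorem supNorm_le_iff {θ : Vec m} {a : ℝ} (ha : 0 ≤ a) : supNorm θ ≤ a ↔ ∀ i, |θ i| ≤ a := by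
  rw [supNorm_eq, pi_norm_le_iff_of_nonneg ha]; rfl

theorem supNorm_smul (t : ℝ) (θ : Vec m) : supNorm (t • θ) = |t| * supNorm θ := by
  rw [supNorm_eq, supNorm_eq, WithLp.ofLp_smul, norm_smul, Real.norm_eq_abs]

theorem supNorm_sub_le (θ θ' : Vec m) : supNorm θ ≤ supNorm θ' + supNorm (θ - θ') := by
  simp only [supNorm_eq, WithLp.ofLp_sub]
  have := norm_add_le (WithLp.ofLp θ') (WithLp.ofLp θ - WithLp.ofLp θ')
  simpa using this

theorem supNorm_eq_zero {θ : Vec m} : supNorm θ = 0 ↔ θ = 0 := by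
  rw [supNorm_eq, norm_eq_zero]
  simp

theorem continuous_supNorm : Continuous (supNorm : Vec m → ℝ) := by
  have : (supNorm : Vec m → ℝ) = fun θ => ‖(WithLp.ofLp θ : Fin m → ℝ)‖ := funext supNorm_eq
  rw [this]
  fun_prop

theorem supNorm_le_norm (θ : Vec m) : supNorm θ ≤ ‖θ‖ := by
  rw [supNorm_le_iff (norm_nonneg _)]
  intro i
  simpa using PiLp.norm_apply_le θ i

theorem norm_le_sqrt_mul_supNorm (θ : Vec m) : ‖θ‖ ≤ √m * supNorm θ := by
  rw [EuclideanSpace.norm_eq]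
  have h : ∑ i, ‖θ i‖ ^ 2 ≤ (m : ℝ) * supNorm θ ^ 2 := by
    calc ∑ i, ‖θ i‖ ^ 2 ≤ ∑ _i : Fin m, supNorm θ ^ 2 := by
          apply Finset.sum_le_sum
          intro i _
          exact pow_le_pow_left₀ (norm_nonneg _) (abs_apply_le_supNorm θ i) 2
      _ = _ := by simp
  calc √(∑ i, ‖θ i‖ ^ 2) ≤ √((m : ℝ) * supNorm θ ^ 2) := Real.sqrt_le_sqrt h
    _ = _ := by rw [Real.sqrt_mul (by positivity), Real.sqrt_sq (supNorm_nonneg _)]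

theorem abs_inner_le_supNorm (θ x : Vec m) : |inner ℝ θ x| ≤ √m * supNorm θ * ‖x‖ :=
  (abs_real_inner_le_norm θ x).trans
    (mul_le_mul_of_nonneg_right (norm_le_sqrt_mul_supNorm θ) (norm_nonneg _))

theorem inner_le_supNorm_mul_sum (θ x : Vec m) : inner ℝ θ x ≤ supNorm θ * ∑ i, |x i| := by
  rw [PiLp.inner_apply, Finset.mul_sum]
  apply Finset.sum_le_sum
  intro i _
  calc inner ℝ (θ i) (x i) ≤ |inner ℝ (θ i) (x i)| := le_abs_self _
    _ = |θ i| * |x i| := by simp [abs_mul, mul_comm]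
    _ ≤ _ := mul_le_mul_of_nonneg_right (abs_apply_le_supNorm θ i) (abs_nonneg _)

theorem volume_supNorm_le (a : ℝ) (ha : 0 ≤ a) :
    volume {θ : Vec m | supNorm θ ≤ a} = ENNReal.ofReal ((2 * a) ^ m) := by
  have h := (EuclideanSpace.volume_preserving_symm_measurableEquiv_toLp (Fin m)).measure_preimage
    (Metric.isClosed_closedBall (x := (0 : Fin m → ℝ)) (ε := a)).measurableSet.nullMeasurableSet
  rw [Real.volume_pi_closedBall _ ha, Fintype.card_fin] at h
  rw [← h]
  congr 1
  ext θ
  simp [supNorm_eq]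

/-! ### The distance to the integers -/

theorem distInt_eq (x : ℝ) : distInt x = |x - round x| := by
  unfold distInt
  apply le_antisymm
  · exact Metric.infDist_le_dist_of_mem ⟨round x, rfl⟩
  · rw [Metric.le_infDist (Set.range_nonempty _)]
    rintro _ ⟨k, rfl⟩
    exact round_le x k

theorem distInt_nonneg (x : ℝ) : 0 ≤ distInt x := Metric.infDist_nonneg

theorem distInt_le_half (x : ℝ) : distInt x ≤ 1 / 2 := by
  rw [distInt_eq]; exact abs_sub_round x

theorem distInt_le_abs_sub (x : ℝ) (k : ℤ) : distInt x ≤ |x - k| := by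
  rw [distInt_eq]; exact round_le x k

theorem distInt_le_abs (x : ℝ) : distInt x ≤ |x| := by
  simpa using distInt_le_abs_sub x 0

theorem distInt_of_abs_le {x : ℝ} (hx : |x| ≤ 1 / 2) : distInt x = |x| := by
  apply le_antisymm (distInt_le_abs x)
  rw [distInt_eq]
  by_cases h : round x = 0
  · simp [h]
  · have h1 : (1 : ℝ) ≤ |(round x : ℝ)| := by exact_mod_cast Int.one_le_abs h
    have h2 := abs_sub_abs_le_abs_sub (round x : ℝ) x
    rw [abs_sub_comm] at h2
    linarith

theorem distInt_le_add (x y : ℝ) : distInt x ≤ distInt y + |x - y| := by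
  have := Metric.infDist_le_infDist_add_dist (s := Set.range fun k : ℤ => (k : ℝ)) (x := x) (y := y)
  simpa [distInt, Real.dist_eq] using this

theorem continuous_distInt : Continuous distInt := Metric.continuous_infDist_pt _

/-! ### The characteristic function of a Bernoulli variable -/

/-- The character `t ↦ exp (2 π i t)`. -/
def chr (t : ℝ) : ℂ := Complex.exp ((2 * Real.pi * t : ℝ) * Complex.I)

theorem chr_add (s t : ℝ) : chr (s + t) = chr s * chr t := by
  unfold chr; rw [← Complex.exp_add]; congr 1; push_cast; ring

theorem norm_chr (t : ℝ) : ‖chr t‖ = 1 := Complex.norm_exp_ofReal_mul_I _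

theorem chr_sum {ι : Type*} (s : Finset ι) (f : ι → ℝ) : chr (∑ i ∈ s, f i) = ∏ i ∈ s, chr (f i) := by
  unfold chr; rw [← Complex.exp_sum]; congr 1; push_cast; rw [Finset.mul_sum, Finset.sum_mul]

theorem continuous_chr : Continuous chr := by unfold chr; fun_prop

/-- With `d` the distance to the integers, `1 - cos 2πt = 2 sin² πd`, and Jordan's inequality gives
`sin πd ≥ 2d`. -/
theorem cos_two_pi_le (t : ℝ) : Real.cos (2 * Real.pi * t) ≤ 1 - 8 * distInt t ^ 2 := by
  have hc : Real.cos (2 * Real.pi * t) = Real.cos (2 * (Real.pi * distInt t)) := by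
    have h1 : Real.cos (2 * Real.pi * t) = Real.cos (2 * Real.pi * (t - round t)) := by
      have := Real.cos_sub_int_mul_two_pi (2 * Real.pi * t) (round t)
      rw [← this]; ring_nf
    rw [h1, distInt_eq, ← Real.cos_abs, abs_mul, abs_of_pos Real.two_pi_pos, mul_assoc]
  have hd := distInt_nonneg t
  have hs : 2 * distInt t ≤ Real.sin (Real.pi * distInt t) := by
    have := Real.mul_le_sin (x := Real.pi * distInt t) (by positivity)
      (by nlinarith [Real.pi_pos, distInt_le_half t])
    rwa [show 2 / Real.pi * (Real.pi * distInt t) = 2 * distInt t by field_simp] at this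
  rw [hc, Real.cos_two_mul]
  have h3 : (2 * distInt t) ^ 2 ≤ Real.sin (Real.pi * distInt t) ^ 2 :=
    pow_le_pow_left₀ (by positivity) hs 2
  nlinarith [Real.sin_sq_add_cos_sq (Real.pi * distInt t)]

/-- The squared modulus is `1 - 2q(1-q)(1 - cos 2πt)`, to which `cos_two_pi_le` and `1 + x ≤ e^x`
apply. The decay depends on `t` through `distInt`, the quantity that anti-concentration controls. -/
theorem norm_bernoulli_chr_le {q : ℝ} (h0 : 0 ≤ q) (h1 : q ≤ 1) (t : ℝ) :
    ‖(1 - q : ℂ) + q * chr t‖ ≤ Real.exp (-(8 * q * (1 - q) * distInt t ^ 2)) := by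
  have hsq : ‖(1 - q : ℂ) + q * chr t‖ ^ 2
      = 1 - 2 * q * (1 - q) * (1 - Real.cos (2 * Real.pi * t)) := by
    have he : (1 - q : ℂ) + q * chr t
        = ((1 - q + q * Real.cos (2 * Real.pi * t) : ℝ) : ℂ)
          + ((q * Real.sin (2 * Real.pi * t) : ℝ) : ℂ) * Complex.I := by
      unfold chr
      rw [Complex.exp_mul_I, ← Complex.ofReal_cos, ← Complex.ofReal_sin]
      push_cast; ring
    rw [he, Complex.sq_norm, Complex.normSq_add_mul_I]
    linear_combination q ^ 2 * Real.sin_sq_add_cos_sq (2 * Real.pi * t)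
  have hle : ‖(1 - q : ℂ) + q * chr t‖ ^ 2 ≤ Real.exp (-(8 * q * (1 - q) * distInt t ^ 2)) ^ 2 := by
    rw [hsq, ← Real.exp_nat_mul]
    have hc := cos_two_pi_le t
    have hq : 0 ≤ q * (1 - q) := mul_nonneg h0 (by linarith)
    have := Real.add_one_le_exp (((2 : ℕ) : ℝ) * -(8 * q * (1 - q) * distInt t ^ 2))
    push_cast at this ⊢
    nlinarith
  exact (abs_le_of_sq_le_sq' hle (Real.exp_pos _).le).2

/-- Centring kills the linear Taylor term. The factor `q` in the error matters: summed over the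
columns, the errors are of order `p ∑ |⟨θ, A j⟩|³`. -/
theorem norm_centered_bernoulli_chr_sub_le {q : ℝ} (h0 : 0 ≤ q) (h1 : q ≤ 1) {t : ℝ}
    (ht : |2 * Real.pi * t| ≤ 1) :
    ‖((1 - q : ℂ) + q * chr t) * chr (-(q * t))
      - ((1 - q * (1 - q) * (2 * Real.pi * t) ^ 2 / 2 : ℝ) : ℂ)‖ ≤ q * |2 * Real.pi * t| ^ 3 := by
  set x : ℝ := 2 * Real.pi * t with hx
  have key : ∀ y : ℝ, |y| ≤ 1 →
      ‖Complex.exp ((y : ℂ) * Complex.I) - (1 + y * Complex.I - (y : ℂ) ^ 2 / 2)‖ ≤ |y| ^ 3 / 2 := by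
    intro y hy
    have h := Complex.exp_bound (x := (y : ℂ) * Complex.I) (by simpa using hy) (n := 3) (by norm_num)
    have hn : ‖(y : ℂ) * Complex.I‖ = |y| := by simp
    rw [hn] at h
    simp only [Finset.sum_range_succ, Finset.sum_range_zero] at h
    have e : (0 + ((y : ℂ) * Complex.I) ^ 0 / (Nat.factorial 0 : ℂ)
        + ((y : ℂ) * Complex.I) ^ 1 / (Nat.factorial 1 : ℂ)
        + ((y : ℂ) * Complex.I) ^ 2 / (Nat.factorial 2 : ℂ)) = 1 + y * Complex.I - (y : ℂ) ^ 2 / 2 := by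
      simp [mul_pow, Nat.factorial]; ring
    rw [e] at h
    refine h.trans ?_
    have : 0 ≤ |y| ^ 3 := by positivity
    norm_num [Nat.factorial]
    linarith
  have hxa : |-(q * x)| ≤ 1 := by
    rw [abs_neg, abs_mul, abs_of_nonneg h0]; nlinarith [abs_nonneg x]
  have hxb : |(1 - q) * x| ≤ 1 := by
    rw [abs_mul, abs_of_nonneg (by linarith : (0 : ℝ) ≤ 1 - q)]; nlinarith [abs_nonneg x]
  have ka := key _ hxa
  have kb := key _ hxb
  have e1 : chr (-(q * t)) = Complex.exp (((-(q * x) : ℝ) : ℂ) * Complex.I) := by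
    unfold chr; congr 2; rw [hx]; push_cast; ring
  have e2 : chr t * chr (-(q * t)) = Complex.exp ((((1 - q) * x : ℝ) : ℂ) * Complex.I) := by
    rw [← chr_add]; unfold chr; congr 2; rw [hx]; push_cast; ring
  -- The factor is a mixture of exponentials at `-qx` and `(1-q)x` with weights `1-q` and `q`: the
  -- linear terms cancel and the quadratic ones add up to `q(1-q)x²/2`.
  have e3 : ((1 - q : ℂ) + q * chr t) * chr (-(q * t))
      - ((1 - q * (1 - q) * x ^ 2 / 2 : ℝ) : ℂ)
      = (1 - q : ℂ) * (Complex.exp (((-(q * x) : ℝ) : ℂ) * Complex.I)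
          - (1 + ((-(q * x) : ℝ) : ℂ) * Complex.I - ((-(q * x) : ℝ) : ℂ) ^ 2 / 2))
        + q * (Complex.exp ((((1 - q) * x : ℝ) : ℂ) * Complex.I)
          - (1 + (((1 - q) * x : ℝ) : ℂ) * Complex.I - (((1 - q) * x : ℝ) : ℂ) ^ 2 / 2)) := by
    rw [add_mul, mul_assoc, e2, e1]; push_cast; ring
  rw [e3]
  have n1 : ‖(1 - q : ℂ)‖ = 1 - q := by
    rw [show (1 - q : ℂ) = ((1 - q : ℝ) : ℂ) by push_cast; ring, Complex.norm_real,
      Real.norm_of_nonneg (by linarith)]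
  have n2 : ‖(q : ℂ)‖ = q := by rw [Complex.norm_real, Real.norm_of_nonneg h0]
  refine (norm_add_le _ _).trans ?_
  rw [norm_mul, norm_mul, n1, n2]
  have a1 : |-(q * x)| ^ 3 ≤ q * |x| ^ 3 := by
    rw [abs_neg, abs_mul, abs_of_nonneg h0, mul_pow]
    apply mul_le_mul_of_nonneg_right _ (by positivity)
    calc q ^ 3 ≤ q ^ 1 := pow_le_pow_of_le_one h0 h1 (by norm_num)
      _ = q := pow_one q
  have a2 : |(1 - q) * x| ^ 3 ≤ |x| ^ 3 := by
    rw [abs_mul, abs_of_nonneg (by linarith : (0 : ℝ) ≤ 1 - q), mul_pow]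
    have : (1 - q) ^ 3 ≤ 1 := pow_le_one₀ (by linarith) (by linarith)
    nlinarith [pow_nonneg (abs_nonneg x) 3]
  have b1 := mul_le_mul_of_nonneg_left ka (by linarith : (0 : ℝ) ≤ 1 - q)
  have b2 := mul_le_mul_of_nonneg_left kb h0
  have hx3 : 0 ≤ |x| ^ 3 := by positivity
  have c1 : (1 - q) * (|-(q * x)| ^ 3 / 2) ≤ q * |x| ^ 3 / 2 := by
    nlinarith [mul_nonneg h0 hx3, mul_nonneg h0 (mul_nonneg h0 hx3)]
  have c2 : q * (|(1 - q) * x| ^ 3 / 2) ≤ q * |x| ^ 3 / 2 := by nlinarith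
  linarith

/-! ### Moments of a column -/

section Moments

variable {D : Measure (Vec m)}

theorem memLp_apply_sub_mean [IsProbabilityMeasure D] (h2 : MemLp id 2 D) (i : Fin m) :
    MemLp (fun x : Vec m => x i - mean D i) 2 D := by
  have h : MemLp (fun x : Vec m => x i) 2 D := by
    have := h2.continuousLinearMap_comp (EuclideanSpace.proj (𝕜 := ℝ) i)
    exact this
  exact h.sub (memLp_const _)

theorem mean_apply [IsProbabilityMeasure D] (h2 : MemLp id 2 D) (i : Fin m) : mean D i = ∫ x, x i ∂D := by
  have h1 : Integrable (fun x : Vec m => x) D := h2.integrable (by norm_num)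
  have := (EuclideanSpace.proj (𝕜 := ℝ) i).integral_comp_comm h1
  exact this.symm

theorem integral_apply_sub_mean [IsProbabilityMeasure D] (h2 : MemLp id 2 D) (i : Fin m) :
    ∫ x, (x i - mean D i) ∂D = 0 := by
  have h : Integrable (fun x : Vec m => x i) D := by
    have h1 : Integrable (fun x : Vec m => x) D := h2.integrable (by norm_num)
    exact (EuclideanSpace.proj (𝕜 := ℝ) i).integrable_comp h1
  rw [integral_sub h (integrable_const _), ← mean_apply h2]
  simp

theorem sigma_sq : sigma D ^ 2 = ‖Matrix.toEuclideanCLM (𝕜 := ℝ) (covMatrix D)‖ :=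
  Real.sq_sqrt (norm_nonneg _)

theorem integral_sq_apply_sub_mean_le (i : Fin m) :
    ∫ x, (x i - mean D i) ^ 2 ∂D ≤ sigma D ^ 2 := by
  rw [sigma_sq]
  set M := Matrix.toEuclideanCLM (𝕜 := ℝ) (covMatrix D)
  have h := M.le_opNorm (EuclideanSpace.single i (1 : ℝ))
  rw [PiLp.norm_single, norm_one, mul_one] at h
  refine le_trans ?_ h
  refine le_trans ?_ (PiLp.norm_apply_le _ i)
  refine le_trans (le_of_eq ?_) (le_abs_self _)
  have : (M (EuclideanSpace.single i (1 : ℝ))) i = covMatrix D i i := by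
    change (WithLp.ofLp (Matrix.toEuclideanCLM (𝕜 := ℝ) (covMatrix D) (EuclideanSpace.single i (1 : ℝ)))) i = _
    rw [Matrix.ofLp_toEuclideanCLM]
    simp
  rw [this]
  simp [covMatrix, sq]

theorem integrable_sq_apply_sub_mean [IsProbabilityMeasure D] (h2 : MemLp id 2 D) (i : Fin m) :
    Integrable (fun x : Vec m => (x i - mean D i) ^ 2) D :=
  (memLp_apply_sub_mean h2 i).integrable_sq

theorem norm_sub_mean_sq (x : Vec m) : ‖x - mean D‖ ^ 2 = ∑ i, (x i - mean D i) ^ 2 := by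
  rw [EuclideanSpace.norm_sq_eq]; simp

theorem integral_norm_sub_mean_sq_le [IsProbabilityMeasure D] (h2 : MemLp id 2 D) :
    ∫ x, ‖x - mean D‖ ^ 2 ∂D ≤ m * sigma D ^ 2 := by
  simp_rw [norm_sub_mean_sq]
  rw [integral_finsetSum _ fun i _ => integrable_sq_apply_sub_mean h2 i]
  calc _ ≤ ∑ _i : Fin m, sigma D ^ 2 :=
        Finset.sum_le_sum fun i _ => integral_sq_apply_sub_mean_le i
    _ = _ := by simp

theorem measurableSet_norm_sub_mean_le (τ : ℝ) :
    MeasurableSet {x : Vec m | ‖x - mean D‖ ≤ τ} :=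
  measurableSet_le (by fun_prop) measurable_const

theorem measureReal_lt_norm_sub_mean_le [IsProbabilityMeasure D] (h2 : MemLp id 2 D) {τ : ℝ} (hτ : 0 < τ) :
    D.real {x | τ < ‖x - mean D‖} ≤ m * sigma D ^ 2 / τ ^ 2 := by
  have hint : Integrable (fun x : Vec m => ‖x - mean D‖ ^ 2) D := by
    simp_rw [norm_sub_mean_sq]
    exact integrable_finsetSum _ fun i _ => integrable_sq_apply_sub_mean h2 i
  have h := mul_meas_ge_le_integral_of_nonneg (μ := D)
    (f := fun x : Vec m => ‖x - mean D‖ ^ 2) (Filter.Eventually.of_forall fun x => by positivity)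
    hint (τ ^ 2)
  rw [le_div_iff₀ (by positivity), mul_comm]
  refine le_trans ?_ (h.trans (integral_norm_sub_mean_sq_le h2))
  apply mul_le_mul_of_nonneg_left _ (by positivity)
  exact measureReal_mono fun x hx => pow_le_pow_left₀ hτ.le (le_of_lt hx) 2

open Classical in
/-- The `i`-th coordinate of the centred column, cut off at `τ`. -/
def cutCoord (D : Measure (Vec m)) (τ : ℝ) (i : Fin m) (x : Vec m) : ℝ :=
  if ‖x - mean D‖ ≤ τ then x i - mean D i else 0

theorem measurable_cutCoord (τ : ℝ) (i : Fin m) : Measurable (cutCoord D τ i) :=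
  Measurable.ite (measurableSet_norm_sub_mean_le τ) (by fun_prop) measurable_const

theorem abs_cutCoord_le {τ : ℝ} (hτ : 0 ≤ τ) (i : Fin m) (x : Vec m) : |cutCoord D τ i x| ≤ τ := by
  unfold cutCoord
  split_ifs with h
  · refine le_trans ?_ h
    simpa using PiLp.norm_apply_le (x - mean D) i
  · simpa using hτ

/-- The untruncated coordinate has mean zero, so the truncated mean is only the contribution of the
rare event `E` where the column is cut off. `S` is the cut-off measured in units of `√m σ`. -/
theorem abs_integral_cutCoord_le [IsProbabilityMeasure D] (h2 : MemLp id 2 D) (hσ : 0 < sigma D) {τ S : ℝ} (hτ : 0 < τ)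
    (hS : 0 < S) (h : m * sigma D ^ 2 * S ^ 2 ≤ τ ^ 2) (i : Fin m) :
    |∫ x, cutCoord D τ i x ∂D| ≤ sigma D / S := by
  set E : Set (Vec m) := {x | τ < ‖x - mean D‖}
  have hE : MeasurableSet E := measurableSet_lt measurable_const (by fun_prop)
  have hic : Integrable (cutCoord D τ i) D :=
    Integrable.of_bound (measurable_cutCoord τ i).aestronglyMeasurable τ
      (Filter.Eventually.of_forall fun x => abs_cutCoord_le hτ.le i x)
  have hiy : Integrable (fun x : Vec m => x i - mean D i) D :=
    (memLp_apply_sub_mean h2 i).integrable (by norm_num)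
  have hrew : ∫ x, cutCoord D τ i x ∂D = ∫ x, (cutCoord D τ i x - (x i - mean D i)) ∂D := by
    rw [integral_sub hic hiy, integral_apply_sub_mean h2, sub_zero]
  have hi1 : Integrable (E.indicator fun _ => (1 : ℝ)) D := (integrable_const _).indicator hE
  have hi2 := integrable_sq_apply_sub_mean h2 i
  rw [hrew]
  refine (abs_integral_le_integral_abs).trans ?_
  -- On `E`, AM-GM gives `|y| ≤ y²/(2σS) + σS/2`. As `E` has mass at most `1/S²`, each half
  -- contributes at most `σ/(2S)`.
  have hb : ∫ x, |cutCoord D τ i x - (x i - mean D i)| ∂D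
      ≤ ∫ x, (1 / (2 * (sigma D * S)) * (x i - mean D i) ^ 2
        + (sigma D * S) / 2 * E.indicator (fun _ => (1 : ℝ)) x) ∂D := by
    apply integral_mono (hic.sub hiy).abs ((hi2.const_mul _).add (hi1.const_mul _))
    intro x
    change |cutCoord D τ i x - (x i - mean D i)| ≤ 1 / (2 * (sigma D * S)) * (x i - mean D i) ^ 2
        + (sigma D * S) / 2 * E.indicator (fun _ => (1 : ℝ)) x
    simp only [cutCoord]
    split_ifs with hx
    · simp only [sub_self, abs_zero]
      have : 0 ≤ E.indicator (fun _ => (1 : ℝ)) x := Set.indicator_nonneg (by simp) x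
      positivity
    · have hxE : x ∈ E := not_le.mp hx
      simp only [Set.indicator_of_mem hxE, zero_sub, abs_neg, mul_one]
      rw [← sq_abs]
      have hs : 0 < sigma D * S := by positivity
      have : 1 / (2 * (sigma D * S)) * |x i - mean D i| ^ 2 + sigma D * S / 2 - |x i - mean D i|
          = (|x i - mean D i| - sigma D * S) ^ 2 / (2 * (sigma D * S)) := by
        field_simp; ring
      have h0 : 0 ≤ (|x i - mean D i| - sigma D * S) ^ 2 / (2 * (sigma D * S)) := by positivity
      linarith
  refine hb.trans ?_
  rw [integral_add (hi2.const_mul _) (hi1.const_mul _), integral_const_mul, integral_const_mul,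
    integral_indicator_const _ hE, smul_eq_mul, mul_one]
  have hP : D.real E ≤ 1 / S ^ 2 := by
    refine (measureReal_lt_norm_sub_mean_le h2 hτ).trans ?_
    rw [div_le_div_iff₀ (by positivity) (by positivity)]
    linarith
  have h3 := mul_le_mul_of_nonneg_left (integral_sq_apply_sub_mean_le (D := D) i)
    (by positivity : 0 ≤ 1 / (2 * (sigma D * S)))
  have h4 := mul_le_mul_of_nonneg_left hP (by positivity : 0 ≤ sigma D * S / 2)
  refine (add_le_add h3 h4).trans (le_of_eq ?_)
  field_simp; ring

end Moments

/-! ### Counting independent successes -/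

section Counting

variable {α : Type*} [MeasurableSpace α] {P : Measure α} [IsProbabilityMeasure P]

open Classical in
-- Exponential Markov inequality for a binomial count. The sign of `t` is free, so this covers both
-- the upper and the lower tail.
theorem measureReal_le_mul_card_le {E : Set α} (hE : MeasurableSet E) (n : ℕ) (t r : ℝ) :
    (Measure.pi fun _ : Fin n => P).real {A | r ≤ t * (Finset.univ.filter fun j => A j ∈ E).card}
      ≤ Real.exp (n * ((Real.exp t - 1) * P.real E) - r) := by
  set f : α → ℝ := fun x => 1 + E.indicator (fun _ => Real.exp t - 1) x with hf
  have hfm : Measurable f := measurable_const.add (measurable_const.indicator hE)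
  have hfv : ∀ x, f x = if x ∈ E then Real.exp t else 1 := by
    intro x; simp only [hf]; split_ifs with h <;> simp [h]
  have hf0 : ∀ x, 0 ≤ f x := by
    intro x; rw [hfv]; split_ifs <;> positivity
  have hfi : Integrable f P := (integrable_const _).add ((integrable_const _).indicator hE)
  have hint : ∫ x, f x ∂P = 1 + (Real.exp t - 1) * P.real E := by
    simp only [hf]
    rw [integral_add (integrable_const _) ((integrable_const _).indicator hE),
      integral_indicator_const _ hE]
    simp [mul_comm]
  have hprod : ∀ A : Fin n → α, ∏ j, f (A j)
      = Real.exp (t * (Finset.univ.filter fun j => A j ∈ E).card) := by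
    intro A
    simp_rw [hfv]
    rw [Finset.prod_ite]
    simp [← Real.exp_nat_mul, mul_comm]
  have hpi : ∫ A, ∏ j, f (A j) ∂(Measure.pi fun _ : Fin n => P) = (∫ x, f x ∂P) ^ n := by
    rw [integral_fintype_prod_eq_prod (fun _ : Fin n => f)]; simp
  have hmk := mul_meas_ge_le_integral_of_nonneg (μ := Measure.pi fun _ : Fin n => P)
    (f := fun A => ∏ j, f (A j))
    (Filter.Eventually.of_forall fun A => Finset.prod_nonneg fun j _ => hf0 _)
    (Integrable.fintype_prod (f := fun _ : Fin n => f) fun _ => hfi) (Real.exp r)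
  have hset : {A : Fin n → α | Real.exp r ≤ ∏ j, f (A j)}
      = {A | r ≤ t * (Finset.univ.filter fun j => A j ∈ E).card} := by
    ext A; simp [hprod]
  rw [hset, hpi, hint] at hmk
  rw [Real.exp_sub, le_div_iff₀ (Real.exp_pos _), mul_comm]
  refine hmk.trans ?_
  rw [Real.exp_nat_mul]
  have h0 : 0 ≤ 1 + (Real.exp t - 1) * P.real E := by
    rw [← hint]; exact integral_nonneg hf0
  exact pow_le_pow_left₀ h0 (by linarith [Real.add_one_le_exp ((Real.exp t - 1) * P.real E)]) n

end Counting

/-! ### Regular matrices -/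

instance (n : ℕ) (D : Measure (Vec m)) [IsProbabilityMeasure D] :
    IsProbabilityMeasure (columnsLaw n D) := by
  unfold columnsLaw; infer_instance

open Classical in
/-- The columns at distance at most `τ` from the mean. -/
def goodCols {n : ℕ} (D : Measure (Vec m)) (τ : ℝ) (A : Fin n → Vec m) : Finset (Fin n) :=
  Finset.univ.filter fun j => ‖A j - mean D‖ ≤ τ

theorem mem_goodCols {n : ℕ} {D : Measure (Vec m)} {τ : ℝ} {A : Fin n → Vec m} {j : Fin n} :
    j ∈ goodCols D τ A ↔ ‖A j - mean D‖ ≤ τ := by simp [goodCols]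

open Classical in
/-- The deterministic properties of the matrix with columns `A` which the argument needs. -/
structure Regular {n : ℕ} (D : Measure (Vec m)) (κ τ ε L : ℝ) (A : Fin n → Vec m) : Prop where
  card_le : 99 / 100 * (n : ℝ) ≤ (goodCols D τ A).card
  sum_le : ∀ i, |∑ j ∈ goodCols D τ A, (A j i - mean D i)| ≤ ε * n
  spread : ∀ θ : Vec m, supNorm θ ≤ L → κ * n / 2 ≤ ((goodCols D τ A).filter fun j =>
    3 / 4 * κ * min 1 (supNorm θ * sigma D) ≤ distInt (inner ℝ θ (A j))).card

section Regularity

variable {D : Measure (Vec m)} [IsProbabilityMeasure D]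

theorem columnsLaw_real_card_goodCols_lt (n : ℕ) {τ : ℝ}
    (hP : D.real {x | τ < ‖x - mean D‖} ≤ 1 / 500) :
    (columnsLaw n D).real {A | ((goodCols D τ A).card : ℝ) < 99 / 100 * (n : ℝ)}
      ≤ Real.exp (-(n / 160)) := by
  classical
  set E : Set (Vec m) := {x | τ < ‖x - mean D‖}
  have hE : MeasurableSet E := measurableSet_lt measurable_const (by fun_prop)
  -- With `t = 1` the exponent is at most `n (1.72/500 - 1/100)`, which is below `-n/160`.
  have h := measureReal_le_mul_card_le (P := D) hE n 1 (n / 100)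
  unfold columnsLaw
  refine (measureReal_mono ?_).trans (h.trans ?_)
  · intro A hA
    simp only [Set.mem_ofPred_eq] at hA ⊢
    have hc := Finset.card_filter_add_card_filter_not (s := (Finset.univ : Finset (Fin n)))
      (fun j => ‖A j - mean D‖ ≤ τ)
    have e1 : (Finset.univ.filter fun j => A j ∈ E)
        = Finset.univ.filter fun j => ¬ ‖A j - mean D‖ ≤ τ := by
      ext j; simp [E]
    rw [e1, one_mul]
    rw [Finset.card_univ, Fintype.card_fin] at hc
    have hc' : ((goodCols D τ A).card : ℝ)
        + ((Finset.univ.filter fun j => ¬ ‖A j - mean D‖ ≤ τ).card : ℝ) = n := by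
      rw [show goodCols D τ A = Finset.univ.filter fun j => ‖A j - mean D‖ ≤ τ by
        ext j; simp [goodCols]]
      exact_mod_cast hc
    linarith
  · apply Real.exp_le_exp.mpr
    have he : Real.exp 1 - 1 ≤ 1.72 := by linarith [Real.exp_one_lt_d9]
    have he0 : 0 ≤ Real.exp 1 - 1 := by linarith [Real.add_one_le_exp (1 : ℝ)]
    have : (Real.exp 1 - 1) * D.real E ≤ 1.72 * (1 / 500) :=
      mul_le_mul he hP measureReal_nonneg (by norm_num)
    have hn : (0 : ℝ) ≤ n := by positivity
    nlinarith

/-- Truncation makes the summands bounded, so Hoeffding applies although the columns only have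
second moments. Half of `ε` absorbs the bias of the truncation, the other half the deviation. -/
theorem columnsLaw_real_sum_goodCols_gt (n : ℕ) {τ ε : ℝ} (hτ : 0 < τ) (hε : 0 < ε) (i : Fin m)
    (hmean : |∫ x, cutCoord D τ i x ∂D| ≤ ε / 2) :
    (columnsLaw n D).real {A | ε * n < |∑ j ∈ goodCols D τ A, (A j i - mean D i)|}
      ≤ 2 * Real.exp (-(ε ^ 2 * n / (8 * τ ^ 2))) := by
  classical
  rcases Nat.eq_zero_or_pos n with hn | hn
  · subst hn
    refine measureReal_le_one.trans ?_
    norm_num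
  have hn' : (0 : ℝ) < n := by exact_mod_cast hn
  set f := cutCoord D τ i
  set a := ∫ x, f x ∂D
  have hsum : ∀ A : Fin n → Vec m, ∑ j ∈ goodCols D τ A, (A j i - mean D i) = ∑ j, f (A j) := by
    intro A
    rw [goodCols, Finset.sum_filter]
    rfl
  have hsub : ProbabilityTheory.HasSubgaussianMGF (fun x => f x - a) ((‖τ - -τ‖₊ / 2) ^ 2) D :=
    ProbabilityTheory.hasSubgaussianMGF_of_mem_Icc (measurable_cutCoord τ i).aemeasurable
      (Filter.Eventually.of_forall fun x => abs_le.mp (abs_cutCoord_le hτ.le i x))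
  have hc : (((‖τ - -τ‖₊ / 2) ^ 2 : NNReal) : ℝ) = τ ^ 2 := by
    push_cast
    rw [Real.norm_of_nonneg (by linarith)]
    ring
  have hpush : ∀ g : Vec m → ℝ, AEMeasurable g D → ∀ c : NNReal,
      ProbabilityTheory.HasSubgaussianMGF g c D → ∀ j : Fin n,
      ProbabilityTheory.HasSubgaussianMGF (fun A : Fin n → Vec m => g (A j)) c (columnsLaw n D) := by
    intro g hg c hgc j
    have hmp : MeasurePreserving (Function.eval j) (columnsLaw n D) D :=
      measurePreserving_eval (fun _ : Fin n => D) j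
    have h1 : ProbabilityTheory.HasSubgaussianMGF g c ((columnsLaw n D).map (Function.eval j)) := by
      rw [hmp.map_eq]; exact hgc
    exact ProbabilityTheory.HasSubgaussianMGF.of_map hmp.aemeasurable h1
  have htail : ∀ g : Vec m → ℝ, Measurable g →
      ProbabilityTheory.HasSubgaussianMGF g ((‖τ - -τ‖₊ / 2) ^ 2) D →
      (columnsLaw n D).real {A | ε / 2 * n ≤ ∑ j, g (A j)}
        ≤ Real.exp (-(ε ^ 2 * n / (8 * τ ^ 2))) := by
    intro g hgm hg
    have hind : ProbabilityTheory.iIndepFun (fun (j : Fin n) (A : Fin n → Vec m) => g (A j))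
        (columnsLaw n D) :=
      ProbabilityTheory.iIndepFun_pi (X := fun _ : Fin n => g) fun _ => hgm.aemeasurable
    have h := ProbabilityTheory.HasSubgaussianMGF.measure_sum_ge_le_of_iIndepFun hind
      (s := Finset.univ) (fun j _ => hpush g hgm.aemeasurable _ hg j) (ε := ε / 2 * n) (by positivity)
    refine h.trans (le_of_eq ?_)
    congr 1
    rw [NNReal.coe_sum, Finset.sum_const, Finset.card_univ, Fintype.card_fin, nsmul_eq_mul, hc]
    field_simp
    ring
  have hfm : Measurable f := measurable_cutCoord τ i
  have h1 := htail (fun x => f x - a) (hfm.sub_const a) hsub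
  have h2 := htail (fun x => -(f x - a)) (hfm.sub_const a).neg hsub.neg
  have hcov : {A : Fin n → Vec m | ε * n < |∑ j ∈ goodCols D τ A, (A j i - mean D i)|}
      ⊆ {A | ε / 2 * n ≤ ∑ j, (f (A j) - a)} ∪ {A | ε / 2 * n ≤ ∑ j, -(f (A j) - a)} := by
    intro A hA
    simp only [Set.mem_ofPred_eq, hsum] at hA
    simp only [Set.mem_union, Set.mem_ofPred_eq, Finset.sum_neg_distrib, Finset.sum_sub_distrib,
      Finset.sum_const, Finset.card_univ, Fintype.card_fin, nsmul_eq_mul]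
    have ha := abs_le.mp hmean
    rcases lt_abs.mp hA with h | h
    · left; nlinarith
    · right; nlinarith
  refine (measureReal_mono hcov).trans ((measureReal_union_le _ _).trans ?_)
  linarith

end Regularity

/-! ### Uniformity over the Fourier side -/

section Net

variable {D : Measure (Vec m)}

open Classical in
-- A lower-tail Chernoff bound for one frequency. Discarding the columns far from the mean costs
-- `κ/20` of the mass `κ`.
theorem columnsLaw_real_spread_lt [IsProbabilityMeasure D] (n : ℕ) {κ τ : ℝ} (hκ : 0 < κ) {θ : Vec m}
    (hP : D.real {x | τ < ‖x - mean D‖} ≤ κ / 20)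
    (ha : κ ≤ D.real {x | κ * min 1 (supNorm θ * sigma D) ≤ distInt (inner ℝ θ x)}) :
    (columnsLaw n D).real {A | (((goodCols D τ A).filter fun j =>
        κ * min 1 (supNorm θ * sigma D) ≤ distInt (inner ℝ θ (A j))).card : ℝ) < κ * n / 2}
      ≤ Real.exp (-(κ * n / 8)) := by
  set F : Set (Vec m) := {x | κ * min 1 (supNorm θ * sigma D) ≤ distInt (inner ℝ θ x)}
  set E : Set (Vec m) := {x | ‖x - mean D‖ ≤ τ ∧ x ∈ F}
  have hF : MeasurableSet F := by
    apply measurableSet_le measurable_const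
    exact continuous_distInt.measurable.comp (by fun_prop)
  have hE : MeasurableSet E := (measurableSet_norm_sub_mean_le τ).inter hF
  have hEP : 19 / 20 * κ ≤ D.real E := by
    have : D.real F ≤ D.real E + D.real {x | τ < ‖x - mean D‖} := by
      refine (measureReal_mono ?_).trans (measureReal_union_le _ _)
      intro x hx
      by_cases h : ‖x - mean D‖ ≤ τ
      · left; exact ⟨h, hx⟩
      · right; exact not_le.mp h
    linarith
  -- The tilt `t = -log 2` gives the exponent `κn (-19/40 + (log 2)/2)`, below `-κn/8`.
  have h := measureReal_le_mul_card_le (P := D) hE n (-Real.log 2) (-Real.log 2 * (κ * n / 2))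
  unfold columnsLaw
  have hl2 : 0 < Real.log 2 := Real.log_pos (by norm_num)
  refine (measureReal_mono ?_).trans (h.trans ?_)
  · intro A hA
    simp only [Set.mem_ofPred_eq] at hA ⊢
    have e1 : ∀ inst : DecidablePred fun j => A j ∈ E,
        (@Finset.filter _ (fun j => A j ∈ E) inst Finset.univ) = (goodCols D τ A).filter fun j =>
        κ * min 1 (supNorm θ * sigma D) ≤ distInt (inner ℝ θ (A j)) := by
      intro inst; ext j; simp [E, F, mem_goodCols]
    rw [e1]
    nlinarith
  · apply Real.exp_le_exp.mpr
    rw [Real.exp_neg, Real.exp_log (by norm_num)]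
    have hn : (0 : ℝ) ≤ n := by positivity
    have := Real.log_two_lt_d9
    have hκn : 0 ≤ κ * n := by positivity
    nlinarith [mul_le_mul_of_nonneg_left hEP hn]

open Classical in
-- Away from the origin, moving `θ` by `η` costs at most a quarter of the threshold, whence the
-- factor `3/4`. Near the origin no net is fine enough relative to `θ`; there the inner products do
-- not wrap around, so `distInt` is homogeneous and `θ` can be scaled up to sup norm `r`.
theorem spread_of_net {n : ℕ} {κ τ L B η : ℝ} (hκ : 0 < κ) (hκ1 : κ ≤ 1) (hσ : 0 < sigma D)
    (hm : 1 ≤ m) (hB : ‖mean D‖ + τ ≤ B) (hσB : sigma D ≤ B) (hL : 1 / (2 * √m * B) ≤ L)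
    (hη0 : 0 ≤ η) (hη : η ≤ κ * sigma D / (16 * m * B ^ 2)) {A : Fin n → Vec m}
    (hnet : ∀ θ : Vec m, supNorm θ ≤ L → ∃ θ' : Vec m, supNorm (θ - θ') ≤ η ∧
      κ * n / 2 ≤ ((goodCols D τ A).filter fun j =>
        κ * min 1 (supNorm θ' * sigma D) ≤ distInt (inner ℝ θ' (A j))).card)
    {θ : Vec m} (hθ : supNorm θ ≤ L) :
    κ * n / 2 ≤ ((goodCols D τ A).filter fun j =>
      3 / 4 * κ * min 1 (supNorm θ * sigma D) ≤ distInt (inner ℝ θ (A j))).card := by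
  have hm0 : (0 : ℝ) < m := by exact_mod_cast hm
  have hs0 : 0 < √(m : ℝ) := Real.sqrt_pos.mpr hm0
  have hs1 : 1 ≤ √(m : ℝ) := by rw [Real.one_le_sqrt]; exact_mod_cast hm
  have hss : √(m : ℝ) ^ 2 = m := Real.sq_sqrt hm0.le
  have hB0 : 0 < B := hσ.trans_le hσB
  -- Up to sup norm `r`, every good column satisfies `|⟨θ, A j⟩| ≤ 1/2`.
  set r := 1 / (2 * √m * B) with hr
  have hr0 : 0 < r := by positivity
  have hAB : ∀ j ∈ goodCols D τ A, ‖A j‖ ≤ B := by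
    intro j hj
    rw [mem_goodCols] at hj
    have := norm_le_norm_add_norm_sub' (A j) (mean D)
    linarith
  have hrσ : r * sigma D ≤ 1 / 2 := by
    rw [hr, div_mul_eq_mul_div, div_le_div_iff₀ (by positivity) (by norm_num)]
    nlinarith [mul_le_mul hs1 hσB hσ.le hs0.le]
  -- Two losses are covered: the change of the inner product, at most `√m η B`, and the change of
  -- the threshold, at most `κησ ≤ √m η B`.
  have hηr : 2 * √m * η * B ≤ κ / 4 * (r * sigma D) := by
    have h1 : 2 * √m * η * B ≤ 2 * √m * (κ * sigma D / (16 * m * B ^ 2)) * B := by gcongr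
    refine h1.trans (le_of_eq ?_)
    rw [hr]
    clear_value r
    generalize √(m : ℝ) = s at *
    rw [← hss]; field_simp; norm_num
  have hlarge : ∀ θ : Vec m, supNorm θ ≤ L → r ≤ supNorm θ →
      κ * n / 2 ≤ ((goodCols D τ A).filter fun j =>
        3 / 4 * κ * min 1 (supNorm θ * sigma D) ≤ distInt (inner ℝ θ (A j))).card := by
    intro θ hθ hrθ
    obtain ⟨θ', hd, hc⟩ := hnet θ hθ
    refine hc.trans ?_
    have hsub : ((goodCols D τ A).filter fun j =>
        κ * min 1 (supNorm θ' * sigma D) ≤ distInt (inner ℝ θ' (A j))) ⊆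
        ((goodCols D τ A).filter fun j =>
        3 / 4 * κ * min 1 (supNorm θ * sigma D) ≤ distInt (inner ℝ θ (A j))) := by
      intro j hj
      rw [Finset.mem_filter] at hj ⊢
      refine ⟨hj.1, ?_⟩
      have hj2 := hj.2
      have h1 := distInt_le_add (inner ℝ θ' (A j)) (inner ℝ θ (A j))
      have h2 : |inner ℝ θ' (A j) - inner ℝ θ (A j)| ≤ √m * η * B := by
        rw [abs_sub_comm, ← inner_sub_left]
        refine (abs_inner_le_supNorm _ _).trans ?_
        have := hAB j hj.1
        have h3 := supNorm_nonneg (θ - θ')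
        gcongr
      have h3 : min 1 (supNorm θ * sigma D) ≤ min 1 (supNorm θ' * sigma D) + η * sigma D := by
        have h4 := supNorm_sub_le θ θ'
        rcases le_total 1 (supNorm θ' * sigma D) with h5 | h5
        · rw [min_eq_left h5]
          exact (min_le_left _ _).trans (by nlinarith)
        · rw [min_eq_right h5]
          exact (min_le_right _ _).trans (by nlinarith)
      have h6 : r * sigma D ≤ min 1 (supNorm θ * sigma D) :=
        le_min (by linarith) (by nlinarith)
      have h7 : κ * (η * sigma D) ≤ √m * η * B := by
        calc κ * (η * sigma D) ≤ 1 * (η * B) := by gcongr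
          _ ≤ √m * (η * B) := by gcongr
          _ = _ := by ring
      have h8 := mul_le_mul_of_nonneg_left h3 hκ.le
      have h9 := mul_le_mul_of_nonneg_left h6 hκ.le
      linarith
    exact_mod_cast Finset.card_le_card hsub
  rcases le_or_gt r (supNorm θ) with hrθ | hrθ
  · exact hlarge θ hθ hrθ
  rcases (supNorm_nonneg θ).eq_or_lt with h0 | h0
  · -- at the origin the condition is void
    have hz : θ = 0 := supNorm_eq_zero.mp h0.symm
    have e0 : min 1 (supNorm θ * sigma D) = 0 := by rw [← h0]; simp
    obtain ⟨θ', -, hc⟩ := hnet θ hθ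
    refine hc.trans ?_
    have : ((goodCols D τ A).filter fun j =>
        κ * min 1 (supNorm θ' * sigma D) ≤ distInt (inner ℝ θ' (A j))) ⊆
        ((goodCols D τ A).filter fun j =>
        3 / 4 * κ * min 1 (supNorm θ * sigma D) ≤ distInt (inner ℝ θ (A j))) := by
      intro j hj
      rw [Finset.mem_filter] at hj ⊢
      refine ⟨hj.1, ?_⟩
      rw [e0, mul_zero]; exact distInt_nonneg _
    exact_mod_cast Finset.card_le_card this
  · set t := r / supNorm θ with ht
    have ht0 : 0 < t := by positivity
    have hnt : supNorm (t • θ) = r := by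
      rw [supNorm_smul, abs_of_pos ht0, ht]; field_simp
    refine (hlarge (t • θ) (hnt.trans_le hL) hnt.ge).trans ?_
    have : ((goodCols D τ A).filter fun j =>
        3 / 4 * κ * min 1 (supNorm (t • θ) * sigma D) ≤ distInt (inner ℝ (t • θ) (A j))) ⊆
        ((goodCols D τ A).filter fun j =>
        3 / 4 * κ * min 1 (supNorm θ * sigma D) ≤ distInt (inner ℝ θ (A j))) := by
      intro j hj
      rw [Finset.mem_filter] at hj ⊢
      refine ⟨hj.1, ?_⟩
      have hj2 := hj.2
      rw [hnt, min_eq_right (by linarith)] at hj2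
      have h1 := hj2.trans (distInt_le_abs _)
      rw [inner_smul_left, abs_mul] at h1
      simp only [conj_trivial, abs_of_pos ht0] at h1
      have h2 : |inner ℝ θ (A j)| ≤ 1 / 2 := by
        refine (abs_inner_le_supNorm _ _).trans ?_
        calc √m * supNorm θ * ‖A j‖ ≤ √m * r * B := by
              have := hAB j hj.1
              gcongr
          _ = 1 / 2 := by rw [hr]; field_simp
      rw [distInt_of_abs_le h2]
      have h3 : 3 / 4 * κ * (supNorm θ * sigma D) ≤ |inner ℝ θ (A j)| := by
        have e : 3 / 4 * κ * (r * sigma D) = t * (3 / 4 * κ * (supNorm θ * sigma D)) := by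
          rw [ht]; field_simp
        rw [e] at h1
        exact le_of_mul_le_mul_left h1 ht0
      refine le_trans ?_ h3
      gcongr
      exact min_le_right _ _
    exact_mod_cast Finset.card_le_card this

open Classical in
-- Union bound over the cells of a grid of mesh `η` covering the cube `supNorm θ ≤ L`; the base of
-- the `m`-th power bounds the number of cells per axis.
theorem columnsLaw_real_exists_spread_lt [IsProbabilityMeasure D] (n : ℕ) {κ τ L B : ℝ} (hκ : 0 < κ) (hκ1 : κ ≤ 1)
    (hσ : 0 < sigma D) (hm : 1 ≤ m) (hB : ‖mean D‖ + τ ≤ B) (hσB : sigma D ≤ B)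
    (hL : 1 / (2 * √m * B) ≤ L) (hP : D.real {x | τ < ‖x - mean D‖} ≤ κ / 20)
    (ha : ∀ θ : Vec m, supNorm θ ≤ L →
      κ ≤ D.real {x | κ * min 1 (supNorm θ * sigma D) ≤ distInt (inner ℝ θ x)}) :
    (columnsLaw n D).real {A | ∃ θ : Vec m, supNorm θ ≤ L ∧ (((goodCols D τ A).filter fun j =>
        3 / 4 * κ * min 1 (supNorm θ * sigma D) ≤ distInt (inner ℝ θ (A j))).card : ℝ) < κ * n / 2}
      ≤ (40 * L * m * B ^ 2 / (κ * sigma D)) ^ m * Real.exp (-(κ * n / 8)) := by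
  have hm0 : (0 : ℝ) < m := by exact_mod_cast hm
  have hs1 : 1 ≤ √(m : ℝ) := by rw [Real.one_le_sqrt]; exact_mod_cast hm
  have hss : √(m : ℝ) ^ 2 = m := Real.sq_sqrt hm0.le
  have hB0 : 0 < B := hσ.trans_le hσB
  have hL0 : 0 < L := lt_of_lt_of_le (by positivity) hL
  set η := κ * sigma D / (16 * m * B ^ 2) with hη
  have hη0 : 0 < η := by positivity
  set N : ℕ := ⌈L / η⌉₊ with hN
  set K : Finset (Fin m → ℤ) := Fintype.piFinset fun _ => Finset.Icc (-(N : ℤ)) N with hK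
  set Cell : (Fin m → ℤ) → Vec m → Prop :=
    fun k θ => supNorm θ ≤ L ∧ ∀ i, ⌊θ i / η⌋ = k i with hCell
  -- The representative is taken inside the cube, since anti-concentration is assumed only there.
  -- The default `0` for empty cells lies in the cube too.
  set rep : (Fin m → ℤ) → Vec m := fun k => if h : ∃ θ, Cell k θ then h.choose else 0 with hrep
  have hrepL : ∀ k, supNorm (rep k) ≤ L := by
    intro k
    simp only [hrep]
    split_ifs with h
    · exact h.choose_spec.1
    · rw [supNorm_eq_zero.mpr rfl]; exact hL0.le
  set Bad : (Fin m → ℤ) → Set (Fin n → Vec m) := fun k => {A | (((goodCols D τ A).filter fun j =>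
    κ * min 1 (supNorm (rep k) * sigma D) ≤ distInt (inner ℝ (rep k) (A j))).card : ℝ) < κ * n / 2}
  have hcov : {A : Fin n → Vec m | ∃ θ : Vec m, supNorm θ ≤ L ∧ (((goodCols D τ A).filter fun j =>
      3 / 4 * κ * min 1 (supNorm θ * sigma D) ≤ distInt (inner ℝ θ (A j))).card : ℝ) < κ * n / 2}
      ⊆ ⋃ k ∈ K, Bad k := by
    rintro A ⟨θ, hθ, hlt⟩
    by_contra hA
    simp only [Set.mem_iUnion, not_exists] at hA
    refine absurd hlt (not_lt.mpr ?_)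
    refine spread_of_net hκ hκ1 hσ hm hB hσB hL hη0.le le_rfl ?_ hθ
    intro θ hθ
    set k : Fin m → ℤ := fun i => ⌊θ i / η⌋ with hk
    have hkK : k ∈ K := by
      rw [hK, Fintype.mem_piFinset]
      intro i
      have h1 := abs_le.mp ((abs_apply_le_supNorm θ i).trans hθ)
      have h2 : L / η ≤ N := Nat.le_ceil _
      rw [Finset.mem_Icc]
      constructor
      · rw [hk, Int.le_floor]
        push_cast
        have : -(L / η) ≤ θ i / η := by rw [← neg_div]; gcongr; exact h1.1
        linarith
      · have h3 : θ i / η ≤ L / η := by gcongr; exact h1.2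
        have h4 : (k i : ℝ) ≤ N := (Int.floor_le _).trans (h3.trans h2)
        exact_mod_cast h4
    have hex : ∃ θ, Cell k θ := ⟨θ, hθ, fun i => rfl⟩
    have hcell : Cell k (rep k) := by
      simp only [hrep, dif_pos hex]
      exact hex.choose_spec
    refine ⟨rep k, ?_, ?_⟩
    · rw [supNorm_le_iff hη0.le]
      intro i
      have h1 : ⌊θ i / η⌋ = ⌊rep k i / η⌋ := (hcell.2 i).symm
      have h2 := Int.abs_sub_lt_one_of_floor_eq_floor h1
      rw [← sub_div, abs_div, abs_of_pos hη0, div_lt_one hη0] at h2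
      exact h2.le
    · exact not_lt.mp (hA k hkK)
  have hcard : (K.card : ℝ) = (2 * N + 1 : ℝ) ^ m := by
    rw [hK, Fintype.card_piFinset]
    simp only [Int.card_Icc, Finset.prod_const, Finset.card_univ, Fintype.card_fin]
    push_cast
    congr 1
    have : ((N : ℤ) + 1 - -(N : ℤ)).toNat = 2 * N + 1 := by omega
    rw [this]; push_cast; ring
  have hNle : (2 * N + 1 : ℝ) ≤ 40 * L * m * B ^ 2 / (κ * sigma D) := by
    have h1 : (N : ℝ) < L / η + 1 := Nat.ceil_lt_add_one (by positivity)
    have h2 : L / η = 16 * (L * m * B ^ 2 / (κ * sigma D)) := by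
      rw [hη]; field_simp
    have h3 : 1 / 2 ≤ L * m * B ^ 2 / (κ * sigma D) := by
      rw [le_div_iff₀ (by positivity)]
      have h4 : 1 / (2 * √m * B) * m * B ^ 2 ≤ L * m * B ^ 2 := by gcongr
      have h5 : 1 / (2 * √m * B) * m * B ^ 2 = √m * B / 2 := by
        nth_rewrite 2 [← hss]; field_simp
      have h6 : κ * sigma D ≤ √m * B := by
        calc κ * sigma D ≤ 1 * B := by gcongr
          _ ≤ √m * B := by gcongr
      linarith
    have h4 : 40 * L * m * B ^ 2 / (κ * sigma D) = 40 * (L * m * B ^ 2 / (κ * sigma D)) := by ring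
    rw [h4]; linarith
  refine (measureReal_mono hcov (measure_ne_top _ _)).trans ((measureReal_biUnion_finset_le _ _).trans ?_)
  calc ∑ k ∈ K, (columnsLaw n D).real (Bad k) ≤ ∑ _k ∈ K, Real.exp (-(κ * n / 8)) :=
        Finset.sum_le_sum fun k _ => columnsLaw_real_spread_lt n hκ hP (ha _ (hrepL k))
    _ = (2 * N + 1 : ℝ) ^ m * Real.exp (-(κ * n / 8)) := by
        rw [Finset.sum_const, nsmul_eq_mul, hcard]
    _ ≤ _ := by gcongr

theorem columnsLaw_real_not_regular_le [IsProbabilityMeasure D] (n : ℕ) (h2 : MemLp id 2 D) {κ τ ε L B S : ℝ} (hκ : 0 < κ)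
    (hκ1 : κ ≤ 1) (hσ : 0 < sigma D) (hm : 1 ≤ m) (hτ : 0 < τ) (hS : 0 < S)
    (hτS : m * sigma D ^ 2 * S ^ 2 ≤ τ ^ 2) (hSκ : 1 / S ^ 2 ≤ κ / 20)
    (hS2 : 1 / S ^ 2 ≤ 1 / 500) (hSε : sigma D / S ≤ ε / 2)
    (hB : ‖mean D‖ + τ ≤ B) (hσB : sigma D ≤ B) (hL : 1 / (2 * √m * B) ≤ L)
    (ha : ∀ θ : Vec m, supNorm θ ≤ L →
      κ ≤ D.real {x | κ * min 1 (supNorm θ * sigma D) ≤ distInt (inner ℝ θ x)}) :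
    (columnsLaw n D).real {A | ¬ Regular D κ τ ε L A}
      ≤ Real.exp (-(n / 160)) + 2 * m * Real.exp (-(ε ^ 2 * n / (8 * τ ^ 2)))
        + (40 * L * m * B ^ 2 / (κ * sigma D)) ^ m * Real.exp (-(κ * n / 8)) := by
  classical
  have hPS : D.real {x | τ < ‖x - mean D‖} ≤ 1 / S ^ 2 := by
    refine (measureReal_lt_norm_sub_mean_le h2 hτ).trans ?_
    rw [div_le_div_iff₀ (by positivity) (by positivity)]
    linarith
  have hε : 0 < ε := by
    have : 0 < sigma D / S := by positivity
    linarith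
  have e1 := columnsLaw_real_card_goodCols_lt (D := D) n (hPS.trans hS2)
  have e2 : ∀ i, _ := fun i => columnsLaw_real_sum_goodCols_gt (D := D) n hτ hε i
    ((abs_integral_cutCoord_le h2 hσ hτ hS hτS i).trans hSε)
  have e3 := columnsLaw_real_exists_spread_lt (D := D) n hκ hκ1 hσ hm hB hσB hL (hPS.trans hSκ) ha
  have hcov : {A : Fin n → Vec m | ¬ Regular D κ τ ε L A} ⊆
      ({A | ((goodCols D τ A).card : ℝ) < 99 / 100 * (n : ℝ)} ∪
        ⋃ i ∈ (Finset.univ : Finset (Fin m)),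
          {A | ε * n < |∑ j ∈ goodCols D τ A, (A j i - mean D i)|}) ∪
        {A | ∃ θ : Vec m, supNorm θ ≤ L ∧ (((goodCols D τ A).filter fun j =>
        3 / 4 * κ * min 1 (supNorm θ * sigma D) ≤ distInt (inner ℝ θ (A j))).card : ℝ)
          < κ * n / 2} := by
    intro A hA
    by_contra hcon
    simp only [Set.mem_union, Set.mem_ofPred_eq, Set.mem_iUnion, Finset.mem_univ, not_or,
      not_exists, not_lt, not_and, exists_prop, true_and] at hcon
    exact hA ⟨hcon.1.1, hcon.1.2, hcon.2⟩
  refine (measureReal_mono hcov (measure_ne_top _ _)).trans ((measureReal_union_le _ _).trans (add_le_add ?_ e3))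
  refine (measureReal_union_le _ _).trans (add_le_add e1 ?_)
  refine (measureReal_biUnion_finset_le _ _).trans ?_
  refine (Finset.sum_le_sum fun i _ => e2 i).trans (le_of_eq ?_)
  simp; ring

end Net

/-! ### Choosing the sampling weights -/

section Weights

variable {D : Measure (Vec m)} {n : ℕ} {A : Fin n → Vec m} {κ τ ε L B : ℝ}

theorem norm_le_of_mem_goodCols (hB : ‖mean D‖ + τ ≤ B) {j : Fin n} (hj : j ∈ goodCols D τ A) :
    ‖A j‖ ≤ B := by
  rw [mem_goodCols] at hj
  have := norm_le_norm_add_norm_sub' (A j) (mean D)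
  linarith

open Classical in
-- Because `|⟨θ, A j⟩|` dominates `distInt` and is homogeneous, the spread condition at sup norm `r`
-- scales to every `θ`, with neither the cap at `1` nor the bound `L`.
theorem Regular.card_abs_inner_ge (hA : Regular D κ τ ε L A) (hκ : 0 < κ) (hσ : 0 < sigma D)
    (hm : 1 ≤ m) (hσB : sigma D ≤ B) (hL : 1 / (2 * √m * B) ≤ L)
    (θ : Vec m) :
    κ * n / 2 ≤ ((goodCols D τ A).filter fun j =>
      3 / 4 * κ * (supNorm θ * sigma D) ≤ |inner ℝ θ (A j)|).card := by
  have hm0 : (0 : ℝ) < m := by exact_mod_cast hm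
  have hs0 : 0 < √(m : ℝ) := Real.sqrt_pos.mpr hm0
  have hs1 : 1 ≤ √(m : ℝ) := by rw [Real.one_le_sqrt]; exact_mod_cast hm
  have hB0 : 0 < B := hσ.trans_le hσB
  set r := 1 / (2 * √m * B) with hr
  have hr0 : 0 < r := by positivity
  have hrσ : r * sigma D ≤ 1 / 2 := by
    rw [hr, div_mul_eq_mul_div, div_le_div_iff₀ (by positivity) (by norm_num)]
    nlinarith [mul_le_mul hs1 hσB hσ.le hs0.le]
  rcases (supNorm_nonneg θ).eq_or_lt with h0 | h0
  · have h := hA.spread θ (h0 ▸ (hr0.le.trans hL))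
    refine h.trans ?_
    have : ((goodCols D τ A).filter fun j =>
        3 / 4 * κ * min 1 (supNorm θ * sigma D) ≤ distInt (inner ℝ θ (A j))) ⊆
        ((goodCols D τ A).filter fun j =>
          3 / 4 * κ * (supNorm θ * sigma D) ≤ |inner ℝ θ (A j)|) := by
      intro j hj
      rw [Finset.mem_filter] at hj ⊢
      refine ⟨hj.1, ?_⟩
      rw [← h0, zero_mul, mul_zero]; exact abs_nonneg _
    exact_mod_cast Finset.card_le_card this
  · set t := r / supNorm θ with ht
    have ht0 : 0 < t := by positivity
    have hnt : supNorm (t • θ) = r := by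
      rw [supNorm_smul, abs_of_pos ht0, ht]; field_simp
    refine (hA.spread (t • θ) (hnt.trans_le hL)).trans ?_
    have : ((goodCols D τ A).filter fun j =>
        3 / 4 * κ * min 1 (supNorm (t • θ) * sigma D) ≤ distInt (inner ℝ (t • θ) (A j))) ⊆
        ((goodCols D τ A).filter fun j =>
        3 / 4 * κ * (supNorm θ * sigma D) ≤ |inner ℝ θ (A j)|) := by
      intro j hj
      rw [Finset.mem_filter] at hj ⊢
      refine ⟨hj.1, ?_⟩
      have hj2 := hj.2
      rw [hnt, min_eq_right (by linarith)] at hj2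
      have h1 := hj2.trans (distInt_le_abs _)
      rw [inner_smul_left, abs_mul] at h1
      simp only [conj_trivial, abs_of_pos ht0] at h1
      have e : 3 / 4 * κ * (r * sigma D) = t * (3 / 4 * κ * (supNorm θ * sigma D)) := by
        rw [ht]; field_simp
      rw [e] at h1
      exact le_of_mul_le_mul_left h1 ht0
    exact_mod_cast Finset.card_le_card this

/-- The sum on the right is the support function of the zonotope spanned by the good columns; this
says that the zonotope is fat in every direction. -/
theorem Regular.sum_abs_inner_ge (hA : Regular D κ τ ε L A) (hκ : 0 < κ) (hσ : 0 < sigma D)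
    (hm : 1 ≤ m) (hσB : sigma D ≤ B) (hL : 1 / (2 * √m * B) ≤ L)
    (θ : Vec m) :
    3 / 8 * κ ^ 2 * sigma D * n * supNorm θ ≤ ∑ j ∈ goodCols D τ A, |inner ℝ θ (A j)| := by
  classical
  have h := hA.card_abs_inner_ge hκ hσ hm hσB hL θ
  have h0 := supNorm_nonneg θ
  calc 3 / 8 * κ ^ 2 * sigma D * n * supNorm θ
      = (κ * n / 2) * (3 / 4 * κ * (supNorm θ * sigma D)) := by ring
    _ ≤ (((goodCols D τ A).filter fun j =>
          3 / 4 * κ * (supNorm θ * sigma D) ≤ |inner ℝ θ (A j)|).card : ℝ)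
          * (3 / 4 * κ * (supNorm θ * sigma D)) := by gcongr
    _ ≤ ∑ j ∈ (goodCols D τ A).filter fun j =>
          3 / 4 * κ * (supNorm θ * sigma D) ≤ |inner ℝ θ (A j)|, |inner ℝ θ (A j)| := by
        rw [← nsmul_eq_mul]
        apply Finset.card_nsmul_le_sum
        intro j hj
        exact (Finset.mem_filter.mp hj).2
    _ ≤ _ := Finset.sum_le_sum_of_subset_of_nonneg (Finset.filter_subset _ _)
          fun _ _ _ => abs_nonneg _

/-- A vector which no functional separates from a zonotope lies in it. -/
theorem exists_sum_smul_eq {ι : Type*} (G : Finset ι) (a : ι → Vec m) {δ : ℝ} (hδ : 0 ≤ δ)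
    (b : Vec m) (h : ∀ ν : Vec m, inner ℝ ν b ≤ δ * ∑ j ∈ G, |inner ℝ ν (a j)|) :
    ∃ c : ι → ℝ, (∀ j, |c j| ≤ δ) ∧ ∑ j ∈ G, c j • a j = b := by
  classical
  set T : (ι → ℝ) →ₗ[ℝ] Vec m :=
    ∑ j ∈ G, (LinearMap.proj j : (ι → ℝ) →ₗ[ℝ] ℝ).smulRight (a j) with hT
  have hTa : ∀ c, T c = ∑ j ∈ G, c j • a j := by intro c; simp [hT]
  have hTc : Continuous T := by
    have : (T : (ι → ℝ) → Vec m) = fun c => ∑ j ∈ G, c j • a j := funext hTa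
    rw [this]; fun_prop
  set box : Set (ι → ℝ) := Set.univ.pi fun _ => Set.Icc (-δ) δ with hbox
  have hcomp : IsCompact (T '' box) := (isCompact_univ_pi fun _ => isCompact_Icc).image hTc
  have hconv : Convex ℝ (T '' box) := (convex_pi fun _ _ => convex_Icc _ _).linear_image T
  by_cases hb : b ∈ T '' box
  · obtain ⟨c, hc, hcb⟩ := hb
    exact ⟨c, fun j => abs_le.mpr (hc j (Set.mem_univ j)), by rw [← hTa, hcb]⟩
  · exfalso
    obtain ⟨f, u, h1, h2⟩ := geometric_hahn_banach_closed_point hconv hcomp.isClosed hb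
    set ν := (InnerProductSpace.toDual ℝ (Vec m)).symm f
    have hν : ∀ x, inner ℝ ν x = f x := fun x => InnerProductSpace.toDual_symm_apply
    -- The vertex of the box at which the separating functional attains its maximum over the
    -- zonotope, namely `δ ∑ |⟨ν, a j⟩|`.
    set c : ι → ℝ := fun j => if 0 ≤ f (a j) then δ else -δ with hc
    have hcm : c ∈ box := by
      intro j _
      simp only [hc]
      split_ifs
      · exact ⟨by linarith, le_rfl⟩
      · exact ⟨le_rfl, by linarith⟩
    have h3 := h1 _ ⟨c, hcm, rfl⟩
    have h4 : f (T c) = δ * ∑ j ∈ G, |inner ℝ ν (a j)| := by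
      rw [hTa, map_sum, Finset.mul_sum]
      apply Finset.sum_congr rfl
      intro j _
      rw [map_smul, hν, smul_eq_mul]
      simp only [hc]
      split_ifs with h0
      · rw [abs_of_nonneg h0]
      · rw [abs_of_neg (not_le.mp h0)]; ring
    have h5 := h ν
    rw [hν] at h5
    linarith

/-- Start from the constant weight `q0 = pn / |G|` and correct it by factors `1 + c j` with `|c j| ≤
1/50`. The defect `b` has coordinates at most `σ√(mn) + εn`, so it lies in the zonotope scaled by
`1/50`; the bound in `hsmall` is `1/50` of the `3/8` in `Regular.sum_abs_inner_ge`. -/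
theorem Regular.exists_weights (hA : Regular D κ τ ε L A) (hκ : 0 < κ) (hσ : 0 < sigma D)
    (hm : 1 ≤ m) (hn : 0 < n) (hσB : sigma D ≤ B)
    (hL : 1 / (2 * √m * B) ≤ L)
    (hsmall : m * (sigma D * √(m * n) + ε * n) ≤ 3 / 400 * κ ^ 2 * sigma D * n)
    {p : ℝ} (hp : 0 < p) {l : Vec m}
    (hl : ‖l - (p * n) • mean D‖ ≤ sigma D * p * √(m * n)) :
    ∃ q : Fin n → ℝ, (∀ j, 98 / 100 * p ≤ q j ∧ q j ≤ 104 / 100 * p) ∧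
      ∑ j ∈ goodCols D τ A, q j • A j = l ∧
      98 / 100 * (p * n) ≤ ∑ j ∈ goodCols D τ A, q j ∧
      ∑ j ∈ goodCols D τ A, q j ≤ 102 / 100 * (p * n) := by
  set G := goodCols D τ A with hG
  have hn0 : (0 : ℝ) < n := by exact_mod_cast hn
  have hc1 := hA.card_le
  rw [← hG] at hc1
  have hc2 : (G.card : ℝ) ≤ n := by
    have := Finset.card_le_univ G
    rw [Fintype.card_fin] at this; exact_mod_cast this
  have hc0 : (0 : ℝ) < G.card := by linarith
  set q0 := p * n / G.card with hq0
  have hq0p : p ≤ q0 := by rw [hq0, le_div_iff₀ hc0]; gcongr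
  have hq0u : q0 ≤ 1.0102 * p := by
    rw [hq0, div_le_iff₀ hc0]
    nlinarith
  have hq0pos : 0 < q0 := hp.trans_le hq0p
  have hqc : q0 * G.card = p * n := by rw [hq0]; field_simp
  set b : Vec m := q0⁻¹ • l - ∑ j ∈ G, A j with hb
  have hbi : ∀ i, |b i| ≤ sigma D * √(m * n) + ε * n := by
    intro i
    have e : b i = q0⁻¹ * ((l - (p * n) • mean D) i) - ∑ j ∈ G, (A j i - mean D i) := by
      rw [Finset.sum_sub_distrib, Finset.sum_const, nsmul_eq_mul]
      simp only [hb, PiLp.sub_apply, PiLp.smul_apply, smul_eq_mul, WithLp.ofLp_sum,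
        Finset.sum_apply]
      rw [← hqc]; field_simp; ring
    rw [e]
    refine (abs_sub _ _).trans (add_le_add ?_ (hA.sum_le i))
    rw [abs_mul, abs_of_pos (inv_pos.mpr hq0pos)]
    have h1 : |(l - (p * n) • mean D) i| ≤ sigma D * p * √(m * n) := by
      refine le_trans ?_ hl
      simpa using PiLp.norm_apply_le (l - (p * n) • mean D) i
    calc q0⁻¹ * |(l - (p * n) • mean D) i| ≤ p⁻¹ * (sigma D * p * √(m * n)) := by gcongr
      _ = _ := by field_simp
  obtain ⟨c, hcδ, hcb⟩ := exists_sum_smul_eq G A (δ := 1 / 50) (by norm_num) b (by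
    intro ν
    have h0 := supNorm_nonneg ν
    calc inner ℝ ν b ≤ supNorm ν * ∑ i, |b i| := inner_le_supNorm_mul_sum ν b
      _ ≤ supNorm ν * ∑ _i : Fin m, (sigma D * √(m * n) + ε * n) := by
          gcongr with i; exact hbi i
      _ = supNorm ν * (m * (sigma D * √(m * n) + ε * n)) := by
          rw [Finset.sum_const, Finset.card_univ, Fintype.card_fin, nsmul_eq_mul]
      _ ≤ supNorm ν * (3 / 400 * κ ^ 2 * sigma D * n) := by gcongr
      _ = 1 / 50 * (3 / 8 * κ ^ 2 * sigma D * n * supNorm ν) := by ring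
      _ ≤ _ := by
          gcongr
          exact hA.sum_abs_inner_ge hκ hσ hm hσB hL ν)
  have hcl : ∀ j, -(1 / 50) ≤ c j ∧ c j ≤ 1 / 50 := fun j => abs_le.mp (hcδ j)
  refine ⟨fun j => q0 * (1 + c j), fun j => ⟨?_, ?_⟩, ?_, ?_, ?_⟩
  · have := hcl j; nlinarith
  · have := hcl j; nlinarith
  · have : ∀ j, (q0 * (1 + c j)) • A j = q0 • (A j + c j • A j) := by
      intro j; rw [mul_smul, add_smul, one_smul]
    simp_rw [this]
    rw [← Finset.smul_sum, Finset.sum_add_distrib, hcb, hb]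
    rw [add_sub_cancel, smul_inv_smul₀ hq0pos.ne']
  · rw [← Finset.mul_sum]
    have : (G.card : ℝ) * (98 / 100) ≤ ∑ j ∈ G, (1 + c j) := by
      rw [← nsmul_eq_mul]
      exact Finset.card_nsmul_le_sum _ _ _ fun j _ => by have := hcl j; linarith
    nlinarith
  · rw [← Finset.mul_sum]
    have : ∑ j ∈ G, (1 + c j) ≤ (G.card : ℝ) * (102 / 100) := by
      rw [← nsmul_eq_mul]
      exact Finset.sum_le_card_nsmul _ _ _ fun j _ => by have := hcl j; linarith
    nlinarith

end Weights

/-! ### The size of a random subset -/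

section Subsets

variable {ι : Type*} [DecidableEq ι]

/-- The probability of `S` when the elements `j` of `G` are chosen independently with
probabilities `q j`. -/
def subsetWeight (G : Finset ι) (q : ι → ℝ) (S : Finset ι) : ℝ :=
  (∏ j ∈ S, q j) * ∏ j ∈ G \ S, (1 - q j)

theorem subsetWeight_nonneg {G : Finset ι} {q : ι → ℝ} (h0 : ∀ j, 0 ≤ q j) (h1 : ∀ j, q j ≤ 1)
    (S : Finset ι) : 0 ≤ subsetWeight G q S :=
  mul_nonneg (Finset.prod_nonneg fun j _ => h0 j)
    (Finset.prod_nonneg fun j _ => sub_nonneg.mpr (h1 j))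

theorem sum_subsetWeight (G : Finset ι) (q : ι → ℝ) :
    ∑ S ∈ G.powerset, subsetWeight G q S = 1 := by
  unfold subsetWeight
  rw [← Finset.prod_add]
  simp

theorem sum_subsetWeight_mul_prod {G : Finset ι} (q : ι → ℝ) (u : ℝ) :
    ∑ S ∈ G.powerset, subsetWeight G q S * u ^ S.card = ∏ j ∈ G, (1 + q j * (u - 1)) := by
  have : ∀ j, 1 + q j * (u - 1) = q j * u + (1 - q j) := fun j => by ring
  simp_rw [this]
  rw [Finset.prod_add]
  apply Finset.sum_congr rfl
  intro S _
  rw [subsetWeight, Finset.prod_mul_distrib, Finset.prod_const]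
  ring

/-- Exponential Markov inequality with tilt `u`; `u < 1` serves the lower tail of the size, `u > 1`
the upper. -/
theorem sum_subsetWeight_filter_le {G : Finset ι} {q : ι → ℝ} (h0 : ∀ j, 0 ≤ q j)
    (h1 : ∀ j, q j ≤ 1) {u r : ℝ} (hu : 0 < u) (F : Finset ι → Prop) [DecidablePred F]
    (hF : ∀ S, F S → Real.exp r ≤ u ^ S.card) :
    ∑ S ∈ G.powerset with F S, subsetWeight G q S
      ≤ Real.exp ((u - 1) * ∑ j ∈ G, q j - r) := by
  rw [Real.exp_sub, le_div_iff₀ (Real.exp_pos _), Finset.sum_mul]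
  have hw := subsetWeight_nonneg (G := G) h0 h1
  calc ∑ S ∈ G.powerset with F S, subsetWeight G q S * Real.exp r
      ≤ ∑ S ∈ G.powerset with F S, subsetWeight G q S * u ^ S.card := by
        apply Finset.sum_le_sum
        intro S hS
        exact mul_le_mul_of_nonneg_left (hF S (Finset.mem_filter.mp hS).2) (hw S)
    _ ≤ ∑ S ∈ G.powerset, subsetWeight G q S * u ^ S.card :=
        Finset.sum_le_sum_of_subset_of_nonneg (Finset.filter_subset _ _)
          fun S _ _ => mul_nonneg (hw S) (by positivity)
    _ = ∏ j ∈ G, (1 + q j * (u - 1)) := sum_subsetWeight_mul_prod q u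
    _ ≤ ∏ j ∈ G, Real.exp ((u - 1) * q j) := by
        apply Finset.prod_le_prod
        · intro j _; nlinarith [h0 j, h1 j, mul_nonneg (h0 j) hu.le]
        · intro j _
          have := Real.add_one_le_exp ((u - 1) * q j)
          linarith
    _ = _ := by rw [← Real.exp_sum, Finset.mul_sum]

theorem log_three_halves_gt : (0.405 : ℝ) < Real.log (3 / 2) := by
  rw [Real.log_div (by norm_num) (by norm_num)]
  linarith [Real.log_three_gt_d9, Real.log_two_lt_d9]

/-- The number of chosen elements is rarely outside `[x/2, 3x/2]`. -/
theorem sum_subsetWeight_card_le {G : Finset ι} {q : ι → ℝ} (h0 : ∀ j, 0 ≤ q j)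
    (h1 : ∀ j, q j ≤ 1) {x : ℝ} (hx : 0 ≤ x) (hl : 98 / 100 * x ≤ ∑ j ∈ G, q j)
    (hu : ∑ j ∈ G, q j ≤ 102 / 100 * x) :
    ∑ S ∈ G.powerset with ¬ (x / 2 ≤ (S.card : ℝ) ∧ (S.card : ℝ) ≤ 3 * x / 2),
      subsetWeight G q S ≤ 2 * Real.exp (-(9 / 100 * x)) := by
  have hw := subsetWeight_nonneg (G := G) h0 h1
  have hlog := log_three_halves_gt
  have hlog2 := Real.log_two_lt_d9
  -- The tilts `1/2` and `3/2` give exponents at most `(-0.49 + (log 2)/2) x` and `(0.51 - (3/2) log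
  -- (3/2)) x`; both are below `-0.09 x`.
  have hlow := sum_subsetWeight_filter_le (G := G) h0 h1 (u := 1 / 2) (r := -Real.log 2 * (x / 2))
    (by norm_num) (fun S => (S.card : ℝ) < x / 2) (by
      intro S hS
      have e : (1 / 2 : ℝ) ^ S.card = Real.exp (-Real.log 2 * S.card) := by
        rw [mul_comm, Real.exp_nat_mul, Real.exp_neg, Real.exp_log (by norm_num)]; norm_num
      rw [e]
      apply Real.exp_le_exp.mpr
      have : 0 < Real.log 2 := Real.log_pos (by norm_num)
      nlinarith)
  have hupp := sum_subsetWeight_filter_le (G := G) h0 h1 (u := 3 / 2)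
    (r := Real.log (3 / 2) * (3 * x / 2))
    (by norm_num) (fun S => 3 * x / 2 < (S.card : ℝ)) (by
      intro S hS
      have e : (3 / 2 : ℝ) ^ S.card = Real.exp (Real.log (3 / 2) * S.card) := by
        rw [mul_comm, Real.exp_nat_mul, Real.exp_log (by norm_num)]
      rw [e]
      apply Real.exp_le_exp.mpr
      nlinarith)
  have hsplit : ∑ S ∈ G.powerset with ¬ (x / 2 ≤ (S.card : ℝ) ∧ (S.card : ℝ) ≤ 3 * x / 2),
      subsetWeight G q S
      ≤ ∑ S ∈ G.powerset with (S.card : ℝ) < x / 2, subsetWeight G q S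
        + ∑ S ∈ G.powerset with 3 * x / 2 < (S.card : ℝ), subsetWeight G q S := by
    rw [Finset.sum_filter, Finset.sum_filter, Finset.sum_filter, ← Finset.sum_add_distrib]
    apply Finset.sum_le_sum
    intro S _
    have := hw S
    by_cases h2 : (S.card : ℝ) < x / 2
    · have h3 : ¬ (x / 2 ≤ (S.card : ℝ) ∧ (S.card : ℝ) ≤ 3 * x / 2) := fun h => by linarith [h.1]
      rw [if_pos h3, if_pos h2]
      split_ifs <;> linarith
    · by_cases h4 : 3 * x / 2 < (S.card : ℝ)
      · rw [if_pos h4, if_neg h2]; split_ifs <;> linarith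
      · rw [if_neg h4, if_neg h2, if_neg]
        · simp
        · push Not at h2 h4 ⊢
          exact ⟨h2, h4⟩
  have e1 : Real.exp ((1 / 2 - 1) * ∑ j ∈ G, q j - -Real.log 2 * (x / 2))
      ≤ Real.exp (-(9 / 100 * x)) := by
    apply Real.exp_le_exp.mpr; nlinarith
  have e2 : Real.exp ((3 / 2 - 1) * ∑ j ∈ G, q j - Real.log (3 / 2) * (3 * x / 2))
      ≤ Real.exp (-(9 / 100 * x)) := by
    apply Real.exp_le_exp.mpr; nlinarith
  linarith

end Subsets

/-! ### The characteristic function of a random subset sum -/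

section CharFun

variable {n : ℕ}

/-- The characteristic function of `∑ j ∈ S, A j - l` for the random subset `S` of `G`. -/
def subsetChar (G : Finset (Fin n)) (q : Fin n → ℝ) (A : Fin n → Vec m) (l θ : Vec m) : ℂ :=
  (∏ j ∈ G, ((1 - q j : ℂ) + q j * chr (inner ℝ θ (A j)))) * chr (-inner ℝ θ l)

variable {G : Finset (Fin n)} {q : Fin n → ℝ} {A : Fin n → Vec m} {l : Vec m}

theorem subsetChar_eq_sum (θ : Vec m) :
    subsetChar G q A l θ = ∑ S ∈ G.powerset,
      (subsetWeight G q S : ℂ) * chr (inner ℝ θ (subsetSum A S - l)) := by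
  have h : ∀ j, (1 - q j : ℂ) + q j * chr (inner ℝ θ (A j))
      = q j * chr (inner ℝ θ (A j)) + (1 - q j) := fun j => by ring
  unfold subsetChar
  simp_rw [h]
  rw [Finset.prod_add, Finset.sum_mul]
  apply Finset.sum_congr rfl
  intro S _
  rw [inner_sub_right, sub_eq_add_neg, chr_add, subsetSum, inner_sum, chr_sum,
    Finset.prod_mul_distrib, subsetWeight]
  push_cast
  ring

/-- Since `l` is exactly the expected sum, the phase of `l` splits into the phases that centre the
individual factors. -/
theorem subsetChar_eq_prod (hl : ∑ j ∈ G, q j • A j = l) (θ : Vec m) :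
    subsetChar G q A l θ = ∏ j ∈ G,
      ((1 - q j : ℂ) + q j * chr (inner ℝ θ (A j))) * chr (-(q j * inner ℝ θ (A j))) := by
  rw [Finset.prod_mul_distrib, ← chr_sum, subsetChar, ← hl, inner_sum, Finset.sum_neg_distrib]
  simp_rw [inner_smul_right]

theorem continuous_subsetChar : Continuous (subsetChar G q A l) := by
  unfold subsetChar
  have := continuous_chr
  fun_prop

theorem norm_subsetChar_le {p : ℝ} (hp : 0 ≤ p) (hp1 : p ≤ 1 / 1000)
    (hq : ∀ j, 98 / 100 * p ≤ q j ∧ q j ≤ 104 / 100 * p) (θ : Vec m) :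
    ‖subsetChar G q A l θ‖ ≤ Real.exp (-(7 * (p * ∑ j ∈ G, distInt (inner ℝ θ (A j)) ^ 2))) := by
  unfold subsetChar
  rw [norm_mul, norm_chr, mul_one, norm_prod, Finset.mul_sum, Finset.mul_sum,
    ← Finset.sum_neg_distrib, Real.exp_sum]
  apply Finset.prod_le_prod (fun _ _ => norm_nonneg _)
  intro j _
  obtain ⟨h1, h2⟩ := hq j
  refine (norm_bernoulli_chr_le (by nlinarith) (by nlinarith) _).trans ?_
  apply Real.exp_le_exp.mpr
  rw [neg_le_neg_iff, ← mul_assoc]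
  apply mul_le_mul_of_nonneg_right _ (sq_nonneg _)
  nlinarith

theorem norm_subsetChar_le_one (h0 : ∀ j, 0 ≤ q j) (h1 : ∀ j, q j ≤ 1) (θ : Vec m) :
    ‖subsetChar G q A l θ‖ ≤ 1 := by
  unfold subsetChar
  rw [norm_mul, norm_chr, mul_one, norm_prod]
  apply Finset.prod_le_one (fun _ _ => norm_nonneg _)
  intro j _
  refine (norm_bernoulli_chr_le (h0 j) (h1 j) _).trans ?_
  rw [Real.exp_le_one_iff, neg_nonpos]
  have := h0 j
  have : 0 ≤ 1 - q j := sub_nonneg.mpr (h1 j)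
  positivity

/-- Each centred factor is `r j (1 + d j)` with `r j` its real quadratic Taylor polynomial. The real
product is at least `exp (-42Q)`, and the relative errors `d j` are summable to at most `2/5`, so
they cannot turn the product away from the positive axis. -/
theorem re_subsetChar_ge {p T : ℝ} (hp : 0 ≤ p) (hp1 : p ≤ 1 / 1000)
    (hq : ∀ j, 98 / 100 * p ≤ q j ∧ q j ≤ 104 / 100 * p) (hl : ∑ j ∈ G, q j • A j = l)
    {θ : Vec m} (hT : ∀ j ∈ G, |inner ℝ θ (A j)| ≤ T) (hT1 : 7 * T ≤ 1)
    (hTQ : 520 * T * (p * ∑ j ∈ G, inner ℝ θ (A j) ^ 2) ≤ 2 / 5) :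
    1 / 2 * Real.exp (-(42 * (p * ∑ j ∈ G, inner ℝ θ (A j) ^ 2))) ≤ (subsetChar G q A l θ).re := by
  have hpi := Real.pi_pos
  have hpi2 := Real.pi_lt_d4
  set t : Fin n → ℝ := fun j => inner ℝ θ (A j) with ht
  set x : Fin n → ℝ := fun j => 2 * Real.pi * t j with hx
  set r : Fin n → ℝ := fun j => 1 - q j * (1 - q j) * x j ^ 2 / 2 with hr
  set f : Fin n → ℂ := fun j => ((1 - q j : ℂ) + q j * chr (t j)) * chr (-(q j * t j)) with hf
  set d : Fin n → ℂ := fun j => (f j - r j) / r j with hd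
  have hq0 : ∀ j, 0 ≤ q j := fun j => by have := hq j; nlinarith
  have hq1 : ∀ j, q j ≤ 1 := fun j => by have := hq j; nlinarith
  have hxle : ∀ j ∈ G, |x j| ≤ 1 := by
    intro j hj
    have h1 := hT j hj
    have h0 := abs_nonneg (t j)
    rw [hx]
    simp only
    rw [abs_mul, abs_of_pos Real.two_pi_pos]
    calc 2 * Real.pi * |t j| ≤ 7 * T := by
          apply mul_le_mul _ h1 h0 (by norm_num); linarith
      _ ≤ 1 := hT1
  have hx2 : ∀ j ∈ G, x j ^ 2 ≤ 1 := fun j hj => by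
    rw [← sq_abs]; exact pow_le_one₀ (abs_nonneg _) (hxle j hj)
  have hrh : ∀ j ∈ G, 1 / 2 ≤ r j := by
    intro j hj
    have h1 : q j * (1 - q j) ≤ 1 := by nlinarith [hq0 j, hq1 j]
    have h2 : 0 ≤ q j * (1 - q j) := mul_nonneg (hq0 j) (sub_nonneg.mpr (hq1 j))
    have h3 : q j * (1 - q j) * x j ^ 2 ≤ 1 := mul_le_one₀ h1 (sq_nonneg _) (hx2 j hj)
    simp only [hr]; linarith
  have hr0 : ∀ j ∈ G, 0 < r j := fun j hj => by linarith [hrh j hj]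
  have hdn : ∀ j ∈ G, ‖d j‖ ≤ 2 * (q j * |x j| ^ 3) := by
    intro j hj
    have h1 := norm_centered_bernoulli_chr_sub_le (hq0 j) (hq1 j) (hxle j hj)
    simp only [hd]
    rw [norm_div, Complex.norm_real, Real.norm_of_nonneg (hr0 j hj).le, div_le_iff₀ (hr0 j hj)]
    refine h1.trans ?_
    have : 0 ≤ q j * |x j| ^ 3 := mul_nonneg (hq0 j) (by positivity)
    nlinarith [hrh j hj]
  have hfd : ∀ j ∈ G, f j = (r j : ℂ) * (1 + d j) := by
    intro j hj
    have : (r j : ℂ) ≠ 0 := by exact_mod_cast (hr0 j hj).ne'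
    simp only [hd]; field_simp; ring
  have hprod : subsetChar G q A l θ = ((∏ j ∈ G, r j : ℝ) : ℂ) * ∏ j ∈ G, (1 + d j) := by
    rw [subsetChar_eq_prod hl]
    push_cast
    rw [← Finset.prod_mul_distrib]
    exact Finset.prod_congr rfl hfd
  have hsum : ∑ j ∈ G, ‖d j‖ ≤ 2 / 5 := by
    refine le_trans ?_ hTQ
    rw [Finset.mul_sum, Finset.mul_sum]
    apply Finset.sum_le_sum
    intro j hj
    refine (hdn j hj).trans ?_
    have e : |x j| ^ 3 = (2 * Real.pi) ^ 3 * |t j| * t j ^ 2 := by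
      rw [← sq_abs (t j), hx]; simp only
      rw [abs_mul, abs_of_pos Real.two_pi_pos]; ring
    have h8 : (2 * Real.pi) ^ 3 ≤ 250 := by
      calc (2 * Real.pi) ^ 3 ≤ (2 * 3.1416) ^ 3 := by gcongr
        _ ≤ 250 := by norm_num
    rw [e]
    calc 2 * (q j * ((2 * Real.pi) ^ 3 * |t j| * t j ^ 2))
        ≤ 2 * (104 / 100 * p * (250 * T * t j ^ 2)) := by
          gcongr
          · exact (hq j).2
          · exact hT j hj
      _ ≤ 520 * T * (p * t j ^ 2) := by
          have : 0 ≤ T * (p * t j ^ 2) :=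
            mul_nonneg ((abs_nonneg _).trans (hT j hj)) (by positivity)
          nlinarith
  -- As `e^{2/5} ≤ 3/2`, the product of the `1 + d j` is within `1/2` of `1`.
  have hclose := Finset.norm_prod_one_add_sub_one_le G d
  have hexp : Real.exp (∑ j ∈ G, ‖d j‖) ≤ 3 / 2 := by
    rw [← Real.le_log_iff_exp_le (by norm_num)]
    have := log_three_halves_gt
    linarith
  have hre : 1 / 2 ≤ (∏ j ∈ G, (1 + d j)).re := by
    have h1 := Complex.abs_re_le_norm (∏ j ∈ G, (1 + d j) - 1)
    rw [Complex.sub_re, Complex.one_re] at h1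
    have h2 := (abs_le.mp (h1.trans (hclose.trans (sub_le_sub_right hexp 1)))).1
    linarith
  have hrprod : Real.exp (-(42 * (p * ∑ j ∈ G, t j ^ 2))) ≤ ∏ j ∈ G, r j := by
    rw [Finset.mul_sum, Finset.mul_sum, ← Finset.sum_neg_distrib, Real.exp_sum]
    apply Finset.prod_le_prod (fun _ _ => (Real.exp_pos _).le)
    intro j hj
    have h4 : (2 * Real.pi) ^ 2 ≤ 40 := by
      calc (2 * Real.pi) ^ 2 ≤ (2 * 3.1416) ^ 2 := by gcongr
        _ ≤ 40 := by norm_num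
    have h5 : q j * (1 - q j) * x j ^ 2 / 2 ≤ 21 * (p * t j ^ 2) := by
      have e : x j ^ 2 = (2 * Real.pi) ^ 2 * t j ^ 2 := by rw [hx]; ring
      rw [e]
      have h6 : q j * (1 - q j) ≤ 104 / 100 * p := by nlinarith [hq0 j, (hq j).2]
      calc q j * (1 - q j) * ((2 * Real.pi) ^ 2 * t j ^ 2) / 2
          ≤ 104 / 100 * p * (40 * t j ^ 2) / 2 := by gcongr
        _ ≤ _ := by nlinarith [mul_nonneg hp (sq_nonneg (t j))]
    have h7 : 0 ≤ q j * (1 - q j) * x j ^ 2 / 2 := by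
      have := mul_nonneg (hq0 j) (sub_nonneg.mpr (hq1 j)); positivity
    have h8 := hrh j hj
    set y := q j * (1 - q j) * x j ^ 2 / 2 with hy
    have h9 : Real.exp (-(2 * y)) ≤ 1 - y := by
      have hy2 : y ≤ 1 / 2 := by simp only [hr] at h8; linarith
      rw [Real.exp_neg, inv_le_comm₀ (Real.exp_pos _) (by linarith)]
      have := Real.add_one_le_exp (2 * y)
      refine le_trans ?_ this
      rw [inv_le_iff_one_le_mul₀ (by linarith)]
      nlinarith
    refine le_trans (Real.exp_le_exp.mpr ?_) h9
    linarith
  rw [hprod, Complex.re_ofReal_mul]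
  have hp0 : 0 ≤ ∏ j ∈ G, r j := Finset.prod_nonneg fun j hj => (hr0 j hj).le
  calc _ ≤ 1 / 2 * ∏ j ∈ G, r j := by gcongr
    _ = (∏ j ∈ G, r j) * (1 / 2) := mul_comm _ _
    _ ≤ _ := by gcongr

end CharFun

/-! ### Quadratic forms and Gaussian integrals -/

section Quadratic

variable {n : ℕ}

/-- The quadratic form `θ ↦ p ∑ ⟨θ, A j⟩²`. -/
def quadForm (p : ℝ) (G : Finset (Fin n)) (A : Fin n → Vec m) (θ : Vec m) : ℝ :=
  p * ∑ j ∈ G, inner ℝ θ (A j) ^ 2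

variable {p : ℝ} {G : Finset (Fin n)} {A : Fin n → Vec m}

theorem continuous_quadForm : Continuous (quadForm p G A) := by
  unfold quadForm; fun_prop

theorem quadForm_nonneg (hp : 0 ≤ p) (θ : Vec m) : 0 ≤ quadForm p G A θ :=
  mul_nonneg hp (Finset.sum_nonneg fun _ _ => sq_nonneg _)

theorem quadForm_le {B : ℝ} (hp : 0 ≤ p) (hB : ∀ j ∈ G, ‖A j‖ ≤ B) (θ : Vec m) :
    quadForm p G A θ ≤ p * n * m * B ^ 2 * supNorm θ ^ 2 := by
  have h0 := supNorm_nonneg θ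
  have hc : (G.card : ℝ) ≤ n := by
    have := Finset.card_le_univ G
    rw [Fintype.card_fin] at this; exact_mod_cast this
  have h1 : ∑ j ∈ G, inner ℝ θ (A j) ^ 2 ≤ G.card * (m * B ^ 2 * supNorm θ ^ 2) := by
    rw [← nsmul_eq_mul]
    apply Finset.sum_le_card_nsmul
    intro j hj
    have h2 : |inner ℝ θ (A j)| ≤ √m * supNorm θ * B := by
      refine (abs_inner_le_supNorm _ _).trans ?_
      gcongr; exact hB j hj
    rw [← sq_abs]
    calc |inner ℝ θ (A j)| ^ 2 ≤ (√m * supNorm θ * B) ^ 2 := by gcongr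
      _ = _ := by rw [mul_pow, mul_pow, Real.sq_sqrt (Nat.cast_nonneg m)]; ring
  unfold quadForm
  calc p * ∑ j ∈ G, inner ℝ θ (A j) ^ 2 ≤ p * (n * (m * B ^ 2 * supNorm θ ^ 2)) := by
        apply mul_le_mul_of_nonneg_left _ hp
        refine h1.trans ?_
        gcongr
    _ = _ := by ring

/-- A definite quadratic form has Gaussian integral at most `√(m!)` times the volume of its unit
ball. -/
theorem integral_exp_neg_quadForm (hp : 0 ≤ p) {c : ℝ} (hc : 0 < c)
    (hpos : ∀ θ : Vec m, c * supNorm θ ^ 2 ≤ quadForm p G A θ) (hm : 1 ≤ m) :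
    Integrable (fun θ : Vec m => Real.exp (-quadForm p G A θ)) ∧
    ∫ θ : Vec m, Real.exp (-quadForm p G A θ)
      ≤ √(m.factorial) * volume.real {θ : Vec m | quadForm p G A θ < 1} := by
  have hm0 : (0 : ℝ) < m := by exact_mod_cast hm
  have hpos' : ∀ θ : Vec m, c / m * ‖θ‖ ^ 2 ≤ quadForm p G A θ := by
    intro θ
    refine le_trans ?_ (hpos θ)
    have h1 := pow_le_pow_left₀ (norm_nonneg _) (norm_le_sqrt_mul_supNorm θ) 2
    rw [mul_pow, Real.sq_sqrt hm0.le] at h1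
    rw [div_mul_eq_mul_div, div_le_iff₀ hm0]
    nlinarith
  have hint : Integrable (fun θ : Vec m => Real.exp (-quadForm p G A θ)) := by
    have hg : Integrable (fun θ : Vec m => Real.exp (-(c / m) * ‖θ‖ ^ 2)) := by
      have h := GaussianFourier.integrable_cexp_neg_mul_sq_norm_add (V := Vec m)
        (b := ((c / m : ℝ) : ℂ)) (by rw [Complex.ofReal_re]; positivity) 0 0
      have h2 := h.norm
      refine h2.congr (Filter.Eventually.of_forall fun θ => ?_)
      simp only [Complex.norm_exp]
      congr 1
      have e : (-((c / m : ℝ) : ℂ) * (‖θ‖ : ℂ) ^ 2 + 0 * ((inner ℝ (0 : Vec m) θ : ℝ) : ℂ))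
        = ((-(c / m) * ‖θ‖ ^ 2 : ℝ) : ℂ) := by push_cast; ring
      rw [e, Complex.ofReal_re]
    refine hg.mono' ?_ (Filter.Eventually.of_forall fun θ => ?_)
    · exact (Real.continuous_exp.comp continuous_quadForm.neg).aestronglyMeasurable
    · rw [Real.norm_of_nonneg (Real.exp_pos _).le]
      apply Real.exp_le_exp.mpr
      have := hpos' θ
      linarith
  refine ⟨hint, ?_⟩
  -- Writing the form as `‖T θ‖²` makes its square root a norm on `Vec m`, for which the Gaussian
  -- integral is `Γ(m/2 + 1)` times the volume of the unit ball.
  set T : Vec m →ₗ[ℝ] EuclideanSpace ℝ (Fin n) :=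
    (WithLp.linearEquiv 2 ℝ (Fin n → ℝ)).symm.toLinearMap ∘ₗ
      LinearMap.pi fun j => if j ∈ G then √p • (innerₗ (Vec m)).flip (A j) else 0 with hT
  have hTj : ∀ θ j, T θ j = if j ∈ G then √p * inner ℝ θ (A j) else 0 := by
    intro θ j
    simp only [hT, LinearMap.comp_apply]
    change (LinearMap.pi (fun j => if j ∈ G then √p • (innerₗ (Vec m)).flip (A j) else 0) θ) j = _
    rw [LinearMap.pi_apply]
    split_ifs <;> simp [real_inner_comm]
  have hTn : ∀ θ, ‖T θ‖ ^ 2 = quadForm p G A θ := by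
    intro θ
    rw [EuclideanSpace.norm_sq_eq]
    simp_rw [hTj]
    rw [quadForm, Finset.mul_sum, ← Finset.sum_filter_add_sum_filter_not Finset.univ (· ∈ G)]
    rw [Finset.sum_eq_zero (s := Finset.univ.filter (· ∉ G)), add_zero]
    · rw [show Finset.univ.filter (· ∈ G) = G by ext; simp]
      apply Finset.sum_congr rfl
      intro j hj
      rw [if_pos hj, Real.norm_eq_abs, sq_abs, mul_pow, Real.sq_sqrt hp]
    · intro j hj
      rw [if_neg (Finset.mem_filter.mp hj).2]; simp
  have key := measure_lt_one_eq_integral_div_gamma (E := Vec m) volume (g := fun θ => ‖T θ‖)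
    (by simp) (by simp) (fun x y => by simpa using norm_add_le (T x) (T y))
    (by
      intro x hx
      have h1 : quadForm p G A x = 0 := by rw [← hTn, hx]; simp
      have h2 := hpos x
      rw [h1] at h2
      have h3 : supNorm x ^ 2 = 0 := by nlinarith [sq_nonneg (supNorm x)]
      exact supNorm_eq_zero.mp (by simpa using h3))
    (fun r x => by rw [map_smul, norm_smul, Real.norm_eq_abs]) (p := 2) (by norm_num)
  have e1 : {x : Vec m | ‖T x‖ < 1} = {θ | quadForm p G A θ < 1} := by
    ext θ
    simp only [Set.mem_ofPred_eq]
    rw [← hTn, sq_lt_one_iff₀ (norm_nonneg _)]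
  have e2 : ∀ x, Real.exp (-‖T x‖ ^ (2 : ℝ)) = Real.exp (-quadForm p G A x) := by
    intro x
    rw [← hTn]; congr 2; exact_mod_cast Real.rpow_natCast ‖T x‖ 2
  rw [e1] at key
  simp_rw [e2] at key
  have hfr : Module.finrank ℝ (Vec m) = m := by simp
  rw [hfr] at key
  have hΓ0 : 0 < Real.Gamma ((m : ℝ) / 2 + 1) := Real.Gamma_pos_of_pos (by positivity)
  -- Log-convexity of `Γ` at the midpoint `m/2 + 1` of `1` and `m + 1`.
  have hΓ : Real.Gamma ((m : ℝ) / 2 + 1) ≤ √(m.factorial) := by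
    have h := Real.Gamma_mul_add_mul_le_rpow_Gamma_mul_rpow_Gamma (s := 1) (t := (m : ℝ) + 1)
      (a := 1 / 2) (b := 1 / 2) (by norm_num) (by positivity) (by norm_num) (by norm_num)
      (by norm_num)
    rw [Real.Gamma_one, Real.one_rpow, one_mul, Real.Gamma_nat_eq_factorial,
      ← Real.sqrt_eq_rpow] at h
    convert h using 2
    ring
  have hvol : volume.real {θ : Vec m | quadForm p G A θ < 1}
      = (∫ θ, Real.exp (-quadForm p G A θ)) / Real.Gamma ((m : ℝ) / 2 + 1) := by
    rw [Measure.real, key, ENNReal.toReal_ofReal]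
    exact div_nonneg (integral_nonneg fun _ => (Real.exp_pos _).le) hΓ0.le
  have h3 : ∫ θ : Vec m, Real.exp (-quadForm p G A θ)
      = Real.Gamma ((m : ℝ) / 2 + 1) * volume.real {θ : Vec m | quadForm p G A θ < 1} := by
    rw [hvol]; field_simp
  rw [h3]
  gcongr

theorem volume_real_supNorm_le (a : ℝ) (ha : 0 ≤ a) :
    volume.real {θ : Vec m | supNorm θ ≤ a} = (2 * a) ^ m := by
  rw [Measure.real, volume_supNorm_le a ha, ENNReal.toReal_ofReal (by positivity)]

/-- The cube of half-side `a` lies in the ellipsoid, because the form is at most `1/4` on it. -/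
theorem volume_real_quadForm_lt_one_ge {B c : ℝ} (hp : 0 < p) (hn : 0 < n) (hm : 1 ≤ m)
    (hB0 : 0 < B) (hB : ∀ j ∈ G, ‖A j‖ ≤ B) (hc : 0 < c)
    (hpos : ∀ θ : Vec m, c * supNorm θ ^ 2 ≤ quadForm p G A θ) :
    (1 / (√(p * n * m) * B)) ^ m ≤ volume.real {θ : Vec m | quadForm p G A θ < 1} := by
  have hn0 : (0 : ℝ) < n := by exact_mod_cast hn
  have hm0 : (0 : ℝ) < m := by exact_mod_cast hm
  have hs : 0 < √(p * n * m) := Real.sqrt_pos.mpr (by positivity)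
  have hss : √(p * n * m) ^ 2 = p * n * m := Real.sq_sqrt (by positivity)
  set a := 1 / (2 * (√(p * n * m) * B)) with ha
  have ha0 : 0 < a := by positivity
  have e : (1 / (√(p * n * m) * B)) ^ m = volume.real {θ : Vec m | supNorm θ ≤ a} := by
    rw [volume_real_supNorm_le a ha0.le, ha]; congr 1; field_simp
  rw [e]
  have hfin : volume {θ : Vec m | quadForm p G A θ < 1} ≠ ⊤ := by
    have hsub : {θ : Vec m | quadForm p G A θ < 1} ⊆ {θ | supNorm θ ≤ √(1 / c)} := by
      intro θ hθ
      have h1 := (hpos θ).trans (le_of_lt hθ)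
      apply Real.le_sqrt_of_sq_le
      rw [le_div_iff₀ hc]; linarith
    refine ne_top_of_le_ne_top ?_ (measure_mono hsub)
    rw [volume_supNorm_le _ (Real.sqrt_nonneg _)]
    exact ENNReal.ofReal_ne_top
  refine measureReal_mono ?_ hfin
  intro θ hθ
  have h1 := quadForm_le hp.le hB θ
  have h0 := supNorm_nonneg θ
  have h2 : p * n * m * B ^ 2 * supNorm θ ^ 2 ≤ p * n * m * B ^ 2 * a ^ 2 := by
    gcongr; exact hθ
  have h3 : p * n * m * B ^ 2 * a ^ 2 = 1 / 4 := by
    clear_value a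
    generalize √(p * n * m) = s at *
    rw [ha, ← hss]
    field_simp; norm_num
  simp only [Set.mem_ofPred_eq]
  linarith

end Quadratic

/-! ### The Fourier integral -/

/-- Five functions bound the integrand pointwise: the gain on `Q < 1`, and one loss for each way in
which `θ` can be far out. Where `Q ≥ R`, `exp (-7Q) ≤ exp (-6R) exp (-Q)`, so the Gaussian region is
paid for by an integral over all of space. -/
theorem integral_mul_re_ge {w Q : Vec m → ℝ} {φ : Vec m → ℂ} (hw0 : ∀ θ, 0 ≤ w θ)
    (hw1 : ∀ θ, w θ ≤ 1) (hwi : Integrable w) (hφc : Continuous φ) (hφ1 : ∀ θ, ‖φ θ‖ ≤ 1)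
    (hQc : Continuous Q) (hQi : Integrable fun θ => Real.exp (-Q θ))
    (hQfin : volume {θ | Q θ < 1} ≠ ⊤) {R a₁ a₂ L ρ : ℝ} (ha₁ : 0 ≤ a₁) (ha₂ : 0 ≤ a₂)
    (hρ : 0 ≤ ρ)
    (h1 : ∀ θ, Q θ < 1 → 1 / 2 ≤ w θ ∧ 1 / 2 * Real.exp (-42) ≤ (φ θ).re)
    (h2 : ∀ θ, Q θ < R → 0 ≤ (φ θ).re)
    (h3 : ∀ θ, supNorm θ ≤ L → ‖φ θ‖ ≤ Real.exp (-(7 * Q θ)) ∨ (supNorm θ ≤ ρ ∧ ‖φ θ‖ ≤ a₁) ∨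
      ‖φ θ‖ ≤ a₂) :
    1 / 4 * Real.exp (-42) * volume.real {θ | Q θ < 1}
      - Real.exp (-(6 * R)) * (∫ θ, Real.exp (-Q θ))
      - a₁ * (2 * ρ) ^ m - a₂ * (∫ θ, w θ) - ∫ θ in {θ | L < supNorm θ}, w θ
      ≤ ∫ θ, w θ * (φ θ).re := by
  have hE1 : MeasurableSet {θ | Q θ < 1} := (isOpen_lt hQc continuous_const).measurableSet
  have hE2 : MeasurableSet {θ : Vec m | supNorm θ ≤ ρ} :=
    (isClosed_le continuous_supNorm continuous_const).measurableSet
  have hE3 : MeasurableSet {θ : Vec m | L < supNorm θ} :=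
    (isOpen_lt continuous_const continuous_supNorm).measurableSet
  have hE2fin : volume {θ : Vec m | supNorm θ ≤ ρ} ≠ ⊤ := by
    rw [volume_supNorm_le _ hρ]; exact ENNReal.ofReal_ne_top
  set F1 : Vec m → ℝ := {θ | Q θ < 1}.indicator fun _ => 1 / 4 * Real.exp (-42) with hF1
  set F2 : Vec m → ℝ := fun θ => Real.exp (-(6 * R)) * Real.exp (-Q θ) with hF2
  set F3 : Vec m → ℝ := {θ : Vec m | supNorm θ ≤ ρ}.indicator fun _ => a₁ with hF3
  set F4 : Vec m → ℝ := fun θ => a₂ * w θ with hF4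
  set F5 : Vec m → ℝ := {θ : Vec m | L < supNorm θ}.indicator w with hF5
  have i1 : Integrable F1 := (integrable_indicator_iff hE1).mpr (integrableOn_const hQfin)
  have i2 : Integrable F2 := hQi.const_mul _
  have i3 : Integrable F3 := (integrable_indicator_iff hE2).mpr (integrableOn_const hE2fin)
  have i4 : Integrable F4 := hwi.const_mul _
  have i5 : Integrable F5 := hwi.indicator hE3
  have hre : ∀ θ, |(φ θ).re| ≤ ‖φ θ‖ := fun θ => Complex.abs_re_le_norm _
  have i6 : Integrable fun θ => w θ * (φ θ).re := by
    refine hwi.mono' (hwi.aestronglyMeasurable.mul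
      (Complex.continuous_re.comp hφc).aestronglyMeasurable) (Filter.Eventually.of_forall fun θ => ?_)
    rw [norm_mul, Real.norm_of_nonneg (hw0 θ), Real.norm_eq_abs]
    exact mul_le_of_le_one_right (hw0 θ) ((hre θ).trans (hφ1 θ))
  have hint : ∫ θ, (F1 θ - F2 θ - F3 θ - F4 θ - F5 θ)
      = 1 / 4 * Real.exp (-42) * volume.real {θ | Q θ < 1}
      - Real.exp (-(6 * R)) * (∫ θ, Real.exp (-Q θ))
      - a₁ * (2 * ρ) ^ m - a₂ * (∫ θ, w θ) - ∫ θ in {θ | L < supNorm θ}, w θ := by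
    have j2 : ∫ θ, (F1 θ - F2 θ) = (∫ θ, F1 θ) - ∫ θ, F2 θ := integral_sub i1 i2
    have j3 : ∫ θ, (F1 θ - F2 θ - F3 θ) = (∫ θ, (F1 θ - F2 θ)) - ∫ θ, F3 θ :=
      integral_sub (i1.sub i2) i3
    have j4 : ∫ θ, (F1 θ - F2 θ - F3 θ - F4 θ) = (∫ θ, (F1 θ - F2 θ - F3 θ)) - ∫ θ, F4 θ :=
      integral_sub ((i1.sub i2).sub i3) i4
    have j5 : ∫ θ, (F1 θ - F2 θ - F3 θ - F4 θ - F5 θ)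
        = (∫ θ, (F1 θ - F2 θ - F3 θ - F4 θ)) - ∫ θ, F5 θ :=
      integral_sub (((i1.sub i2).sub i3).sub i4) i5
    rw [j5, j4, j3, j2]
    rw [hF1, hF3, hF5, integral_indicator_const _ hE1, integral_indicator_const _ hE2,
      integral_indicator hE3, hF2, hF4, integral_const_mul, integral_const_mul,
      volume_real_supNorm_le ρ hρ, smul_eq_mul, smul_eq_mul]
    ring
  rw [← hint]
  refine integral_mono ((((i1.sub i2).sub i3).sub i4).sub i5) i6 fun θ => ?_
  change F1 θ - F2 θ - F3 θ - F4 θ - F5 θ ≤ w θ * (φ θ).re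
  have p2 : 0 ≤ F2 θ := by simp only [hF2]; positivity
  have p3 : 0 ≤ F3 θ := Set.indicator_nonneg (fun _ _ => ha₁) θ
  have p4 : 0 ≤ F4 θ := mul_nonneg ha₂ (hw0 θ)
  have p5 : 0 ≤ F5 θ := Set.indicator_nonneg (fun _ _ => hw0 _) θ
  by_cases hq1 : Q θ < 1
  · obtain ⟨a, b⟩ := h1 θ hq1
    have e : F1 θ = 1 / 4 * Real.exp (-42) := Set.indicator_of_mem (by exact hq1) _
    have : 1 / 2 * (1 / 2 * Real.exp (-42)) ≤ w θ * (φ θ).re := by gcongr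
    linarith
  have e : F1 θ = 0 := Set.indicator_of_notMem (by exact hq1) _
  rw [e]
  by_cases hq2 : Q θ < R
  · have := mul_nonneg (hw0 θ) (h2 θ hq2)
    linarith
  have hlow : -‖φ θ‖ ≤ (φ θ).re := (abs_le.mp (hre θ)).1
  have hlow2 : -(w θ * ‖φ θ‖) ≤ w θ * (φ θ).re := by nlinarith [hw0 θ]
  by_cases hL : supNorm θ ≤ L
  · have hle : ∀ a : ℝ, 0 ≤ a → w θ * a ≤ a := fun a ha => mul_le_of_le_one_left ha (hw1 θ)
    rcases h3 θ hL with h | h | h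
    · have h4 : Real.exp (-(7 * Q θ)) ≤ F2 θ := by
        simp only [hF2]
        rw [← Real.exp_add]
        apply Real.exp_le_exp.mpr
        push Not at hq2
        linarith
      have := hle _ (norm_nonneg (φ θ))
      linarith
    · have h4 : F3 θ = a₁ := Set.indicator_of_mem (by exact h.1) _
      have := hle _ (norm_nonneg (φ θ))
      linarith [h.2]
    · have h4 : w θ * ‖φ θ‖ ≤ F4 θ := by
        simp only [hF4]; rw [mul_comm]; gcongr; exact hw0 θ
      linarith
  · have h4 : F5 θ = w θ := Set.indicator_of_mem (by exact not_le.mp hL) _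
    have : w θ * ‖φ θ‖ ≤ w θ := mul_le_of_le_one_right (hw0 θ) (hφ1 θ)
    linarith

/-- The cosine transform of `w`. -/
def cosTransform (w : Vec m → ℝ) (x : Vec m) : ℝ := ∫ θ, w θ * (chr (inner ℝ θ x)).re

theorem integrable_mul_re_chr {w : Vec m → ℝ} (hwi : Integrable w) (x : Vec m) :
    Integrable fun θ => w θ * (chr (inner ℝ θ x)).re := by
  have hc := continuous_chr
  refine hwi.mul_bdd (c := 1) ?_ ?_
  · exact (Complex.continuous_re.comp (hc.comp (by fun_prop))).aestronglyMeasurable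
  · refine Filter.Eventually.of_forall fun θ => ?_
    rw [← norm_chr (inner ℝ θ x)]
    exact Complex.abs_re_le_norm _

theorem cosTransform_le {w : Vec m → ℝ} (hw0 : ∀ θ, 0 ≤ w θ) (hwi : Integrable w) (x : Vec m) :
    cosTransform w x ≤ ∫ θ, w θ := by
  refine integral_mono (integrable_mul_re_chr hwi x) hwi fun θ => ?_
  refine mul_le_of_le_one_right (hw0 θ) ?_
  rw [← norm_chr (inner ℝ θ x)]
  exact Complex.re_le_norm _

/-- The Fourier identity of the method: for a finite random choice it is just linearity of the
integral. -/
theorem integral_mul_re_subsetChar {n : ℕ} {w : Vec m → ℝ}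
    (hwi : Integrable w) (G : Finset (Fin n)) (q : Fin n → ℝ) (A : Fin n → Vec m) (l : Vec m) :
    ∫ θ, w θ * (subsetChar G q A l θ).re
      = ∑ S ∈ G.powerset, subsetWeight G q S * cosTransform w (subsetSum A S - l) := by
  have h : ∀ θ, w θ * (subsetChar G q A l θ).re = ∑ S ∈ G.powerset,
      subsetWeight G q S * (w θ * (chr (inner ℝ θ (subsetSum A S - l))).re) := by
    intro θ
    rw [subsetChar_eq_sum, Complex.re_sum, Finset.mul_sum]
    apply Finset.sum_congr rfl
    intro S _
    rw [Complex.re_ofReal_mul]; ring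
  simp_rw [h]
  rw [integral_finsetSum _ fun S _ => (integrable_mul_re_chr hwi _).const_mul _]
  simp_rw [integral_const_mul]
  rfl

/-- The radius `R = 20 m²` is large enough to beat the factor `√(m!) ≤ e^{m²}` from the Gaussian
integral. -/
theorem sqrt_factorial_mul_exp_le (hm : 1 ≤ m) :
    Real.exp (-(6 * (20 * m ^ 2 : ℝ))) * √(m.factorial) ≤ Real.exp (-46) := by
  have hm0 : (1 : ℝ) ≤ m := by exact_mod_cast hm
  have h1 : (m.factorial : ℝ) ≤ Real.exp (m ^ 2) := by
    calc (m.factorial : ℝ) ≤ (m : ℝ) ^ m := by exact_mod_cast Nat.factorial_le_pow m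
      _ ≤ (Real.exp m) ^ m := by
          gcongr; linarith [Real.add_one_le_exp (m : ℝ)]
      _ = _ := by rw [← Real.exp_nat_mul]; congr 1; ring
  have h2 : √(m.factorial : ℝ) ≤ Real.exp (m ^ 2) := by
    refine le_trans ?_ h1
    apply Real.sqrt_le_iff.mpr
    have : (1 : ℝ) ≤ m.factorial := by exact_mod_cast Nat.factorial_pos m
    exact ⟨by linarith, by nlinarith⟩
  calc Real.exp (-(6 * (20 * m ^ 2 : ℝ))) * √(m.factorial)
      ≤ Real.exp (-(6 * (20 * m ^ 2 : ℝ))) * Real.exp (m ^ 2) := by gcongr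
    _ = Real.exp (-(119 * m ^ 2)) := by rw [← Real.exp_add]; congr 1; ring
    _ ≤ _ := by apply Real.exp_le_exp.mpr; nlinarith

/-! ### Size of the characteristic function for a regular matrix, and the resulting existence
statement -/

section Decay

variable {D : Measure (Vec m)} {n : ℕ} {A : Fin n → Vec m} {κ τ ε L B : ℝ}

theorem Regular.quadForm_ge (hA : Regular D κ τ ε L A) (hκ : 0 < κ) (hσ : 0 < sigma D)
    (hm : 1 ≤ m) (hσB : sigma D ≤ B) (hL : 1 / (2 * √m * B) ≤ L) {p : ℝ} (hp : 0 < p)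
    (θ : Vec m) :
    9 / 32 * (κ ^ 3 * p * n * sigma D ^ 2) * supNorm θ ^ 2
      ≤ quadForm p (goodCols D τ A) A θ := by
  classical
  set G := goodCols D τ A with hG
  have h := hA.card_abs_inner_ge hκ hσ hm hσB hL θ
  have h0 := supNorm_nonneg θ
  rw [quadForm]
  calc 9 / 32 * (κ ^ 3 * p * n * sigma D ^ 2) * supNorm θ ^ 2
      = p * ((κ * n / 2) * (3 / 4 * κ * (supNorm θ * sigma D)) ^ 2) := by ring
    _ ≤ p * ((((G.filter fun j =>
        3 / 4 * κ * (supNorm θ * sigma D) ≤ |inner ℝ θ (A j)|).card : ℝ))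
        * (3 / 4 * κ * (supNorm θ * sigma D)) ^ 2) := by gcongr
    _ ≤ p * ∑ j ∈ G.filter fun j =>
        3 / 4 * κ * (supNorm θ * sigma D) ≤ |inner ℝ θ (A j)|, inner ℝ θ (A j) ^ 2 := by
        gcongr
        rw [← nsmul_eq_mul]
        apply Finset.card_nsmul_le_sum
        intro j hj
        rw [← sq_abs (inner ℝ θ (A j))]
        have := (Finset.mem_filter.mp hj).2
        gcongr
    _ ≤ _ := by
        gcongr
        exact Finset.filter_subset _ _

/-- On `Q < 20 m²`, `hnear` forces `|⟨θ, A j⟩| ≤ T = 1/(26000 m²)`; the constant is chosen so that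
`520 · T · 20 m² = 2/5`. -/
theorem re_subsetChar_ge_of_quadForm_lt {G : Finset (Fin n)} {q : Fin n → ℝ} {l : Vec m} {p c : ℝ}
    (hm : 1 ≤ m) (hp : 0 < p) (hp1 : p ≤ 1 / 1000) (hB0 : 0 < B) (hAB : ∀ j ∈ G, ‖A j‖ ≤ B)
    (hq : ∀ j, 98 / 100 * p ≤ q j ∧ q j ≤ 104 / 100 * p) (hql : ∑ j ∈ G, q j • A j = l)
    (hnear : 72 * 26000 ^ 2 * m ^ 7 * B ^ 2 ≤ c)
    {θ : Vec m} (hpos : 9 / 32 * c * supNorm θ ^ 2 ≤ quadForm p G A θ)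
    (hθ : quadForm p G A θ < 20 * m ^ 2) :
    1 / 2 * Real.exp (-(42 * quadForm p G A θ)) ≤ (subsetChar G q A l θ).re := by
  have hm0 : (0 : ℝ) < m := by exact_mod_cast hm
  have hm1 : (1 : ℝ) ≤ m := by exact_mod_cast hm
  have h0 := supNorm_nonneg θ
  apply re_subsetChar_ge (T := 1 / (26000 * (m : ℝ) ^ 2)) hp.le hp1 hq hql
  · intro j hj
    refine (abs_inner_le_supNorm _ _).trans ?_
    have h1 : √m * supNorm θ * ‖A j‖ ≤ √m * supNorm θ * B := by
      gcongr; exact hAB j hj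
    refine h1.trans ?_
    rw [← sq_le_sq₀ (by positivity) (by positivity)]
    have h2 : 9 / 32 * c * supNorm θ ^ 2 ≤ 20 * m ^ 2 := hpos.trans hθ.le
    rw [mul_pow, mul_pow, Real.sq_sqrt hm0.le, div_pow, one_pow, le_div_iff₀ (by positivity)]
    have h3 : (m * supNorm θ ^ 2 * B ^ 2 * (26000 * (m : ℝ) ^ 2) ^ 2) * (72 * m ^ 2)
        ≤ 1 * (72 * m ^ 2) := by
      calc (m * supNorm θ ^ 2 * B ^ 2 * (26000 * (m : ℝ) ^ 2) ^ 2) * (72 * m ^ 2)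
          = (72 * 26000 ^ 2 * m ^ 7 * B ^ 2) * supNorm θ ^ 2 := by ring
        _ ≤ c * supNorm θ ^ 2 := by gcongr
        _ = 32 / 9 * (9 / 32 * c * supNorm θ ^ 2) := by ring
        _ ≤ 32 / 9 * (20 * m ^ 2) := by gcongr
        _ ≤ 1 * (72 * m ^ 2) := by nlinarith [sq_nonneg (m : ℝ)]
    exact le_of_mul_le_mul_right h3 (by positivity)
  · rw [mul_one_div, div_le_one (by positivity)]
    nlinarith
  · have h4 : p * ∑ j ∈ G, inner ℝ θ (A j) ^ 2 ≤ 20 * m ^ 2 := hθ.le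
    calc 520 * (1 / (26000 * (m : ℝ) ^ 2)) * (p * ∑ j ∈ G, inner ℝ θ (A j) ^ 2)
        ≤ 520 * (1 / (26000 * (m : ℝ) ^ 2)) * (20 * m ^ 2) := by gcongr
      _ = 2 / 5 := by field_simp; norm_num

/-- If no inner product exceeds `1/2`, `distInt` is the absolute value and the exponent is `7Q`.
Otherwise `supNorm θ` is at least `1/(2√m B)`, and the spread condition gives many columns at
distance at least `(3/4) κ d` from the integers, where `d` is `1` or `supNorm θ * sigma D`; hence
the last two alternatives. -/
theorem Regular.norm_subsetChar_le (hA : Regular D κ τ ε L A) (hκ : 0 < κ) (hσ : 0 < sigma D)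
    (hm : 1 ≤ m) (hB : ‖mean D‖ + τ ≤ B) (hσB : sigma D ≤ B) {p : ℝ} (hp : 0 < p)
    (hp1 : p ≤ 1 / 1000) {q : Fin n → ℝ}
    (hq : ∀ j, 98 / 100 * p ≤ q j ∧ q j ≤ 104 / 100 * p) (l : Vec m) {θ : Vec m}
    (hθL : supNorm θ ≤ L) :
    ‖subsetChar (goodCols D τ A) q A l θ‖ ≤ Real.exp (-(7 * quadForm p (goodCols D τ A) A θ)) ∨
      (supNorm θ ≤ 1 / sigma D ∧ ‖subsetChar (goodCols D τ A) q A l θ‖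
        ≤ Real.exp (-(63 / 128 * (κ ^ 3 * p * n * sigma D ^ 2 / (m * B ^ 2))))) ∨
      ‖subsetChar (goodCols D τ A) q A l θ‖ ≤ Real.exp (-(63 / 32 * (κ ^ 3 * p * n))) := by
  classical
  set G := goodCols D τ A with hG
  have hB0 : 0 < B := hσ.trans_le hσB
  have hm0 : (0 : ℝ) < m := by exact_mod_cast hm
  have hAB : ∀ j ∈ G, ‖A j‖ ≤ B := fun j hj => norm_le_of_mem_goodCols hB hj
  have hn1 := RandomDisc.norm_subsetChar_le (A := A) (G := G) (l := l) hp.le hp1 hq θ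
  have h0 := supNorm_nonneg θ
  by_cases hsm : ∀ j ∈ G, |inner ℝ θ (A j)| ≤ 1 / 2
  · left
    refine hn1.trans (le_of_eq ?_)
    rw [quadForm]
    congr 4
    apply Finset.sum_congr rfl
    intro j hj
    rw [distInt_of_abs_le (hsm j hj), sq_abs]
  · right
    have hlarge : 1 / 2 < √m * supNorm θ * B := by
      push Not at hsm
      obtain ⟨j, hj, hlt⟩ := hsm
      refine hlt.trans_le ((abs_inner_le_supNorm _ _).trans ?_)
      gcongr; exact hAB j hj
    have hsp := hA.spread θ hθL
    rw [← hG] at hsp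
    set d := min 1 (supNorm θ * sigma D) with hd
    have hd0 : 0 ≤ d := le_min zero_le_one (by positivity)
    have hsum : 9 / 32 * (κ ^ 3 * n) * d ^ 2 ≤ ∑ j ∈ G, distInt (inner ℝ θ (A j)) ^ 2 := by
      calc 9 / 32 * (κ ^ 3 * n) * d ^ 2 = (κ * n / 2) * (3 / 4 * κ * d) ^ 2 := by ring
        _ ≤ ((G.filter fun j => 3 / 4 * κ * d ≤ distInt (inner ℝ θ (A j))).card : ℝ)
            * (3 / 4 * κ * d) ^ 2 := by gcongr
        _ ≤ ∑ j ∈ G.filter fun j => 3 / 4 * κ * d ≤ distInt (inner ℝ θ (A j)),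
            distInt (inner ℝ θ (A j)) ^ 2 := by
            rw [← nsmul_eq_mul]
            apply Finset.card_nsmul_le_sum
            intro j hj
            have := (Finset.mem_filter.mp hj).2
            gcongr
        _ ≤ _ := Finset.sum_le_sum_of_subset_of_nonneg (Finset.filter_subset _ _)
            fun _ _ _ => sq_nonneg _
    have hn2 : ‖subsetChar G q A l θ‖ ≤ Real.exp (-(63 / 32 * (κ ^ 3 * p * n) * d ^ 2)) := by
      refine hn1.trans (Real.exp_le_exp.mpr ?_)
      nlinarith [mul_le_mul_of_nonneg_left hsum hp.le]
    rcases le_total 1 (supNorm θ * sigma D) with h1 | h1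
    · right
      rw [hd, min_eq_left h1] at hn2
      simpa using hn2
    · left
      refine ⟨by rw [le_div_iff₀ hσ]; exact h1, hn2.trans (Real.exp_le_exp.mpr ?_)⟩
      rw [hd, min_eq_right h1, neg_le_neg_iff]
      have h5 : 1 / 4 ≤ m * supNorm θ ^ 2 * B ^ 2 := by
        calc (1 / 4 : ℝ) = (1 / 2) ^ 2 := by norm_num
          _ ≤ (√m * supNorm θ * B) ^ 2 := by gcongr
          _ = _ := by rw [mul_pow, mul_pow, Real.sq_sqrt hm0.le]
      have h6 : sigma D ^ 2 / (m * B ^ 2) ≤ 4 * (supNorm θ * sigma D) ^ 2 := by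
        rw [div_le_iff₀ (by positivity)]
        nlinarith [mul_le_mul_of_nonneg_left h5 (sq_nonneg (sigma D))]
      calc 63 / 128 * (κ ^ 3 * p * n * sigma D ^ 2 / (m * B ^ 2))
          = 63 / 128 * (κ ^ 3 * p * n) * (sigma D ^ 2 / (m * B ^ 2)) := by ring
        _ ≤ 63 / 128 * (κ ^ 3 * p * n) * (4 * (supNorm θ * sigma D) ^ 2) := by gcongr
        _ = _ := by ring

end Decay

theorem exp_neg_fifty_mul_lt {v I : ℝ} (hm : 1 ≤ m) (hv : 0 < v) (hI : I ≤ √(m.factorial) * v) :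
    Real.exp (-50) * v < 1 / 4 * Real.exp (-42) * v
      - Real.exp (-(6 * (20 * m ^ 2 : ℝ))) * I := by
  have h1 : Real.exp (-(6 * (20 * m ^ 2 : ℝ))) * I ≤ Real.exp (-46) * v := by
    calc _ ≤ Real.exp (-(6 * (20 * m ^ 2 : ℝ))) * (√(m.factorial) * v) := by gcongr
      _ = Real.exp (-(6 * (20 * m ^ 2 : ℝ))) * √(m.factorial) * v := by ring
      _ ≤ _ := by gcongr; exact sqrt_factorial_mul_exp_le hm
  have e1 : Real.exp (-42) = Real.exp (-46) * Real.exp 4 := by rw [← Real.exp_add]; norm_num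
  have e2 : Real.exp (-50) ≤ Real.exp (-46) := Real.exp_le_exp.mpr (by norm_num)
  have e3 : 16 ≤ Real.exp 4 := by
    have := Real.exp_one_gt_d9
    calc (16 : ℝ) = 2 ^ 4 := by norm_num
      _ ≤ Real.exp 1 ^ 4 := by gcongr; linarith
      _ = Real.exp 4 := by rw [← Real.exp_nat_mul]; norm_num
  have e4 : 0 < Real.exp (-46) * v := by positivity
  have e5 : Real.exp (-50) * v ≤ Real.exp (-46) * v := by gcongr
  have e6 : 1 / 4 * Real.exp (-42) * v = 1 / 4 * Real.exp 4 * (Real.exp (-46) * v) := by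
    rw [e1]; ring
  nlinarith

/-- If `w` is a weight in Fourier space for which the error terms are negligible, then some random
subset sum of the right size has a large cosine transform at its distance to the target. -/
theorem Regular.exists_subset {D : Measure (Vec m)} {n : ℕ} {A : Fin n → Vec m} {κ τ ε L B : ℝ}
    (hA : Regular D κ τ ε L A) (hκ : 0 < κ) (hσ : 0 < sigma D)
    (hm : 1 ≤ m) (hn : 0 < n) (hB : ‖mean D‖ + τ ≤ B) (hσB : sigma D ≤ B)
    (hL : 1 / (2 * √m * B) ≤ L)
    (hsmall : m * (sigma D * √(m * n) + ε * n) ≤ 3 / 400 * κ ^ 2 * sigma D * n)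
    {p : ℝ} (hp : 0 < p) (hp1 : p ≤ 1 / 1000) {l : Vec m}
    (hl : ‖l - (p * n) • mean D‖ ≤ sigma D * p * √(m * n))
    (hnear : 72 * 26000 ^ 2 * m ^ 7 * B ^ 2 ≤ κ ^ 3 * p * n * sigma D ^ 2)
    {w : Vec m → ℝ} (hw0 : ∀ θ, 0 ≤ w θ) (hw1 : ∀ θ, w θ ≤ 1) (hwi : Integrable w)
    (hwhalf : ∀ θ, 9 / 32 * (κ ^ 3 * p * n * sigma D ^ 2) * supNorm θ ^ 2 ≤ 1 → 1 / 2 ≤ w θ)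
    {e : ℝ}
    (hnum : e + 2 * Real.exp (-(9 / 100 * (p * n))) * (∫ θ, w θ)
        + Real.exp (-(63 / 128 * (κ ^ 3 * p * n * sigma D ^ 2 / (m * B ^ 2)))) * (2 / sigma D) ^ m
        + Real.exp (-(63 / 32 * (κ ^ 3 * p * n))) * (∫ θ, w θ)
        + ∫ θ in {θ | L < supNorm θ}, w θ
      ≤ Real.exp (-50) * (1 / (√(p * n * m) * B)) ^ m) (he : 0 ≤ e) :
    ∃ S : Finset (Fin n), p * n / 2 ≤ (S.card : ℝ) ∧ (S.card : ℝ) ≤ 3 * (p * n) / 2 ∧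
      e < cosTransform w (subsetSum A S - l) := by
  classical
  obtain ⟨q, hq, hql, hqs1, hqs2⟩ := hA.exists_weights hκ hσ hm hn hσB hL hsmall hp hl
  set G := goodCols D τ A with hG
  have hB0 : 0 < B := hσ.trans_le hσB
  have hn0 : (0 : ℝ) < n := by exact_mod_cast hn
  have hm0 : (0 : ℝ) < m := by exact_mod_cast hm
  have hm1 : (1 : ℝ) ≤ m := by exact_mod_cast hm
  have hAB : ∀ j ∈ G, ‖A j‖ ≤ B := fun j hj => norm_le_of_mem_goodCols hB hj
  have hq0 : ∀ j, 0 ≤ q j := fun j => by have := hq j; nlinarith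
  have hq1 : ∀ j, q j ≤ 1 := fun j => by have := hq j; nlinarith
  set c := 9 / 32 * (κ ^ 3 * p * n * sigma D ^ 2) with hc
  have hc0 : 0 < c := by positivity
  set Q := quadForm p G A with hQ
  have hpos : ∀ θ : Vec m, c * supNorm θ ^ 2 ≤ Q θ := hA.quadForm_ge hκ hσ hm hσB hL hp
  have hQfin : volume {θ : Vec m | Q θ < 1} ≠ ⊤ := by
    have hsub : {θ : Vec m | Q θ < 1} ⊆ {θ | supNorm θ ≤ √(1 / c)} := by
      intro θ hθ
      have h1 := (hpos θ).trans (le_of_lt hθ)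
      apply Real.le_sqrt_of_sq_le
      rw [le_div_iff₀ hc0]; linarith
    refine ne_top_of_le_ne_top ?_ (measure_mono hsub)
    rw [volume_supNorm_le _ (Real.sqrt_nonneg _)]
    exact ENNReal.ofReal_ne_top
  obtain ⟨hQi, hQint⟩ := integral_exp_neg_quadForm (A := A) (G := G) hp.le hc0 hpos hm
  have hv := volume_real_quadForm_lt_one_ge hp hn hm hB0 hAB hc0 hpos
  set v := volume.real {θ : Vec m | Q θ < 1} with hvdef
  set φ := subsetChar G q A l with hφ
  have hQ0 : ∀ θ, 0 ≤ Q θ := fun θ => quadForm_nonneg hp.le θ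
  -- positivity near the origin
  have hnearT : ∀ θ, Q θ < 20 * m ^ 2 →
      1 / 2 * Real.exp (-(42 * Q θ)) ≤ (φ θ).re := by
    exact fun θ hθ => re_subsetChar_ge_of_quadForm_lt hm hp hp1 hB0 hAB hq hql hnear (hpos θ) hθ
  have hlow := integral_mul_re_ge (w := w) (Q := Q) (φ := φ) (R := 20 * m ^ 2)
    (a₁ := Real.exp (-(63 / 128 * (κ ^ 3 * p * n * sigma D ^ 2 / (m * B ^ 2)))))
    (a₂ := Real.exp (-(63 / 32 * (κ ^ 3 * p * n)))) (L := L) (ρ := 1 / sigma D)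
    hw0 hw1 hwi continuous_subsetChar (norm_subsetChar_le_one hq0 hq1) continuous_quadForm hQi hQfin
    (Real.exp_pos _).le (Real.exp_pos _).le (by positivity)
    (by
      intro θ hθ
      refine ⟨hwhalf θ ((hpos θ).trans hθ.le), ?_⟩
      refine le_trans ?_ (hnearT θ (by nlinarith))
      gcongr
      linarith)
    (fun θ hθ => le_trans (by positivity) (hnearT θ hθ))
    (fun θ hθL => hA.norm_subsetChar_le hκ hσ hm hB hσB hp hp1 hq l hθL)
  have hv0 : 0 < (1 / (√(p * n * m) * B)) ^ m := by
    have : 0 < √(p * n * m) := Real.sqrt_pos.mpr (by positivity)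
    positivity
  have hvpos : 0 < v := hv0.trans_le hv
  have hmain : Real.exp (-50) * v < 1 / 4 * Real.exp (-42) * v
      - Real.exp (-(6 * (20 * m ^ 2 : ℝ))) * ∫ θ, Real.exp (-Q θ) :=
    exp_neg_fifty_mul_lt hm hvpos hQint
  -- If all sets of the right size had transform at most `e`, the average over `S` would be at most
  -- `e` plus `∫ w` times the probability of a wrong size, contradicting the lower bound for the
  -- integral.
  by_contra hcon
  push Not at hcon
  have hW0 : 0 ≤ ∫ θ, w θ := integral_nonneg hw0
  have hwt := subsetWeight_nonneg (G := G) hq0 hq1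
  have hupper : ∫ θ, w θ * (φ θ).re
      ≤ e + 2 * Real.exp (-(9 / 100 * (p * n))) * (∫ θ, w θ) := by
    rw [hφ, integral_mul_re_subsetChar hwi]
    clear hlow hmain hnum
    set F : Finset (Fin n) → Prop :=
      fun S => p * n / 2 ≤ (S.card : ℝ) ∧ (S.card : ℝ) ≤ 3 * (p * n) / 2
    rw [← Finset.sum_filter_add_sum_filter_not G.powerset F]
    apply add_le_add
    · calc ∑ S ∈ G.powerset with F S, subsetWeight G q S * cosTransform w (subsetSum A S - l)
          ≤ ∑ S ∈ G.powerset with F S, subsetWeight G q S * e := by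
            apply Finset.sum_le_sum
            intro S hS
            have hS2 := (Finset.mem_filter.mp hS).2
            exact mul_le_mul_of_nonneg_left (hcon S hS2.1 hS2.2) (hwt S)
        _ ≤ ∑ S ∈ G.powerset, subsetWeight G q S * e :=
            Finset.sum_le_sum_of_subset_of_nonneg (Finset.filter_subset _ _)
              fun S _ _ => mul_nonneg (hwt S) he
        _ = e := by rw [← Finset.sum_mul, sum_subsetWeight, one_mul]
    · calc ∑ S ∈ G.powerset with ¬ F S, subsetWeight G q S * cosTransform w (subsetSum A S - l)
          ≤ ∑ S ∈ G.powerset with ¬ F S, subsetWeight G q S * ∫ θ, w θ := by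
            apply Finset.sum_le_sum
            intro S _
            exact mul_le_mul_of_nonneg_left (cosTransform_le hw0 hwi _) (hwt S)
        _ = (∑ S ∈ G.powerset with ¬ F S, subsetWeight G q S) * ∫ θ, w θ := by
            rw [Finset.sum_mul]
        _ ≤ _ := by
            gcongr
            exact sum_subsetWeight_card_le hq0 hq1 (by positivity) hqs1 hqs2
  have hv2 : Real.exp (-50) * (1 / (√(p * n * m) * B)) ^ m ≤ Real.exp (-50) * v := by gcongr
  have e7 : (2 * (1 / sigma D)) = 2 / sigma D := by ring
  rw [e7] at hlow
  linarith

/-! ### The Gaussian weight -/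

/-- The Gaussian weight `θ ↦ exp (-π s² ‖θ‖²)`. -/
def gaussWeight (s : ℝ) (θ : Vec m) : ℝ := Real.exp (-(Real.pi * s ^ 2 * ‖θ‖ ^ 2))

theorem gaussWeight_le_one (s : ℝ) (θ : Vec m) : gaussWeight s θ ≤ 1 := by
  unfold gaussWeight
  rw [Real.exp_le_one_iff, neg_nonpos]
  have := Real.pi_pos
  positivity

theorem integrable_gaussWeight {s : ℝ} (hs : 0 < s) : Integrable (gaussWeight (m := m) s) := by
  have hpi := Real.pi_pos
  have h := GaussianFourier.integrable_cexp_neg_mul_sq_norm_add (V := Vec m)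
    (b := ((Real.pi * s ^ 2 : ℝ) : ℂ)) (by rw [Complex.ofReal_re]; positivity) 0 0
  refine h.norm.congr (Filter.Eventually.of_forall fun θ => ?_)
  simp only [Complex.norm_exp, gaussWeight]
  congr 1
  have e : (-((Real.pi * s ^ 2 : ℝ) : ℂ) * (‖θ‖ : ℂ) ^ 2 + 0 * ((inner ℝ (0 : Vec m) θ : ℝ) : ℂ))
    = ((-(Real.pi * s ^ 2 * ‖θ‖ ^ 2) : ℝ) : ℂ) := by push_cast; ring
  rw [e, Complex.ofReal_re]

theorem integral_gaussWeight {s : ℝ} (hs : 0 < s) :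
    ∫ θ : Vec m, gaussWeight s θ = (1 / s) ^ m := by
  have hpi := Real.pi_pos
  have h := GaussianFourier.integral_rexp_neg_mul_sq_norm (V := Vec m)
    (b := Real.pi * s ^ 2) (by positivity)
  have e : ∀ θ : Vec m, gaussWeight s θ = Real.exp (-(Real.pi * s ^ 2) * ‖θ‖ ^ 2) := by
    intro θ; unfold gaussWeight; congr 1; ring
  simp_rw [e]
  rw [h]
  have e2 : Real.pi / (Real.pi * s ^ 2) = (1 / s) ^ 2 := by field_simp
  rw [e2, ← Real.rpow_natCast (1 / s) 2, ← Real.rpow_mul (by positivity), ← Real.rpow_natCast]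
  congr 1
  simp
  ring

theorem cosTransform_gaussWeight {s : ℝ} (hs : 0 < s) (x : Vec m) :
    cosTransform (gaussWeight s) x = (1 / s) ^ m * Real.exp (-(Real.pi * ‖x‖ ^ 2 / s ^ 2)) := by
  have hpi := Real.pi_pos
  set b : ℂ := ((Real.pi * s ^ 2 : ℝ) : ℂ) with hb
  have hbre : 0 < b.re := by rw [hb, Complex.ofReal_re]; positivity
  have h := GaussianFourier.integral_cexp_neg_mul_sq_norm_add (V := Vec m) hbre
    (2 * Real.pi * Complex.I) x
  have h0 := GaussianFourier.integral_cexp_neg_mul_sq_norm (V := Vec m) hbre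
  have hi := GaussianFourier.integrable_cexp_neg_mul_sq_norm_add (V := Vec m) hbre
    (2 * Real.pi * Complex.I) x
  have e1 : ∀ θ : Vec m, gaussWeight s θ * (chr (inner ℝ θ x)).re
      = (Complex.exp (-b * (‖θ‖ : ℂ) ^ 2 + 2 * Real.pi * Complex.I * ((inner ℝ x θ : ℝ) : ℂ))).re := by
    intro θ
    have : Complex.exp (-b * (‖θ‖ : ℂ) ^ 2 + 2 * Real.pi * Complex.I * ((inner ℝ x θ : ℝ) : ℂ))
        = ((gaussWeight s θ : ℝ) : ℂ) * chr (inner ℝ θ x) := by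
      rw [Complex.exp_add, gaussWeight, chr, real_inner_comm, Complex.ofReal_exp]
      congr 2
      · rw [hb]; push_cast; ring
      · push_cast; ring
    rw [this, Complex.re_ofReal_mul]
  have e2 : ∫ θ : Vec m, Complex.exp (-b * (‖θ‖ : ℂ) ^ 2) = (((1 / s) ^ m : ℝ) : ℂ) := by
    rw [← integral_gaussWeight hs, ← integral_complex_ofReal]
    congr 1; ext θ
    rw [gaussWeight, Complex.ofReal_exp, hb]
    congr 1; push_cast; ring
  rw [← h0, e2] at h
  unfold cosTransform
  simp_rw [e1]
  have hre : ∫ θ : Vec m, (Complex.exp (-b * (‖θ‖ : ℂ) ^ 2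
      + 2 * Real.pi * Complex.I * ((inner ℝ x θ : ℝ) : ℂ))).re
      = (∫ θ : Vec m, Complex.exp (-b * (‖θ‖ : ℂ) ^ 2
      + 2 * Real.pi * Complex.I * ((inner ℝ x θ : ℝ) : ℂ))).re := integral_re hi
  rw [hre, h, Complex.re_ofReal_mul]
  congr 1
  have e3 : (2 * Real.pi * Complex.I) ^ 2 * (‖x‖ : ℂ) ^ 2 / (4 * b)
      = ((-(Real.pi * ‖x‖ ^ 2 / s ^ 2) : ℝ) : ℂ) := by
    rw [hb, mul_pow, Complex.I_sq]
    push_cast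
    have : (Real.pi : ℂ) ≠ 0 := by exact_mod_cast hpi.ne'
    have : (s : ℂ) ≠ 0 := by exact_mod_cast hs.ne'
    field_simp; ring
  rw [e3, ← Complex.ofReal_exp, Complex.ofReal_re]

/-- Three quarters of the exponent give the decay, and the last quarter, the Gaussian with `s/2`, is
integrated. -/
theorem integral_gaussWeight_tail_le {s L : ℝ} (hs : 0 < s) (hL : 0 ≤ L) :
    ∫ θ in {θ : Vec m | L < supNorm θ}, gaussWeight s θ
      ≤ Real.exp (-(s ^ 2 * L ^ 2)) * (2 / s) ^ m := by
  have hpi := Real.pi_gt_three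
  have hs2 : 0 < s / 2 := by positivity
  have hE : MeasurableSet {θ : Vec m | L < supNorm θ} :=
    (isOpen_lt continuous_const continuous_supNorm).measurableSet
  have hi := (integrable_gaussWeight (m := m) hs2).const_mul (Real.exp (-(s ^ 2 * L ^ 2)))
  calc ∫ θ in {θ : Vec m | L < supNorm θ}, gaussWeight s θ
      ≤ ∫ θ in {θ : Vec m | L < supNorm θ}, Real.exp (-(s ^ 2 * L ^ 2)) * gaussWeight (s / 2) θ := by
        refine setIntegral_mono_on (integrable_gaussWeight hs).integrableOn hi.integrableOn hE ?_
        intro θ hθ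
        unfold gaussWeight
        rw [← Real.exp_add]
        apply Real.exp_le_exp.mpr
        have h1 : L ^ 2 ≤ ‖θ‖ ^ 2 := pow_le_pow_left₀ hL (le_of_lt (hθ.trans_le (supNorm_le_norm θ))) 2
        have h2 : s ^ 2 * L ^ 2 ≤ s ^ 2 * ‖θ‖ ^ 2 := by gcongr
        have h3 : 3 * (s ^ 2 * ‖θ‖ ^ 2) ≤ Real.pi * (s ^ 2 * ‖θ‖ ^ 2) := by gcongr
        nlinarith
    _ ≤ ∫ θ : Vec m, Real.exp (-(s ^ 2 * L ^ 2)) * gaussWeight (s / 2) θ :=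
        setIntegral_le_integral hi (Filter.Eventually.of_forall fun θ =>
          mul_nonneg (Real.exp_pos _).le (Real.exp_pos _).le)
    _ = _ := by
        rw [integral_const_mul, integral_gaussWeight hs2]
        congr 2; field_simp

/-! ### The cube weight -/

/-- The indicator function of the cube `[-1/2, 1/2]^m`. -/
def cubeWeight : Vec m → ℝ := {θ : Vec m | supNorm θ ≤ 1 / 2}.indicator fun _ => 1

theorem measurableSet_cube : MeasurableSet {θ : Vec m | supNorm θ ≤ 1 / 2} :=
  (isClosed_le continuous_supNorm continuous_const).measurableSet

theorem integrable_cubeWeight : Integrable (cubeWeight (m := m)) := by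
  unfold cubeWeight
  rw [integrable_indicator_iff measurableSet_cube]
  refine integrableOn_const ?_ (by simp)
  rw [volume_supNorm_le _ (by norm_num)]; exact ENNReal.ofReal_ne_top

theorem integral_cubeWeight : ∫ θ : Vec m, cubeWeight θ = 1 := by
  unfold cubeWeight
  rw [integral_indicator_const _ measurableSet_cube, volume_real_supNorm_le _ (by norm_num)]
  simp

theorem integral_cubeWeight_tail : ∫ θ in {θ : Vec m | 1 / 2 < supNorm θ}, cubeWeight θ = 0 := by
  apply setIntegral_eq_zero_of_forall_eq_zero
  intro θ hθ
  have : ¬ supNorm θ ≤ 1 / 2 := not_le.mpr hθ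
  exact Set.indicator_of_notMem (by exact this) _

theorem integral_chr_mul_int {k : ℤ} (hk : k ≠ 0) :
    ∫ t in (-(1 / 2) : ℝ)..(1 / 2), chr (t * k) = 0 := by
  have hc : (2 * Real.pi * k * Complex.I : ℂ) ≠ 0 := by
    have : (k : ℂ) ≠ 0 := by exact_mod_cast hk
    have : (Real.pi : ℂ) ≠ 0 := by exact_mod_cast Real.pi_ne_zero
    simp [*]
  have e : ∀ t : ℝ, chr (t * k) = Complex.exp ((2 * Real.pi * k * Complex.I) * t) := by
    intro t; unfold chr; congr 1; push_cast; ring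
  simp_rw [e]
  rw [integral_exp_mul_complex hc]
  have : Complex.exp (2 * Real.pi * k * Complex.I * ((1 / 2 : ℝ) : ℂ))
      = Complex.exp (2 * Real.pi * k * Complex.I * ((-(1 / 2) : ℝ) : ℂ)) := by
    rw [Complex.exp_eq_exp_iff_exists_int]
    exact ⟨k, by push_cast; ring⟩
  rw [this, sub_self, zero_div]

/-- The transform factorises over the coordinates, and a nonzero coordinate `k` contributes the
integral of `exp (2πikt)` over a full period. -/
theorem cosTransform_cubeWeight {x : Vec m} (hx : x ∈ integerPoints m) (hx0 : x ≠ 0) :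
    cosTransform cubeWeight x = 0 := by
  have hc := continuous_chr
  choose k hk using hx
  have hfac : ∫ θ : Vec m, (cubeWeight θ : ℂ) * chr (inner ℝ θ x) = 0 := by
    set f : Fin m → ℝ → ℂ := fun i t =>
      (Set.Icc (-(1 / 2) : ℝ) (1 / 2)).indicator (fun t => chr (t * k i)) t with hf
    have h1 : ∀ θ : Vec m, (cubeWeight θ : ℂ) * chr (inner ℝ θ x)
        = ∏ i, f i (WithLp.ofLp θ i) := by
      intro θ
      by_cases hθ : supNorm θ ≤ 1 / 2
      · have e : cubeWeight θ = 1 := Set.indicator_of_mem (by exact hθ) _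
        rw [e, PiLp.inner_apply, chr_sum]
        simp only [Complex.ofReal_one, one_mul]
        apply Finset.prod_congr rfl
        intro i _
        have hi := (supNorm_le_iff (by norm_num)).mp hθ i
        simp only [hf]
        rw [Set.indicator_of_mem (Set.mem_Icc.mpr (abs_le.mp hi)), ← hk i]
        simp [mul_comm]
      · have e : cubeWeight θ = 0 := Set.indicator_of_notMem (by exact hθ) _
        rw [supNorm_le_iff (by norm_num)] at hθ
        push Not at hθ
        obtain ⟨i, hi⟩ := hθ
        rw [e, Complex.ofReal_zero, zero_mul]
        symm
        apply Finset.prod_eq_zero (Finset.mem_univ i)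
        exact Set.indicator_of_notMem
          (fun h => absurd (abs_le.mpr (Set.mem_Icc.mp h)) (not_le.mpr hi)) _
    simp_rw [h1]
    have h2 := (EuclideanSpace.volume_preserving_symm_measurableEquiv_toLp (Fin m)).integral_comp
      (MeasurableEquiv.toLp 2 (Fin m → ℝ)).symm.measurableEmbedding
      (fun y : Fin m → ℝ => ∏ i, f i (y i))
    refine h2.trans ?_
    rw [volume_pi, integral_fintype_prod_eq_prod]
    obtain ⟨i, hi⟩ : ∃ i, k i ≠ 0 := by
      by_contra hcon
      push Not at hcon
      apply hx0
      ext i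
      rw [hk i, hcon i]; simp
    apply Finset.prod_eq_zero (Finset.mem_univ i)
    simp only [hf]
    rw [integral_indicator measurableSet_Icc, integral_Icc_eq_integral_Ioc,
      ← intervalIntegral.integral_of_le (by norm_num)]
    exact integral_chr_mul_int hi
  have hi : Integrable fun θ : Vec m => (cubeWeight θ : ℂ) * chr (inner ℝ θ x) := by
    refine (integrable_cubeWeight.ofReal (𝕜 := ℂ)).mul_bdd (c := 1) ?_ ?_
    · exact (hc.comp (by fun_prop)).aestronglyMeasurable
    · exact Filter.Eventually.of_forall fun θ => (norm_chr _).le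
  have hre : ∫ θ : Vec m, ((cubeWeight θ : ℂ) * chr (inner ℝ θ x)).re
      = (∫ θ : Vec m, (cubeWeight θ : ℂ) * chr (inner ℝ θ x)).re := integral_re hi
  unfold cosTransform
  simp_rw [Complex.re_ofReal_mul] at hre
  rw [hre, hfac, Complex.zero_re]

/-! ### Consequences of anti-concentration -/

section Anti

variable {D : Measure (Vec m)} {κ : ℝ}

theorem AntiConcentrated.le_measureReal [IsProbabilityMeasure D] (h : AntiConcentrated D κ) {θ : Vec m}
    (hθ : θ ∈ fundDomain D) :
    κ ≤ D.real {x | κ * min 1 (supNorm θ * sigma D) ≤ distInt (inner ℝ θ x)} := by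
  -- For `ν = 0` the conditioning event is the whole space.
  have := h 0 θ hθ
  simpa using this

theorem mem_fundDomain_of_supNorm_le (hΛ : dualLattice D = integerPoints m) {θ : Vec m}
    (hθ : supNorm θ ≤ 1 / 2) : θ ∈ fundDomain D := by
  intro w hw _
  rw [hΛ] at hw
  rw [EuclideanSpace.norm_eq, EuclideanSpace.norm_eq]
  apply Real.sqrt_le_sqrt
  apply Finset.sum_le_sum
  intro i _
  obtain ⟨k, hk⟩ := hw i
  have h1 := (supNorm_le_iff (by norm_num)).mp hθ i
  have h2 := distInt_le_abs_sub (θ i) k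
  rw [distInt_of_abs_le h1] at h2
  rw [Real.norm_eq_abs, Real.norm_eq_abs, PiLp.sub_apply, hk]
  exact pow_le_pow_left₀ (abs_nonneg _) h2 2

theorem AntiConcentrated.le_one [IsProbabilityMeasure D] (h : AntiConcentrated D κ) : κ ≤ 1 := by
  have h0 : (0 : Vec m) ∈ fundDomain D := by
    intro w _ _; simp
  exact (h.le_measureReal h0).trans measureReal_le_one

/-- Three dilates of one functional cannot all be far from the integers. -/
theorem AntiConcentrated.le_two_fifths [IsProbabilityMeasure D] (hm : 1 ≤ m) (hσ : 0 < sigma D) (h : AntiConcentrated D κ)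
    (hV : fundDomain D = Set.univ) : κ ≤ 2 / 5 := by
  by_contra hκ
  push Not at hκ
  have hκ0 : 0 < κ := by linarith
  set θ : Vec m := EuclideanSpace.single ⟨0, hm⟩ (1 / sigma D) with hθ
  have hn : 1 / sigma D ≤ supNorm θ := by
    have := abs_apply_le_supNorm θ ⟨0, hm⟩
    rw [hθ] at this ⊢
    simp only [PiLp.single_apply, if_true] at this
    exact (le_abs_self _).trans this
  -- `θ` is long enough for the cap at `1` to be active for all its dilates by `t ≥ 1`.
  have hE : ∀ t : ℝ, 1 ≤ t → κ ≤ D.real {x | κ ≤ distInt (t * inner ℝ θ x)} := by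
    intro t ht
    have h1 := h.le_measureReal (θ := t • θ) (by rw [hV]; trivial)
    have h2 : min 1 (supNorm (t • θ) * sigma D) = 1 := by
      apply min_eq_left
      rw [supNorm_smul, abs_of_pos (by linarith)]
      rw [div_le_iff₀ hσ] at hn
      nlinarith
    rw [h2, mul_one] at h1
    simp_rw [inner_smul_left, conj_trivial] at h1
    exact h1
  have hmeas : ∀ t : ℝ, MeasurableSet {x : Vec m | κ ≤ distInt (t * inner ℝ θ x)} := by
    intro t
    apply measurableSet_le measurable_const
    exact continuous_distInt.measurable.comp (by fun_prop)
  -- Such a `y` is within `1/10` of a half-integer, so `2y` and `4y` are within `1/5` and `2/5` of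
  -- integers. The events for `t = 1, 2, 4` are therefore disjoint, and `3κ ≤ 1`.
  have far : ∀ y : ℝ, κ ≤ distInt y → distInt (2 * y) < κ ∧ distInt (4 * y) < κ := by
    intro y hy
    have hd := distInt_le_half y
    rw [distInt_eq] at hy hd
    rcases le_total 0 (y - round y) with h0 | h0
    · rw [abs_of_nonneg h0] at hy hd
      constructor
      · refine (distInt_le_abs_sub (2 * y) (2 * round y + 1)).trans_lt ?_
        push_cast; rw [abs_lt]; constructor <;> linarith
      · refine (distInt_le_abs_sub (4 * y) (4 * round y + 2)).trans_lt ?_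
        push_cast; rw [abs_lt]; constructor <;> linarith
    · rw [abs_of_nonpos h0] at hy hd
      constructor
      · refine (distInt_le_abs_sub (2 * y) (2 * round y - 1)).trans_lt ?_
        push_cast; rw [abs_lt]; constructor <;> linarith
      · refine (distInt_le_abs_sub (4 * y) (4 * round y - 2)).trans_lt ?_
        push_cast; rw [abs_lt]; constructor <;> linarith
  have d12 : Disjoint {x : Vec m | κ ≤ distInt (1 * inner ℝ θ x)}
      {x | κ ≤ distInt (2 * inner ℝ θ x)} := by
    rw [Set.disjoint_left]
    intro x h1 h2
    simp only [Set.mem_ofPred_eq, one_mul] at h1 h2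
    linarith [(far _ h1).1]
  have d3 : Disjoint ({x : Vec m | κ ≤ distInt (1 * inner ℝ θ x)} ∪
      {x | κ ≤ distInt (2 * inner ℝ θ x)}) {x | κ ≤ distInt (4 * inner ℝ θ x)} := by
    rw [Set.disjoint_left]
    intro x h1 h2
    simp only [Set.mem_union, Set.mem_ofPred_eq, one_mul] at h1 h2
    rcases h1 with h1 | h1
    · linarith [(far _ h1).2]
    · have h3 := (far _ h1).1
      rw [← mul_assoc] at h3
      norm_num at h3
      linarith
  have hu := measureReal_union (μ := D) d3 (hmeas 4)
  rw [measureReal_union d12 (hmeas 2)] at hu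
  have : D.real ({x : Vec m | κ ≤ distInt (1 * inner ℝ θ x)} ∪
      {x | κ ≤ distInt (2 * inner ℝ θ x)} ∪ {x | κ ≤ distInt (4 * inner ℝ θ x)}) ≤ 1 :=
    measureReal_le_one
  linarith [hE 1 le_rfl, hE 2 (by norm_num), hE 4 (by norm_num)]

theorem ae_mem_integerPoints (hΛ : dualLattice D = integerPoints m) :
    ∀ᵐ x ∂D, x ∈ integerPoints m := by
  have hs : ∀ᵐ x ∂D, x ∈ D.support := Measure.support_mem_ae
  filter_upwards [hs] with x hx i
  have hi : EuclideanSpace.single i (1 : ℝ) ∈ dualLattice D := by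
    rw [hΛ]
    intro j
    by_cases hij : j = i
    · exact ⟨1, by simp [hij]⟩
    · exact ⟨0, by simp [hij]⟩
  obtain ⟨k, hk⟩ := hi x hx
  exact ⟨k, by simpa [PiLp.inner_apply, PiLp.single_apply] using hk⟩

/-- An integral distribution which is anti-concentrated has second moment at least `κ`. -/
theorem AntiConcentrated.le_sigma_sq_add [IsProbabilityMeasure D] (hm : 1 ≤ m) (h2 : MemLp id 2 D) (hσ : 0 < sigma D)
    (hκ : 0 < κ) (h : AntiConcentrated D κ) (hΛ : dualLattice D = integerPoints m) :
    κ ≤ 2 * (m * sigma D ^ 2 + ‖mean D‖ ^ 2) := by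
  -- At this frequency, being off the integers forces `x ≠ 0`, hence `‖x‖ ≥ 1` for an integral `x`;
  -- Markov's inequality concludes.
  set θ : Vec m := EuclideanSpace.single ⟨0, hm⟩ (1 / 2) with hθ
  have hn : supNorm θ ≤ 1 / 2 := by
    refine (supNorm_le_norm θ).trans ?_
    rw [hθ]; simp
  have hn0 : 0 < supNorm θ := by
    refine lt_of_le_of_ne (supNorm_nonneg θ) fun h0 => ?_
    have := supNorm_eq_zero.mp h0.symm
    rw [hθ] at this
    simp at this
  have h1 := h.le_measureReal (mem_fundDomain_of_supNorm_le hΛ hn)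
  have hsupp := ae_mem_integerPoints hΛ
  have h3 : D.real {x | κ * min 1 (supNorm θ * sigma D) ≤ distInt (inner ℝ θ x)}
      ≤ D.real {x | (1 : ℝ) ≤ ‖x‖ ^ 2} := by
    refine ENNReal.toReal_mono (measure_ne_top _ _) (measure_mono_ae ?_)
    filter_upwards [hsupp] with x hx hx2
    have hpos : 0 < κ * min 1 (supNorm θ * sigma D) := by positivity
    have hx0 : x ≠ 0 := by
      rintro rfl
      have h4 : κ * min 1 (supNorm θ * sigma D) ≤ distInt (inner ℝ θ (0 : Vec m)) := hx2
      rw [inner_zero_right] at h4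
      have := distInt_le_abs 0
      simp at this
      linarith
    obtain ⟨i, hi⟩ : ∃ i, x i ≠ 0 := by
      by_contra hcon
      push Not at hcon
      exact hx0 (by ext i; simpa using hcon i)
    obtain ⟨k, hk⟩ := hx i
    have hk0 : k ≠ 0 := by rintro rfl; simp at hk; exact hi hk
    have h5 : (1 : ℝ) ≤ |(k : ℝ)| := by exact_mod_cast Int.one_le_abs hk0
    have h6 := PiLp.norm_apply_le x i
    rw [hk, Real.norm_eq_abs] at h6
    change (1 : ℝ) ≤ ‖x‖ ^ 2
    nlinarith
  have hint : Integrable (fun x : Vec m => ‖x - mean D‖ ^ 2) D := by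
    simp_rw [norm_sub_mean_sq]
    exact integrable_finsetSum _ fun i _ => integrable_sq_apply_sub_mean h2 i
  have hint2 : Integrable (fun x : Vec m => ‖x‖ ^ 2) D := h2.integrable_norm_pow (by norm_num)
  have h4 := mul_meas_ge_le_integral_of_nonneg (μ := D)
    (f := fun x : Vec m => ‖x‖ ^ 2) (Filter.Eventually.of_forall fun x => by positivity) hint2 1
  rw [one_mul] at h4
  have h5 : ∫ x, ‖x‖ ^ 2 ∂D ≤ ∫ x, 2 * (‖x - mean D‖ ^ 2 + ‖mean D‖ ^ 2) ∂D := by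
    apply integral_mono hint2 ((hint.add (integrable_const _)).const_mul 2)
    intro x
    have h7 : ‖x‖ ≤ ‖x - mean D‖ + ‖mean D‖ := by
      simpa using norm_add_le (x - mean D) (mean D)
    have h8 := pow_le_pow_left₀ (norm_nonneg _) h7 2
    change ‖x‖ ^ 2 ≤ 2 * (‖x - mean D‖ ^ 2 + ‖mean D‖ ^ 2)
    nlinarith [sq_nonneg (‖x - mean D‖ - ‖mean D‖)]
  rw [integral_const_mul, integral_add hint (integrable_const _), integral_const] at h5
  have h6 := integral_norm_sub_mean_sq_le h2
  simp at h5
  linarith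

end Anti

/-! ### The range of the parameters -/

/-- The relations between the parameters, with every size measured in powers of `y = n^{1/120}`. -/
structure Scale (m n : ℕ) (σ μ κ κ₀ p y : ℝ) : Prop where
  one_le : 1 ≤ m
  sigma_pos : 0 < σ
  kappa₀_pos : 0 < κ₀
  kappa₀_le : κ₀ ≤ κ
  kappa_le : κ ≤ 1
  p_pos : 0 < p
  p_le : p ≤ κ ^ 4 / (1000 * (m : ℝ) ^ 5)
  pow_eq : y ^ 120 = n
  le_y : 1000 / κ₀ ^ 2 * m ≤ y
  mean_le : μ ≤ σ * y ^ 20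
  pn_ge : y ^ 90 ≤ p * n
  sigma_le : σ ≤ Real.exp (κ ^ 3 * p * n / (80 * m))

namespace Scale

variable {n : ℕ} {σ μ κ κ₀ p y : ℝ}

theorem kappa_pos (h : Scale m n σ μ κ κ₀ p y) : 0 < κ := h.kappa₀_pos.trans_le h.kappa₀_le

theorem m_ge (h : Scale m n σ μ κ κ₀ p y) : (1 : ℝ) ≤ m := by exact_mod_cast h.one_le

theorem kappa₀_sq_mul_ge (h : Scale m n σ μ κ κ₀ p y) : 1000 * m ≤ κ₀ ^ 2 * y := by
  have := h.le_y
  have h0 := h.kappa₀_pos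
  rw [div_mul_eq_mul_div, div_le_iff₀ (by positivity)] at this
  linarith

theorem y_ge (h : Scale m n σ μ κ κ₀ p y) : 1000 * m ≤ y := by
  have h1 := h.kappa₀_sq_mul_ge
  have h2 := h.m_ge
  have h3 : κ₀ ≤ 1 := h.kappa₀_le.trans h.kappa_le
  have h4 : κ₀ ^ 2 ≤ 1 := pow_le_one₀ h.kappa₀_pos.le h3
  have hy : 0 ≤ y := by
    by_contra hneg
    push Not at hneg
    nlinarith [sq_nonneg κ₀]
  nlinarith

theorem y_ge' (h : Scale m n σ μ κ κ₀ p y) : 1000 ≤ y := by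
  have := h.y_ge; have := h.m_ge; linarith

theorem m_le (h : Scale m n σ μ κ κ₀ p y) : (m : ℝ) ≤ y := by
  have := h.y_ge; have := h.m_ge; linarith

theorem pow_le (h : Scale m n σ μ κ κ₀ p y) {a b : ℕ} (hab : a ≤ b) : y ^ a ≤ y ^ b :=
  pow_le_pow_right₀ (by linarith [h.y_ge']) hab

theorem one_le_kappa_mul (h : Scale m n σ μ κ κ₀ p y) : 1 ≤ κ * y := by
  have h1 := h.kappa₀_sq_mul_ge
  have h2 := h.m_ge
  have h3 : κ₀ ≤ 1 := h.kappa₀_le.trans h.kappa_le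
  have h5 := h.y_ge'
  have h4 : κ₀ ^ 2 ≤ κ := by nlinarith [h.kappa₀_pos, h.kappa₀_le]
  nlinarith

theorem n_pos (h : Scale m n σ μ κ κ₀ p y) : 0 < n := by
  have : (0 : ℝ) < n := by
    rw [← h.pow_eq]
    have := h.y_ge'
    positivity
  exact_mod_cast this

theorem p_le_thousandth (h : Scale m n σ μ κ κ₀ p y) : p ≤ 1 / 1000 := by
  refine h.p_le.trans ?_
  have h1 : κ ^ 4 ≤ 1 := pow_le_one₀ h.kappa_pos.le h.kappa_le
  have h2 : (1 : ℝ) ≤ (m : ℝ) ^ 5 := one_le_pow₀ h.m_ge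
  rw [div_le_div_iff₀ (by positivity) (by norm_num)]
  linarith

theorem p_le_kappa (h : Scale m n σ μ κ κ₀ p y) : p ≤ κ / 1000 := by
  refine h.p_le.trans ?_
  have h0 := h.kappa_pos
  have h1 : κ ^ 4 ≤ κ ^ 1 := pow_le_pow_of_le_one h.kappa_pos.le h.kappa_le (by norm_num)
  have h2 : (1 : ℝ) ≤ (m : ℝ) ^ 5 := one_le_pow₀ h.m_ge
  rw [div_le_div_iff₀ (by positivity) (by norm_num)]
  nlinarith

theorem x_ge (h : Scale m n σ μ κ κ₀ p y) : y ^ 87 ≤ κ ^ 3 * p * n := by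
  have h1 : 1 ≤ (κ * y) ^ 3 := one_le_pow₀ h.one_le_kappa_mul
  have h2 := h.pn_ge
  have h3 := h.kappa_pos
  have h4 : 0 ≤ y ^ 87 := by have := h.y_ge'; positivity
  calc y ^ 87 ≤ (κ * y) ^ 3 * y ^ 87 := le_mul_of_one_le_left h4 h1
    _ = κ ^ 3 * y ^ 90 := by ring
    _ ≤ κ ^ 3 * (p * n) := by gcongr
    _ = _ := by ring

theorem x_le (h : Scale m n σ μ κ κ₀ p y) : κ ^ 3 * p * n ≤ p * n := by
  have h1 : κ ^ 3 ≤ 1 := pow_le_one₀ h.kappa_pos.le h.kappa_le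
  have : 0 ≤ p * n := mul_nonneg h.p_pos.le (Nat.cast_nonneg n)
  nlinarith

theorem pn_le (h : Scale m n σ μ κ κ₀ p y) : p * n ≤ n / 1000 := by
  have := h.p_le_thousandth
  have : (0 : ℝ) ≤ n := Nat.cast_nonneg n
  nlinarith

/-- By `m ≤ y ≤ e^y`, the `m`-th power of a polynomial factor costs only `exp (O(y²))`, negligible
against the large exponents in `small_terms`. -/
theorem pow_mul_le (h : Scale m n σ μ κ κ₀ p y) (k : ℕ) : (y ^ k) ^ m ≤ Real.exp (k * y ^ 2) := by
  have hy := h.y_ge'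
  have h1 : y ≤ Real.exp y := by linarith [Real.add_one_le_exp y]
  calc (y ^ k) ^ m = y ^ (k * m) := (pow_mul _ _ _).symm
    _ ≤ Real.exp y ^ (k * m) := by gcongr
    _ = Real.exp (k * (m * y)) := by rw [← Real.exp_nat_mul]; push_cast; ring_nf
    _ ≤ _ := by
        apply Real.exp_le_exp.mpr
        have := h.m_le
        rw [sq]; gcongr

theorem sq_small (h : Scale m n σ μ κ κ₀ p y) {a : ℝ} (ha : a ≤ 400) {k : ℕ} (hk : 3 ≤ k) :
    a * y ^ 2 + 52 ≤ 41 / 100 * y ^ k := by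
  have hy := h.y_ge'
  have h1 := h.pow_le hk
  have h2 : (1000 : ℝ) ^ 2 ≤ y ^ 2 := by gcongr
  nlinarith [sq_nonneg y]

/-- The exponents which occur are all larger than the polynomial corrections. -/
theorem small_terms (h : Scale m n σ μ κ κ₀ p y) {w : ℝ} (hw1 : w ≤ 13 / 200 * (p * n))
    (hw2 : w ≤ 81 / 80 * (κ ^ 3 * p * n)) :
    Real.exp (-n) * Real.exp (201 * y ^ 2 + w) ≤ Real.exp (-52) ∧
    Real.exp (-(9 / 100 * (p * n))) * Real.exp (201 * y ^ 2 + w) ≤ Real.exp (-52) ∧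
    Real.exp (-(63 / 32 * (κ ^ 3 * p * n))) * Real.exp (201 * y ^ 2 + w) ≤ Real.exp (-52) ∧
    2 ^ m * Real.exp (-n) * Real.exp (201 * y ^ 2 + w) ≤ Real.exp (-52) ∧
    Real.exp (-(63 / 128 * (κ ^ 3 * p * n / (m * y ^ 42)))) * Real.exp (142 * y ^ 2)
      ≤ Real.exp (-52) := by
  have hy := h.y_ge'
  have hpn := h.pn_ge
  have hx := h.x_ge
  have hnp := h.pn_le
  have hn0 : (0 : ℝ) ≤ n := Nat.cast_nonneg n
  have h2m : (2 : ℝ) ^ m ≤ Real.exp (1 * y ^ 2) := by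
    refine le_trans ?_ ((h.pow_mul_le 1).trans (le_of_eq (by norm_num)))
    gcongr; linarith
  have hpn0 : 0 ≤ y ^ 90 := by positivity
  have e4 := h.sq_small (a := 202) (by norm_num) (k := 90) (by norm_num)
  have e89 : 41 * y ^ 89 ≤ y ^ 90 := by
    rw [pow_succ y 89]; nlinarith [pow_nonneg (by linarith : (0:ℝ) ≤ y) 89]
  have e5 := h.sq_small (a := 202) (by norm_num) (k := 89) (by norm_num)
  have hm0 : (0 : ℝ) < m := by linarith [h.m_ge]
  refine ⟨?_, ?_, ?_, ?_, ?_⟩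
  · rw [← Real.exp_add]; apply Real.exp_le_exp.mpr
    nlinarith [sq_nonneg y]
  · rw [← Real.exp_add]; apply Real.exp_le_exp.mpr
    nlinarith [sq_nonneg y]
  · rw [← Real.exp_add]; apply Real.exp_le_exp.mpr
    have := h.sq_small (a := 201) (by norm_num) (k := 87) (by norm_num)
    nlinarith
  · calc 2 ^ m * Real.exp (-n) * Real.exp (201 * y ^ 2 + w)
        ≤ Real.exp (1 * y ^ 2) * Real.exp (-n) * Real.exp (201 * y ^ 2 + w) := by gcongr
      _ ≤ _ := by
        rw [← Real.exp_add, ← Real.exp_add]; apply Real.exp_le_exp.mpr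
        nlinarith [sq_nonneg y]
  · rw [← Real.exp_add]; apply Real.exp_le_exp.mpr
    have h1 : y ^ 44 ≤ κ ^ 3 * p * n / (m * y ^ 42) := by
      rw [le_div_iff₀ (by positivity)]
      calc y ^ 44 * (m * y ^ 42) ≤ y ^ 44 * (y * y ^ 42) := by gcongr; exact h.m_le
        _ = y ^ 87 := by ring
        _ ≤ _ := hx
    have := h.sq_small (a := 142) (by norm_num) (k := 44) (by norm_num)
    nlinarith

theorem sqrt_le (h : Scale m n σ μ κ κ₀ p y) : √(p * n * m) ≤ y ^ 120 := by
  have hy := h.y_ge'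
  apply Real.sqrt_le_iff.mpr
  refine ⟨by positivity, ?_⟩
  have h1 : p * n ≤ y ^ 120 := by
    have := h.pn_le; rw [← h.pow_eq] at this ⊢
    have : 0 ≤ y ^ 120 := by positivity
    linarith
  have h2 : (m : ℝ) ≤ y ^ 120 := by
    refine h.m_le.trans ?_
    simpa using h.pow_le (a := 1) (b := 120) (by norm_num)
  rw [sq]
  exact mul_le_mul h1 h2 (Nat.cast_nonneg m) (by positivity)

/-- After multiplication by the inverse volume `V`, every error is at most `e^{-52}`, and their
total multiplicity `6` is below `e²`. Here `w` is the exponential part of the weight's mass times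
`V`; it must stay below the exponents `9/100 · pn` and `63/32 · κ³pn`. -/
theorem error_le (h : Scale m n σ μ κ κ₀ p y) {w M e t : ℝ}
    (hw1 : w ≤ 13 / 200 * (p * n)) (hw2 : w ≤ 81 / 80 * (κ ^ 3 * p * n))
    (hMw : M * (√(p * n * m) * (σ * y ^ 21)) ^ m ≤ Real.exp (201 * y ^ 2 + w))
    (he : e ≤ M * Real.exp (-n)) (ht : t ≤ M * (2 ^ m * Real.exp (-n))) :
    e + 2 * Real.exp (-(9 / 100 * (p * n))) * M
        + Real.exp (-(63 / 128 * (κ ^ 3 * p * n * σ ^ 2 / (m * (σ * y ^ 21) ^ 2)))) * (2 / σ) ^ m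
        + Real.exp (-(63 / 32 * (κ ^ 3 * p * n))) * M + t
      ≤ Real.exp (-50) * (1 / (√(p * n * m) * (σ * y ^ 21))) ^ m := by
  obtain ⟨s1, s2, s3, s4, s5⟩ := h.small_terms hw1 hw2
  have hy := h.y_ge'
  have hσ := h.sigma_pos
  have hm0 : (0 : ℝ) < m := by linarith [h.m_ge]
  have hn0 : (0 : ℝ) < n := by exact_mod_cast h.n_pos
  have hs : 0 < √(p * n * m) := Real.sqrt_pos.mpr (by have := h.p_pos; positivity)
  set V := (√(p * n * m) * (σ * y ^ 21)) ^ m with hV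
  have hV0 : 0 < V := by positivity
  have hσV : (2 / σ) ^ m * V ≤ Real.exp (142 * y ^ 2) := by
    rw [hV, ← mul_pow]
    refine le_trans ?_ ((h.pow_mul_le 142).trans (le_of_eq (by norm_num)))
    have : 2 / σ * (√(p * n * m) * (σ * y ^ 21)) = 2 * √(p * n * m) * y ^ 21 := by field_simp
    rw [this]
    gcongr
    calc 2 * √(p * n * m) * y ^ 21 ≤ y * y ^ 120 * y ^ 21 := by
          gcongr
          · linarith
          · exact h.sqrt_le
      _ = y ^ 142 := by ring
  have e1 : κ ^ 3 * p * n * σ ^ 2 / (m * (σ * y ^ 21) ^ 2) = κ ^ 3 * p * n / (m * y ^ 42) := by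
    field_simp
  rw [e1, one_div, inv_pow, ← div_eq_mul_inv, le_div_iff₀ hV0]
  have t1 : e * V ≤ Real.exp (-52) := by
    calc e * V ≤ M * Real.exp (-n) * V := by gcongr
      _ = Real.exp (-n) * (M * V) := by ring
      _ ≤ Real.exp (-n) * Real.exp (201 * y ^ 2 + w) := by gcongr
      _ ≤ _ := s1
  have t2 : Real.exp (-(9 / 100 * (p * n))) * (M * V) ≤ Real.exp (-52) := by
    refine le_trans ?_ s2; gcongr
  have t3 : Real.exp (-(63 / 32 * (κ ^ 3 * p * n))) * (M * V) ≤ Real.exp (-52) := by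
    refine le_trans ?_ s3; gcongr
  have t4 : t * V ≤ Real.exp (-52) := by
    calc t * V ≤ M * (2 ^ m * Real.exp (-n)) * V := by gcongr
      _ = 2 ^ m * Real.exp (-n) * (M * V) := by ring
      _ ≤ 2 ^ m * Real.exp (-n) * Real.exp (201 * y ^ 2 + w) := by gcongr
      _ ≤ _ := s4
  have t5 : Real.exp (-(63 / 128 * (κ ^ 3 * p * n / (m * y ^ 42)))) * ((2 / σ) ^ m * V)
      ≤ Real.exp (-52) := by
    refine le_trans ?_ s5; gcongr
  have e2 : Real.exp (-50) = Real.exp (-52) * Real.exp 1 ^ 2 := by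
    rw [← Real.exp_nat_mul, ← Real.exp_add]; norm_num
  have e3 : 6 ≤ Real.exp 1 ^ 2 := by nlinarith [Real.exp_one_gt_d9]
  have e4 := Real.exp_pos (-52)
  nlinarith

theorem near_le (h : Scale m n σ μ κ κ₀ p y) :
    72 * 26000 ^ 2 * m ^ 7 * (σ * y ^ 21) ^ 2 ≤ κ ^ 3 * p * n * σ ^ 2 := by
  have hy := h.y_ge'
  have h1 : 72 * 26000 ^ 2 * (m : ℝ) ^ 7 * y ^ 42 ≤ y ^ 87 := by
    calc 72 * 26000 ^ 2 * (m : ℝ) ^ 7 * y ^ 42 ≤ y ^ 10 * y ^ 7 * y ^ 42 := by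
          gcongr
          · calc (72 * 26000 ^ 2 : ℝ) ≤ 1000 ^ 10 := by norm_num
              _ ≤ y ^ 10 := by gcongr
          · exact h.m_le
      _ = y ^ 59 := by ring
      _ ≤ y ^ 87 := h.pow_le (by norm_num)
  calc 72 * 26000 ^ 2 * m ^ 7 * (σ * y ^ 21) ^ 2
      = (72 * 26000 ^ 2 * (m : ℝ) ^ 7 * y ^ 42) * σ ^ 2 := by ring
    _ ≤ (κ ^ 3 * p * n) * σ ^ 2 := mul_le_mul_of_nonneg_right (h1.trans h.x_ge) (sq_nonneg σ)

/-- Of the budget `3/400`, two parts pay for the displacement of the target and one for the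
fluctuation `ε` of the columns. -/
theorem small_le (h : Scale m n σ μ κ κ₀ p y) :
    m * (σ * √(m * n) + κ₀ ^ 2 / 400 * σ / m * n) ≤ 3 / 400 * κ ^ 2 * σ * n := by
  have hy := h.y_ge'
  have hm0 : (0 : ℝ) < m := by linarith [h.m_ge]
  have hσ := h.sigma_pos
  have hκ := h.kappa_pos
  have hsq : κ₀ ^ 2 ≤ κ ^ 2 := pow_le_pow_left₀ h.kappa₀_pos.le h.kappa₀_le 2
  have hs : √(m * n) ≤ y ^ 61 := by
    apply Real.sqrt_le_iff.mpr
    refine ⟨by positivity, ?_⟩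
    rw [← h.pow_eq]
    calc (m : ℝ) * y ^ 120 ≤ y * y ^ 120 := by gcongr; exact h.m_le
      _ = y ^ 121 := by ring
      _ ≤ y ^ 122 := h.pow_le (by norm_num)
      _ = _ := by ring
  have hms : m * √(m * n) ≤ 2 / 400 * κ ^ 2 * n := by
    have h1 : 1 ≤ (κ * y) ^ 2 := one_le_pow₀ h.one_le_kappa_mul
    calc m * √(m * n) ≤ y * y ^ 61 := by gcongr; exact h.m_le
      _ = y ^ 62 * 1 := by ring
      _ ≤ y ^ 62 * (κ * y) ^ 2 := by gcongr
      _ = 1 * (κ ^ 2 * y ^ 64) := by ring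
      _ ≤ (2 / 400 * y) * (κ ^ 2 * y ^ 64) := by gcongr; linarith
      _ = 2 / 400 * κ ^ 2 * y ^ 65 := by ring
      _ ≤ 2 / 400 * κ ^ 2 * y ^ 120 := by gcongr ?_ * ?_; exact h.pow_le (by norm_num)
      _ = _ := by rw [h.pow_eq]
  calc m * (σ * √(m * n) + κ₀ ^ 2 / 400 * σ / m * n)
      = σ * (m * √(m * n)) + κ₀ ^ 2 / 400 * σ * n := by field_simp
    _ ≤ σ * (2 / 400 * κ ^ 2 * n) + κ ^ 2 / 400 * σ * n := by gcongr
    _ = _ := by ring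

theorem radius_le (h : Scale m n σ μ κ κ₀ p y) :
    μ + 1000 / κ₀ ^ 2 * m * √m * σ ≤ σ * y ^ 21 := by
  have hy := h.y_ge'
  have hσ := h.sigma_pos
  have hs : √(m : ℝ) ≤ y := by
    apply Real.sqrt_le_iff.mpr
    have := h.m_le
    exact ⟨by linarith, by nlinarith⟩
  have h1 : 1000 / κ₀ ^ 2 * m * √m * σ ≤ y * y * σ := by
    gcongr; exact h.le_y
  have h2 : y ^ 2 ≤ y ^ 20 := h.pow_le (by norm_num)
  have h3 : 2 * y ^ 20 ≤ y ^ 21 := by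
    rw [pow_succ y 20]; nlinarith [pow_nonneg (by linarith : (0 : ℝ) ≤ y) 20]
  have h4 : σ * (y ^ 20 + y ^ 2) ≤ σ * y ^ 21 := by gcongr; linarith
  have := h.mean_le
  nlinarith

/-- The exponential rate of the failure probability. -/
def rate (κ₀ : ℝ) : ℝ := κ₀ ^ 8 / 1280000000000

/-- Each of the three failures gets a quarter of the bound. The Hoeffding term determines `rate`:
its exponent is exactly `rate κ₀ · n/m⁵`, and `n/m⁵ ≥ 1000 pn`. In the net term, `exp (-κn/8)` beats
`exp ((81/80) κ³pn)` since `p ≤ κ/1000`. -/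
theorem failure_le (h : Scale m n σ μ κ κ₀ p y) {L : ℝ} (hL0 : 0 ≤ L)
    (hL : L * σ ≤ y ^ 180 * Real.exp (81 / 80 * (κ ^ 3 * p * n) / m)) :
    Real.exp (-(n / 160)) + 2 * m * Real.exp (-((κ₀ ^ 2 / 400 * σ / m) ^ 2 * n /
        (8 * (1000 / κ₀ ^ 2 * m * √m * σ) ^ 2)))
      + (40 * L * m * (σ * y ^ 21) ^ 2 / (κ * σ)) ^ m * Real.exp (-(κ * n / 8))
      ≤ Real.exp (-(rate κ₀ * (p * n))) := by
  have hy := h.y_ge'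
  have hm1 := h.m_ge
  have hm0 : (0 : ℝ) < m := by linarith
  have hσ := h.sigma_pos
  have hκ := h.kappa_pos
  have hκ₀ := h.kappa₀_pos
  have hκ₀1 : κ₀ ≤ 1 := h.kappa₀_le.trans h.kappa_le
  have hn0 : (0 : ℝ) < n := by exact_mod_cast h.n_pos
  have hpn := h.pn_ge
  have hpn0 : 0 < p * n := by have := h.p_pos; positivity
  have hy90 : y ≤ y ^ 90 := by simpa using h.pow_le (a := 1) (b := 90) (by norm_num)
  have hc0 : 0 < rate κ₀ := by unfold rate; positivity
  have hc1 : rate κ₀ ≤ 1 := by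
    unfold rate
    have : κ₀ ^ 8 ≤ 1 := pow_le_one₀ hκ₀.le hκ₀1
    linarith
  have quarter : ∀ a : ℝ, a ≤ -(rate κ₀ * (p * n)) - 2 →
      Real.exp a ≤ 1 / 4 * Real.exp (-(rate κ₀ * (p * n))) := by
    intro a ha
    have e3 : 4 ≤ Real.exp 2 := by
      have : Real.exp 2 = Real.exp 1 ^ 2 := by rw [← Real.exp_nat_mul]; norm_num
      rw [this]; nlinarith [Real.exp_one_gt_d9]
    calc Real.exp a ≤ Real.exp (-(rate κ₀ * (p * n)) - 2) := Real.exp_le_exp.mpr ha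
      _ = Real.exp (-(rate κ₀ * (p * n))) / Real.exp 2 := Real.exp_sub _ _
      _ ≤ Real.exp (-(rate κ₀ * (p * n))) / 4 := by gcongr
      _ = _ := by ring
  have hcpn : rate κ₀ * (p * n) ≤ p * n := mul_le_of_le_one_left hpn0.le hc1
  have t1 : Real.exp (-(n / 160)) ≤ 1 / 4 * Real.exp (-(rate κ₀ * (p * n))) := by
    apply quarter
    have := h.pn_le
    linarith
  have t2 : 2 * m * Real.exp (-((κ₀ ^ 2 / 400 * σ / m) ^ 2 * n /
        (8 * (1000 / κ₀ ^ 2 * m * √m * σ) ^ 2))) ≤ 1 / 4 * Real.exp (-(rate κ₀ * (p * n))) := by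
    have e : (κ₀ ^ 2 / 400 * σ / m) ^ 2 * n / (8 * (1000 / κ₀ ^ 2 * m * √m * σ) ^ 2)
        = rate κ₀ * (n / m ^ 5) := by
      have hss : √(m : ℝ) ^ 2 = m := Real.sq_sqrt hm0.le
      have hs0 : 0 < √(m : ℝ) := Real.sqrt_pos.mpr hm0
      rw [mul_pow, mul_pow _ (√(m : ℝ)), hss]
      unfold rate
      field_simp
      norm_num
    have h1 : 1000 * (p * n) ≤ n / m ^ 5 := by
      have h2 := h.p_le
      have h3 : κ ^ 4 ≤ 1 := pow_le_one₀ hκ.le h.kappa_le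
      have h4 : p ≤ 1 / (1000 * (m : ℝ) ^ 5) := h2.trans (by gcongr)
      rw [le_div_iff₀ (by positivity)] at h4 ⊢
      nlinarith
    have h5 : 2 * (m : ℝ) ≤ Real.exp (2 * y) := by
      have := h.m_le
      linarith [Real.add_one_le_exp (2 * y)]
    rw [e]
    refine (mul_le_mul_of_nonneg_right h5 (Real.exp_pos _).le).trans ?_
    rw [← Real.exp_add]
    apply quarter
    have h6 : 3 * y ≤ 999 * (rate κ₀ * (p * n)) := by
      have h7 : 1 ≤ (κ₀ ^ 2 * y) ^ 4 := one_le_pow₀ (by have := h.kappa₀_sq_mul_ge; linarith)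
      have h8 : 1 ≤ rate κ₀ * y ^ 9 := by
        unfold rate
        have e9 : κ₀ ^ 8 / 1280000000000 * y ^ 9
          = (κ₀ ^ 2 * y) ^ 4 * (y ^ 5 / 1280000000000) := by ring
        rw [e9]
        have : (1000 : ℝ) ^ 5 ≤ y ^ 5 := by gcongr
        have : 1 ≤ y ^ 5 / 1280000000000 := by rw [le_div_iff₀ (by norm_num)]; linarith
        exact one_le_mul_of_one_le_of_one_le h7 this
      have h10 : y ^ 10 ≤ p * n := (h.pow_le (by norm_num)).trans hpn
      calc 3 * y ≤ 999 * (1 * y) := by linarith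
        _ ≤ 999 * ((rate κ₀ * y ^ 9) * y) := by gcongr
        _ = 999 * (rate κ₀ * y ^ 10) := by ring
        _ ≤ _ := by gcongr
    have h11 := mul_le_mul_of_nonneg_left h1 hc0.le
    linarith
  have t3 : (40 * L * m * (σ * y ^ 21) ^ 2 / (κ * σ)) ^ m * Real.exp (-(κ * n / 8))
      ≤ 1 / 4 * Real.exp (-(rate κ₀ * (p * n))) := by
    have h1 : 40 * L * m * (σ * y ^ 21) ^ 2 / (κ * σ)
        ≤ y ^ 226 * Real.exp (81 / 80 * (κ ^ 3 * p * n) / m) := by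
      have hk : 1 / κ ≤ y := by
        rw [div_le_iff₀ hκ]; linarith [h.one_le_kappa_mul]
      calc 40 * L * m * (σ * y ^ 21) ^ 2 / (κ * σ)
          = 40 * (L * σ) * m * y ^ 42 * (1 / κ) := by field_simp
        _ ≤ y * (y ^ 180 * Real.exp (81 / 80 * (κ ^ 3 * p * n) / m)) * y * y ^ 42 * y := by
            gcongr
            · linarith
            · exact h.m_le
        _ = y ^ 225 * Real.exp (81 / 80 * (κ ^ 3 * p * n) / m) := by ring
        _ ≤ _ := by gcongr ?_ * _; exact h.pow_le (by norm_num)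
    have h2 : (40 * L * m * (σ * y ^ 21) ^ 2 / (κ * σ)) ^ m
        ≤ Real.exp (226 * y ^ 2) * Real.exp (81 / 80 * (κ ^ 3 * p * n)) := by
      calc _ ≤ (y ^ 226 * Real.exp (81 / 80 * (κ ^ 3 * p * n) / m)) ^ m := by gcongr
        _ = (y ^ 226) ^ m * Real.exp (81 / 80 * (κ ^ 3 * p * n)) := by
            rw [mul_pow, ← Real.exp_nat_mul]; congr 2; field_simp
        _ ≤ _ := by
            gcongr
            exact (h.pow_mul_le 226).trans (le_of_eq (by norm_num))
    refine (mul_le_mul_of_nonneg_right h2 (Real.exp_pos _).le).trans ?_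
    rw [← Real.exp_add, ← Real.exp_add]
    apply quarter
    have h3 := h.x_le
    have h4 : p * n ≤ κ * n / 1000 := by
      have := h.p_le_kappa
      nlinarith
    have h5 : y ^ 119 ≤ κ * n := by
      rw [← h.pow_eq]
      have := h.one_le_kappa_mul
      have h6 : 0 ≤ y ^ 119 := by positivity
      calc y ^ 119 ≤ (κ * y) * y ^ 119 := le_mul_of_one_le_left h6 this
        _ = _ := by ring
    have h7 := h.sq_small (a := 226) (by norm_num) (k := 118) (by norm_num)
    have h8 : 1000 * y ^ 118 ≤ y ^ 119 := by
      rw [pow_succ y 118]; nlinarith [pow_nonneg (by linarith : (0 : ℝ) ≤ y) 118]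
    linarith
  linarith [Real.exp_pos (-(rate κ₀ * (p * n)))]

end Scale

theorem exists_scale {n : ℕ} {σ μ κ κ₀ p : ℝ} (hm : 1 ≤ m) (hσ : 0 < σ) (hμ : 0 ≤ μ)
    (hκ₀ : 0 < κ₀) (hκ : κ₀ ≤ κ) (hκ1 : κ ≤ 1) (hp1 : p ≤ 1)
    (hp : p ≤ κ ^ 4 / (1000 * (m : ℝ) ^ 5))
    (hpn : (1000 / κ₀ ^ 2) ^ 120 * ((m : ℝ) ^ (3 / 4 : ℝ) * (μ / σ + 1) ^ (3 / 2 : ℝ) *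
      (n : ℝ) ^ (-(1 / 4) : ℝ)) ≤ p)
    (hn : (1000 / κ₀ ^ 2) ^ 120 * (m : ℝ) ^ 120 ≤ n)
    (hexp : σ * √(m / κ) + μ ≤ Real.exp (κ ^ 3 * p * n / (80 * m))) :
    ∃ y, Scale m n σ μ κ κ₀ p y := by
  have hm1 : (1 : ℝ) ≤ m := by exact_mod_cast hm
  have hκ0 : 0 < κ := hκ₀.trans_le hκ
  have hκ₀2 : κ₀ ^ 2 ≤ 1 := pow_le_one₀ hκ₀.le (hκ.trans hκ1)
  set Y := 1000 / κ₀ ^ 2 with hY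
  have hY1 : 1 ≤ Y := by rw [hY, le_div_iff₀ (by positivity)]; linarith
  have hn0 : (0 : ℝ) < n := lt_of_lt_of_le (by positivity) hn
  set y : ℝ := (n : ℝ) ^ (1 / 120 : ℝ) with hy
  have hy0 : 0 < y := Real.rpow_pos_of_pos hn0 _
  have hyn : y ^ 120 = n := by
    rw [hy, ← Real.rpow_natCast, ← Real.rpow_mul hn0.le]; norm_num
  have hYy : Y * m ≤ y := by
    rw [← pow_le_pow_iff_left₀ (by positivity) hy0.le (n := 120) (by norm_num), mul_pow, hyn]
    exact hn
  have hq : (n : ℝ) ^ (-(1 / 4) : ℝ) = (y ^ 30)⁻¹ := by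
    rw [← hyn, ← Real.rpow_natCast, ← Real.rpow_natCast, ← Real.rpow_mul hy0.le,
      ← Real.rpow_neg hy0.le]
    norm_num
  set b := μ / σ + 1 with hb
  have hb1 : 1 ≤ b := by
    have : 0 ≤ μ / σ := by positivity
    linarith
  have hm34 : 1 ≤ (m : ℝ) ^ (3 / 4 : ℝ) := Real.one_le_rpow hm1 (by norm_num)
  have hb32 : 1 ≤ b ^ (3 / 2 : ℝ) := Real.one_le_rpow hb1 (by norm_num)
  have hYp : 1 ≤ Y ^ 120 := one_le_pow₀ hY1
  rw [hq] at hpn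
  have hinv : 0 < (y ^ 30)⁻¹ := by positivity
  have h1 : b ^ (3 / 2 : ℝ) * (y ^ 30)⁻¹ ≤ p := by
    refine le_trans ?_ hpn
    calc b ^ (3 / 2 : ℝ) * (y ^ 30)⁻¹ = 1 * (1 * b ^ (3 / 2 : ℝ) * (y ^ 30)⁻¹) := by ring
      _ ≤ _ := by gcongr
  have h2 : (y ^ 30)⁻¹ ≤ p := (le_mul_of_one_le_left hinv.le hb32).trans h1
  -- From `p ≤ 1`, `b^{3/2} ≤ y^30`; take the power `2/3`.
  have hby : b ≤ y ^ 20 := by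
    have h3 : b ^ (3 / 2 : ℝ) ≤ y ^ 30 := by
      have := h1.trans hp1
      rwa [← div_eq_mul_inv, div_le_one (by positivity)] at this
    have h4 := Real.rpow_le_rpow (by positivity) h3 (by norm_num : (0 : ℝ) ≤ 2 / 3)
    rw [← Real.rpow_mul (by linarith), ← Real.rpow_natCast, ← Real.rpow_mul hy0.le] at h4
    norm_num at h4
    exact_mod_cast h4
  refine ⟨y, hm, hσ, hκ₀, hκ, hκ1, hinv.trans_le h2, hp, hyn, hYy, ?_, ?_, ?_⟩
  · have : μ / σ ≤ y ^ 20 := by linarith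
    rw [div_le_iff₀ hσ] at this
    linarith
  · calc y ^ 90 = (y ^ 30)⁻¹ * y ^ 120 := by field_simp
      _ ≤ p * n := by rw [hyn]; gcongr
  · refine le_trans ?_ hexp
    have : 1 ≤ √(m / κ) := by
      rw [Real.one_le_sqrt, le_div_iff₀ hκ0]; linarith
    nlinarith

/-! ### The general bound -/

theorem Scale.columnsLaw_le {n : ℕ} {D : Measure (Vec m)} [IsProbabilityMeasure D]
    {κ κ₀ p y : ℝ} (h : Scale m n (sigma D) ‖mean D‖ κ κ₀ p y) (h2 : MemLp id 2 D) {L : ℝ}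
    (hL : 1 / (2 * √m * (sigma D * y ^ 21)) ≤ L)
    (hLσ : L * sigma D ≤ y ^ 180 * Real.exp (81 / 80 * (κ ^ 3 * p * n) / m))
    (ha : ∀ θ : Vec m, supNorm θ ≤ L →
      κ ≤ D.real {x | κ * min 1 (supNorm θ * sigma D) ≤ distInt (inner ℝ θ x)})
    {w : Vec m → ℝ} (hw0 : ∀ θ, 0 ≤ w θ) (hw1 : ∀ θ, w θ ≤ 1) (hwi : Integrable w)
    (hwhalf : ∀ θ, 9 / 32 * (κ ^ 3 * p * n * sigma D ^ 2) * supNorm θ ^ 2 ≤ 1 → 1 / 2 ≤ w θ)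
    {e W : ℝ} (he0 : 0 ≤ e) (hW1 : W ≤ 13 / 200 * (p * n))
    (hW2 : W ≤ 81 / 80 * (κ ^ 3 * p * n))
    (hMw : (∫ θ, w θ) * (√(p * n * m) * (sigma D * y ^ 21)) ^ m ≤ Real.exp (201 * y ^ 2 + W))
    (he : e ≤ (∫ θ, w θ) * Real.exp (-n))
    (ht : ∫ θ in {θ | L < supNorm θ}, w θ ≤ (∫ θ, w θ) * (2 ^ m * Real.exp (-n))) :
    columnsLaw n D {A | ¬ ∀ l : Vec m,
        ‖l - (p * n) • mean D‖ ≤ sigma D * p * √(m * n) →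
        ∃ S : Finset (Fin n), p * n / 2 ≤ (S.card : ℝ) ∧ (S.card : ℝ) ≤ 3 * (p * n) / 2 ∧
          e < cosTransform w (subsetSum A S - l)}
      ≤ ENNReal.ofReal (Real.exp (-(rate κ₀ * (p * n)))) := by
  have hσ := h.sigma_pos
  have hκ := h.kappa_pos
  have hκ₀ := h.kappa₀_pos
  have hm1 := h.m_ge
  have hm0 : (0 : ℝ) < m := by linarith
  have hy := h.y_ge'
  have hs0 : 0 < √(m : ℝ) := Real.sqrt_pos.mpr hm0
  have hκ₀1 : κ₀ ≤ 1 := h.kappa₀_le.trans h.kappa_le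
  -- `S` makes the truncation bias `σ/S` less than `ε/2`, `τ` is the matching Chebyshev radius, and
  -- `ε` is the fluctuation allowed by `small_le`. They use `κ₀` rather than `κ`, so that the
  -- failure rate depends on `κ₀` only.
  set S := 1000 / κ₀ ^ 2 * m with hS
  set τ := S * √m * sigma D with hτ
  set ε := κ₀ ^ 2 / 400 * sigma D / m with hε
  have hS0 : 0 < S := by positivity
  have hτ0 : 0 < τ := by positivity
  have hS1 : 1000 / κ₀ ^ 2 ≤ S := le_mul_of_one_le_right (by positivity) hm1
  have hSS : 1 / S ^ 2 ≤ κ₀ / 1000 := by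
    have h1 : 1 / S ^ 2 ≤ 1 / (1000 / κ₀ ^ 2) ^ 2 := by gcongr
    refine h1.trans ?_
    have h3 : κ₀ ^ 4 ≤ κ₀ ^ 1 := pow_le_pow_of_le_one hκ₀.le hκ₀1 (by norm_num)
    have h4 : 1 / (1000 / κ₀ ^ 2) ^ 2 = κ₀ ^ 4 / 1000000 := by field_simp; norm_num
    rw [h4]; linarith
  have hB : ‖mean D‖ + τ ≤ sigma D * y ^ 21 := h.radius_le
  have hσB : sigma D ≤ sigma D * y ^ 21 :=
    le_mul_of_one_le_right hσ.le (one_le_pow₀ (by linarith))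
  have hL0 : 0 ≤ L := le_trans (by positivity) hL
  have hprob := columnsLaw_real_not_regular_le (D := D) n h2 (κ := κ) (τ := τ) (ε := ε) (L := L)
    (B := sigma D * y ^ 21) (S := S) hκ h.kappa_le hσ h.one_le hτ0 hS0
    (by
      have hss := Real.sq_sqrt hm0.le
      have : τ ^ 2 = S ^ 2 * √(m : ℝ) ^ 2 * sigma D ^ 2 := by rw [hτ]; ring
      rw [this, hss]; exact le_of_eq (by ring))
    (hSS.trans (by linarith [h.kappa₀_le])) (hSS.trans (by linarith))
    (by
      rw [hε, hS]
      have : sigma D / (1000 / κ₀ ^ 2 * m) = κ₀ ^ 2 / 1000 * (sigma D / m) := by field_simp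
      rw [this]
      have h5 : 0 ≤ κ₀ ^ 2 * (sigma D / m) := by positivity
      have h6 : κ₀ ^ 2 / 400 * sigma D / m / 2 = κ₀ ^ 2 * (sigma D / m) / 800 := by ring
      rw [h6]; linarith)
    hB hσB hL ha
  have hfail := hprob.trans (h.failure_le hL0 hLσ)
  refine (measure_mono ?_).trans (ENNReal.le_ofReal_iff_toReal_le (measure_ne_top _ _)
    (Real.exp_pos _).le |>.mpr hfail)
  -- The target `l` is introduced only after regularity of `A`, so no union bound over targets
  -- occurs.
  intro A hA hreg
  apply hA
  intro l hl
  exact Regular.exists_subset hreg hκ hσ h.one_le h.n_pos hB hσB hL h.small_le h.p_pos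
    h.p_le_thousandth hl h.near_le hw0 hw1 hwi hwhalf (h.error_le hW1 hW2 hMw he ht) he0

/-! ### The continuous case -/

/-- A Gaussian weight whose transform has width `s`, smaller than the accuracy `ρ` by a factor of at
least `√n`: then a transform above its value at distance `ρ` means distance below `ρ`, and this
threshold is at most `e^{-n}` times the mass of the weight. -/
theorem Scale.continuous_case {n : ℕ} {D : Measure (Vec m)} [IsProbabilityMeasure D]
    {κ κ₀ p y : ℝ} (h : Scale m n (sigma D) ‖mean D‖ κ κ₀ p y) (h2 : MemLp id 2 D)
    (ha : AntiConcentrated D κ) (hV : fundDomain D = Set.univ) :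
    columnsLaw n D {A | ¬ ∀ l : Vec m,
        ‖l - (p * n) • mean D‖ ≤ sigma D * p * √(m * n) →
        ∃ S : Finset (Fin n), p * n / 2 ≤ (S.card : ℝ) ∧ (S.card : ℝ) ≤ 3 * (p * n) / 2 ∧
          ‖subsetSum A S - l‖ ≤ (n : ℝ) ^ 4 * Real.exp (-(κ ^ 3 * p * n / m))}
      ≤ ENNReal.ofReal (Real.exp (-(rate κ₀ * (p * n)))) := by
  have hσ := h.sigma_pos
  have hκ := h.kappa_pos
  have hm1 := h.m_ge
  have hm0 : (0 : ℝ) < m := by linarith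
  have hy := h.y_ge'
  have hs1 : 1 ≤ √(m : ℝ) := by rw [Real.one_le_sqrt]; exact hm1
  have hn1 : (1 : ℝ) ≤ n := by exact_mod_cast h.n_pos
  have hn0 : (0 : ℝ) < n := by linarith
  have hpi := Real.pi_gt_three
  have hpi4 := Real.pi_le_four
  set x := κ ^ 3 * p * n with hx
  set ρ := (n : ℝ) ^ 4 * Real.exp (-(x / m)) with hρ
  have hρ0 : 0 < ρ := by positivity
  -- The cap at `sigma D` keeps the weight above `1/2` on the ellipsoid `Q < 1`; division by `y ^ 60
  -- = √n` gives `s² n = r²`.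
  set r := min ρ (sigma D) with hr
  have hr0 : 0 < r := lt_min hρ0 hσ
  set s := r / y ^ 60 with hs
  have hs0 : 0 < s := by positivity
  have hyy : (y ^ 60) ^ 2 = n := by rw [← h.pow_eq]; ring
  have hs2 : s ^ 2 * n = r ^ 2 := by
    rw [hs, div_pow, hyy]; field_simp
  have hx0 : 0 < x := lt_of_lt_of_le (by positivity) h.x_ge
  set E := Real.exp (81 / 80 * x / m) with hE
  have hE1 : 1 ≤ E := Real.one_le_exp (by positivity)
  have hσr : sigma D ≤ r * E := by
    rw [hr]
    rcases le_total ρ (sigma D) with h1 | h1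
    · rw [min_eq_left h1]
      calc sigma D ≤ Real.exp (x / (80 * m)) := h.sigma_le
        _ = 1 * (Real.exp (-(x / m)) * E) := by
            rw [hE, ← Real.exp_add, one_mul]; congr 1; field_simp; norm_num
        _ ≤ (n : ℝ) ^ 4 * (Real.exp (-(x / m)) * E) := by
            gcongr; exact one_le_pow₀ hn1
        _ = ρ * E := by rw [hρ]; ring
    · rw [min_eq_right h1]
      exact le_mul_of_one_le_right hσ.le hE1
  have hσs : sigma D / s ≤ y ^ 60 * E := by
    rw [hs, div_le_iff₀ (by positivity)]
    calc sigma D ≤ r * E := hσr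
      _ = _ := by field_simp
  have hM := integral_gaussWeight (m := m) hs0
  set L := n / s with hL
  have hcore := h.columnsLaw_le h2 (L := L) (w := gaussWeight s)
    (e := (1 / s) ^ m * Real.exp (-(Real.pi * ρ ^ 2 / s ^ 2))) (W := 81 / 80 * x)
    (by
      rw [hL, div_le_div_iff₀ (by positivity) hs0, one_mul]
      have h3 : s ≤ sigma D := by
        rw [hs, div_le_iff₀ (by positivity)]
        calc r ≤ sigma D := min_le_right _ _
          _ ≤ sigma D * y ^ 60 := le_mul_of_one_le_right hσ.le (one_le_pow₀ (by linarith))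
      have h4 : sigma D ≤ sigma D * y ^ 21 :=
        le_mul_of_one_le_right hσ.le (one_le_pow₀ (by linarith))
      calc s ≤ 1 * (2 * 1 * (sigma D * y ^ 21)) := by linarith
        _ ≤ n * (2 * √m * (sigma D * y ^ 21)) := by gcongr)
    (by
      calc L * sigma D = n * (sigma D / s) := by rw [hL]; ring
        _ ≤ n * (y ^ 60 * E) := by gcongr
        _ = y ^ 120 * (y ^ 60 * E) := by rw [h.pow_eq]
        _ = _ := by ring)
    (fun θ _ => ha.le_measureReal (by rw [hV]; trivial))
    (fun θ => (Real.exp_pos _).le) (gaussWeight_le_one s) (integrable_gaussWeight hs0)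
    (by
      intro θ hθ
      have h0 := supNorm_nonneg θ
      have h3 : s ^ 2 * n ≤ sigma D ^ 2 := by
        rw [hs2]; exact pow_le_pow_left₀ hr0.le (min_le_right _ _) 2
      have h4 : ‖θ‖ ^ 2 ≤ m * supNorm θ ^ 2 := by
        have := pow_le_pow_left₀ (norm_nonneg _) (norm_le_sqrt_mul_supNorm θ) 2
        rwa [mul_pow, Real.sq_sqrt hm0.le] at this
      have h5 : 1 ≤ x := (one_le_pow₀ (by linarith)).trans h.x_ge
      have h6 : 1000 * (m : ℝ) ≤ n := by
        rw [← h.pow_eq]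
        refine h.y_ge.trans ?_
        simpa using h.pow_le (a := 1) (b := 120) (by norm_num)
      have h7 : Real.pi * s ^ 2 * ‖θ‖ ^ 2 ≤ 1 / 2 := by
        have h8 : (Real.pi * s ^ 2 * ‖θ‖ ^ 2) * n ≤ 1 / 2 * n := by
          calc (Real.pi * s ^ 2 * ‖θ‖ ^ 2) * n = Real.pi * (s ^ 2 * n) * ‖θ‖ ^ 2 := by ring
            _ ≤ 4 * sigma D ^ 2 * (m * supNorm θ ^ 2) := by gcongr
            _ = 4 * m * (1 * sigma D ^ 2 * supNorm θ ^ 2) := by ring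
            _ ≤ 4 * m * (x * sigma D ^ 2 * supNorm θ ^ 2) := by gcongr
            _ ≤ 4 * m * 4 := by
                gcongr
                nlinarith
            _ ≤ 1 / 2 * n := by linarith
        exact le_of_mul_le_mul_right h8 hn0
      unfold gaussWeight
      have := Real.add_one_le_exp (-(Real.pi * s ^ 2 * ‖θ‖ ^ 2))
      linarith)
    (by positivity)
    (by
      -- This keeps `(81/80) κ³ ≤ 0.0648` under the `13/200` allowed by the tail of the subset size.
      have h3 := ha.le_two_fifths h.one_le hσ hV
      have h4 : κ ^ 3 ≤ (2 / 5) ^ 3 := pow_le_pow_left₀ hκ.le h3 3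
      have h5 : 0 ≤ p * n := by have := h.p_pos; positivity
      have h6 : x ≤ (2 / 5) ^ 3 * (p * n) := by rw [hx, mul_assoc]; gcongr
      norm_num at h6
      linarith)
    le_rfl
    (by
      rw [hM, ← mul_pow]
      have h3 : 1 / s * (√(p * n * m) * (sigma D * y ^ 21)) ≤ y ^ 201 * E := by
        calc 1 / s * (√(p * n * m) * (sigma D * y ^ 21))
            = (sigma D / s) * √(p * n * m) * y ^ 21 := by ring
          _ ≤ (y ^ 60 * E) * y ^ 120 * y ^ 21 := by gcongr; exact h.sqrt_le
          _ = _ := by ring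
      calc _ ≤ (y ^ 201 * E) ^ m := by gcongr
        _ = (y ^ 201) ^ m * Real.exp (81 / 80 * x) := by
            rw [mul_pow, hE, ← Real.exp_nat_mul]; congr 2; field_simp
        _ ≤ Real.exp (201 * y ^ 2) * Real.exp (81 / 80 * x) := by
            gcongr
            exact (h.pow_mul_le 201).trans (le_of_eq (by norm_num))
        _ = _ := (Real.exp_add _ _).symm)
    (by
      rw [hM]
      gcongr
      have h3 : s ^ 2 * n ≤ ρ ^ 2 := by
        rw [hs2]; exact pow_le_pow_left₀ hr0.le (min_le_left _ _) 2
      rw [le_div_iff₀ (by positivity)]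
      nlinarith [sq_nonneg ρ])
    (by
      rw [hM]
      refine (integral_gaussWeight_tail_le hs0 (by positivity)).trans ?_
      have h3 : s ^ 2 * L ^ 2 = n ^ 2 := by rw [hL]; field_simp
      rw [h3]
      calc Real.exp (-(n : ℝ) ^ 2) * (2 / s) ^ m ≤ Real.exp (-(n : ℝ)) * (2 / s) ^ m := by
            gcongr
            nlinarith
        _ = _ := by
          rw [show (2 / s : ℝ) = 2 * (1 / s) by ring, mul_pow]; ring)
  refine (measure_mono ?_).trans hcore
  intro A hA hcon
  apply hA
  intro l hl
  obtain ⟨S, hS1, hS2, hS3⟩ := hcon l hl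
  refine ⟨S, hS1, hS2, ?_⟩
  rw [cosTransform_gaussWeight hs0] at hS3
  have h3 := lt_of_mul_lt_mul_left hS3 (by positivity)
  rw [Real.exp_lt_exp, neg_lt_neg_iff, div_lt_div_iff_of_pos_right (by positivity)] at h3
  have h4 := lt_of_mul_lt_mul_left h3 (by positivity)
  exact (abs_lt_of_sq_lt_sq' h4 hρ0.le).2.le

/-! ### The discrete case -/

theorem sub_mem_integerPoints {x y : Vec m} (hx : x ∈ integerPoints m) (hy : y ∈ integerPoints m) :
    x - y ∈ integerPoints m := by
  intro i
  obtain ⟨a, ha⟩ := hx i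
  obtain ⟨b, hb⟩ := hy i
  exact ⟨a - b, by rw [PiLp.sub_apply, ha, hb]; push_cast; ring⟩

theorem subsetSum_mem_integerPoints {n : ℕ} {A : Fin n → Vec m} (hA : ∀ j, A j ∈ integerPoints m)
    (S : Finset (Fin n)) : subsetSum A S ∈ integerPoints m := by
  choose k hk using hA
  intro i
  refine ⟨∑ j ∈ S, k j i, ?_⟩
  rw [subsetSum, WithLp.ofLp_sum, Finset.sum_apply]
  push_cast
  exact Finset.sum_congr rfl fun j _ => hk j i

/-- With the cube as weight there is no tail beyond `L = 1/2`, the mass is `1`, and the threshold is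
`0`: a positive transform at an integer point means that the point is the origin. -/
theorem Scale.discrete_case {n : ℕ} {D : Measure (Vec m)} [IsProbabilityMeasure D]
    {κ κ₀ p y : ℝ} (h : Scale m n (sigma D) ‖mean D‖ κ κ₀ p y) (h2 : MemLp id 2 D)
    (ha : AntiConcentrated D κ) (hΛ : dualLattice D = integerPoints m) :
    columnsLaw n D {A | ¬ ∀ l ∈ integerPoints m,
        ‖l - (p * n) • mean D‖ ≤ sigma D * p * √(m * n) →
        ∃ S : Finset (Fin n), p * n / 2 ≤ (S.card : ℝ) ∧ (S.card : ℝ) ≤ 3 * (p * n) / 2 ∧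
          subsetSum A S = l}
      ≤ ENNReal.ofReal (Real.exp (-(rate κ₀ * (p * n)))) := by
  have hσ := h.sigma_pos
  have hκ := h.kappa_pos
  have hm1 := h.m_ge
  have hm0 : (0 : ℝ) < m := by linarith
  have hy := h.y_ge'
  have hs1 : 1 ≤ √(m : ℝ) := by rw [Real.one_le_sqrt]; exact hm1
  set x := κ ^ 3 * p * n with hx
  have hx0 : 0 < x := lt_of_lt_of_le (by positivity) h.x_ge
  have hpn0 : 0 ≤ p * n := by have := h.p_pos; positivity
  -- Integrality keeps `sigma D` from being tiny; this puts the scale `r` of the net inside the cube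
  -- and the ellipsoid `Q < 1` inside the support of the weight.
  have hσy : 1 ≤ sigma D ^ 2 * y ^ 42 := by
    have h3 := ha.le_sigma_sq_add h.one_le h2 hσ hκ hΛ
    have h4 : ‖mean D‖ ^ 2 ≤ (sigma D * y ^ 20) ^ 2 :=
      pow_le_pow_left₀ (norm_nonneg _) h.mean_le 2
    have h5 : y ≤ y ^ 40 := by simpa using h.pow_le (a := 1) (b := 40) (by norm_num)
    have h6 := h.m_le
    calc 1 ≤ κ * y := h.one_le_kappa_mul
      _ ≤ (2 * (m * sigma D ^ 2 + ‖mean D‖ ^ 2)) * y := by gcongr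
      _ ≤ (2 * (y ^ 40 * sigma D ^ 2 + (sigma D * y ^ 20) ^ 2)) * y := by
          gcongr; linarith
      _ = 4 * (sigma D ^ 2 * y ^ 41) := by ring
      _ ≤ y * (sigma D ^ 2 * y ^ 41) := by gcongr; linarith
      _ = _ := by ring
  have hB1 : 1 ≤ sigma D * y ^ 21 := by
    have : (1 : ℝ) ^ 2 ≤ (sigma D * y ^ 21) ^ 2 := by
      rw [one_pow]; calc (1 : ℝ) ≤ _ := hσy
        _ = _ := by ring
    exact (abs_le_of_sq_le_sq' this (by positivity)).2
  have hcore := h.columnsLaw_le h2 (L := 1 / 2) (w := cubeWeight) (e := 0) (W := x / 80)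
    (by
      rw [div_le_div_iff₀ (by positivity) (by norm_num)]
      calc (1 : ℝ) * 2 = 1 * (2 * 1 * 1) := by ring
        _ ≤ 1 * (2 * √m * (sigma D * y ^ 21)) := by gcongr)
    (by
      calc 1 / 2 * sigma D ≤ 1 * Real.exp (x / (80 * m)) := by
            gcongr
            · norm_num
            · exact h.sigma_le
        _ ≤ y ^ 180 * Real.exp (81 / 80 * x / m) := by
            gcongr
            · exact one_le_pow₀ (by linarith)
            · linarith
            · linarith)
    (fun θ hθ => ha.le_measureReal (mem_fundDomain_of_supNorm_le hΛ hθ))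
    (fun θ => Set.indicator_nonneg (fun _ _ => zero_le_one) θ)
    (fun θ => Set.indicator_le_self' (fun _ _ => zero_le_one) θ)
    integrable_cubeWeight
    (by
      intro θ hθ
      have h0 := supNorm_nonneg θ
      have h3 : 100 ≤ x * sigma D ^ 2 := by
        have h4 : (100 : ℝ) ≤ y ^ 45 := by
          calc (100 : ℝ) ≤ y := by linarith
            _ ≤ y ^ 45 := by simpa using h.pow_le (a := 1) (b := 45) (by norm_num)
        calc (100 : ℝ) ≤ y ^ 45 * 1 := by linarith
          _ ≤ y ^ 45 * (sigma D ^ 2 * y ^ 42) := by gcongr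
          _ = y ^ 87 * sigma D ^ 2 := by ring
          _ ≤ x * sigma D ^ 2 := by gcongr; exact h.x_ge
      have h5 : supNorm θ ≤ 1 / 2 := by
        by_contra hcon
        push Not at hcon
        have h6 : (1 / 2) ^ 2 ≤ supNorm θ ^ 2 := by gcongr
        nlinarith
      have h7 : cubeWeight θ = 1 := Set.indicator_of_mem (by exact h5) _
      rw [h7]; norm_num)
    le_rfl (by linarith [h.x_le]) (by linarith)
    (by
      rw [integral_cubeWeight, one_mul]
      calc (√(p * n * m) * (sigma D * y ^ 21)) ^ m
          ≤ (y ^ 120 * (Real.exp (x / (80 * m)) * y ^ 21)) ^ m := by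
            gcongr
            · exact h.sqrt_le
            · exact h.sigma_le
        _ = (y ^ 141) ^ m * Real.exp (x / 80) := by
            rw [show y ^ 120 * (Real.exp (x / (80 * m)) * y ^ 21)
              = y ^ 141 * Real.exp (x / (80 * m)) by ring, mul_pow, ← Real.exp_nat_mul]
            congr 2; field_simp
        _ ≤ (y ^ 201) ^ m * Real.exp (x / 80) := by
            gcongr ?_ ^ m * _
            exact h.pow_le (by norm_num)
        _ ≤ Real.exp (201 * y ^ 2) * Real.exp (x / 80) := by
            gcongr
            exact (h.pow_mul_le 201).trans (le_of_eq (by norm_num))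
        _ = _ := (Real.exp_add _ _).symm)
    (by rw [integral_cubeWeight]; positivity)
    (by rw [integral_cubeWeight_tail, integral_cubeWeight]; positivity)
  have hint : ∀ᵐ A ∂(columnsLaw n D), ∀ j, A j ∈ integerPoints m := by
    rw [ae_all_iff]
    intro j
    exact (measurePreserving_eval (fun _ : Fin n => D) j).quasiMeasurePreserving.ae
      (ae_mem_integerPoints hΛ)
  refine (measure_mono_ae ?_).trans hcore
  filter_upwards [hint] with A hAint hA hcon
  apply hA
  intro l hlint hl
  obtain ⟨S, hS1, hS2, hS3⟩ := hcon l hl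
  refine ⟨S, hS1, hS2, ?_⟩
  by_contra hne
  rw [cosTransform_cubeWeight
    (sub_mem_integerPoints (subsetSum_mem_integerPoints hAint S) hlint) (sub_ne_zero.mpr hne)] at hS3
  exact lt_irrefl _ hS3

end RandomDisc

end

theorem theorem3 :
    ∃ K : ℕ, ∀ κ₀ : ℝ, 0 < κ₀ → ∃ C c : ℝ, 0 < C ∧ 0 < c ∧
      ∀ (m n : ℕ) (D : Measure (RandomDisc.Vec m)) [IsProbabilityMeasure D] (κ p : ℝ),
        1 ≤ m →
        -- the mean and the covariance exist, and the covariance is nonzero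
        MemLp id 2 D →
        0 < RandomDisc.sigma D →
        RandomDisc.Admissible D →
        κ₀ ≤ κ →
        RandomDisc.AntiConcentrated D κ →
        0 ≤ p → p ≤ 1 →
        p ≤ κ ^ 4 / (1000 * (m : ℝ) ^ 5) →
        C * ((m : ℝ) ^ (3 / 4 : ℝ) *
            (‖RandomDisc.mean D‖ / RandomDisc.sigma D + 1) ^ (3 / 2 : ℝ) *
            (n : ℝ) ^ (-(1 / 4) : ℝ)) ≤ p →
        C * (m : ℝ) ^ K ≤ (n : ℝ) →
        RandomDisc.sigma D * Real.sqrt ((m : ℝ) / κ) + ‖RandomDisc.mean D‖ ≤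
            Real.exp (κ ^ 3 * p * n / (80 * m)) →
        (1 + ‖RandomDisc.mean D‖ ^ 2 / RandomDisc.sigma D ^ 2) ^ (1 / (m : ℝ)) ≤
            κ ^ 3 * Real.exp (κ ^ 3 / (3 * 80 ^ 2 * p * (m : ℝ) ^ 3)) / (50000 * (m : ℝ) ^ 2) →
        -- continuous case
        (RandomDisc.fundDomain D = Set.univ →
          RandomDisc.columnsLaw n D {A | ¬ ∀ l : RandomDisc.Vec m,
              ‖l - (p * n) • RandomDisc.mean D‖ ≤
                RandomDisc.sigma D * p * Real.sqrt ((m : ℝ) * n) →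
              ∃ S : Finset (Fin n),
                p * n / 2 ≤ (S.card : ℝ) ∧ (S.card : ℝ) ≤ 3 * (p * n) / 2 ∧
                ‖RandomDisc.subsetSum A S - l‖ ≤ (n : ℝ) ^ 4 * Real.exp (-(κ ^ 3 * p * n / m))}
            ≤ ENNReal.ofReal (Real.exp (-(c * (p * n))))) ∧
        -- discrete case
        (RandomDisc.dualLattice D = RandomDisc.integerPoints m →
          RandomDisc.columnsLaw n D {A | ¬ ∀ l ∈ RandomDisc.integerPoints m,
              ‖l - (p * n) • RandomDisc.mean D‖ ≤
                RandomDisc.sigma D * p * Real.sqrt ((m : ℝ) * n) →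
              ∃ S : Finset (Fin n),
                p * n / 2 ≤ (S.card : ℝ) ∧ (S.card : ℝ) ≤ 3 * (p * n) / 2 ∧
                RandomDisc.subsetSum A S = l}
            ≤ ENNReal.ofReal (Real.exp (-(c * (p * n))))) := by
  -- With `y = n^{1/120}`, these values of `K` and `C` turn `C m^K ≤ n` into `(1000/κ₀²) m ≤ y`, so
  -- that small powers of `y` absorb `m`, `1/κ` and the numerical constants.
  refine ⟨120, fun κ₀ hκ₀ => ⟨(1000 / κ₀ ^ 2) ^ 120, RandomDisc.Scale.rate κ₀, by positivity,
    by unfold RandomDisc.Scale.rate; positivity, ?_⟩⟩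
  intro m n D _ κ p hm h2 hσ _ hκ ha _ hp1 hp hpn hn hexp _
  obtain ⟨y, h⟩ := RandomDisc.exists_scale hm hσ (norm_nonneg (RandomDisc.mean D)) hκ₀ hκ
    ha.le_one hp1 hp hpn hn hexp
  exact ⟨h.continuous_case h2 ha, h.discrete_case h2 ha⟩
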